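/- Consider the deterministic LOCAL model: the network is a finite simple graph $G=(V,E)$ with $n$ nodes and maximum degree $\Delta$; the nodes have distinct identifiers from $\{1,\dots,n^c\}$, where $c\ge 1$ is a fixed integer; initially each node knows its identifier, its degree, $\Delta$ and $n$; in each synchronous round every node sends a message to each of its neighbors, receives their messages and updates its state, with no restriction on message size or local computation. For integers $p\ge q\ge 1$, a $(p:q)$-coloring of $G$ assigns to each node $v$ a set $X_v\subseteq\{1,\dots,p\}$ with $|X_v|\ge q$ such that $X_u\cap X_v=\emptyset$ for every edge $\{u,v\}$; a fractional $r$-coloring is a $(p:q)$-coloring with $p/q\le r$. Theorem. There is a function $T(\varepsilon,\Delta)\in\mathbb N$, independent of $n$ and $c$, such that for every real $\varepsilon>0$ and every integer $c\ge 1$ there is a deterministic LOCAL algorithm that, on every graph $G$ with maximum degree $\Delta\ge 3$ which, in case $\varepsilon<1$, contains no clique on $\Delta+1$ nodes, computes a fractional $(\Delta+\varepsilon)$-coloring of $G$ in $T(\varepsilon,\Delta)$ rounds, where, uniformly in all $\varepsilon>0$ and $\Delta\ge 3$, \[ T(\varepsilon,\Delta)= O\!\left(\Big(\log\Delta+\frac{\log^2(1/\varepsilon)}{\log\Delta}\Big)\cdot\log\frac{\Delta}{\varepsilon}\right)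 \quad\text{and}\quad T(\varepsilon,\Delta)= O\!\left(\log^2\Delta+\log^2\frac1\varepsilon+\frac{\log^3(1/\varepsilon)}{\log\Delta}\right). \] Here $O(f)$ stands for $O(\max\{1,f\})$, which matters only for $\varepsilon>1$; for $0<\varepsilon\le 1$ the two bounds are of the same order, that is, each is at most a universal constant times the other. In particular, for every constant $a>0$ we have $T(\varepsilon,\Delta)=O(\log^2\Delta)$ uniformly over all $\Delta\ge 3$ and $\varepsilon>1/\Delta^{a}$, with the implied constant depending only on $a$. -/

import Mathlib

universe u

/-- A deterministic algorithm in the LOCAL model with local outputs in `Out`.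
The sizes of states and messages and the local computation are unrestricted. -/
structure LocalAlgorithm (Out : Type) where
  State : Type
  Msg : Type
  /-- `init n Δ i d` is the initial state of a node with identifier `i` and degree `d` in a
  network with `n` nodes and maximum degree `Δ`; nothing else is known initially. -/
  init : (n Δ i d : ℕ) → State
  /-- `send s j` is the message that a node in state `s` sends through its port `j`. -/
  send : State → ℕ → Msg
  /-- The new state after receiving the given messages, listed in the order of the ports. -/
  receive : State → List Msg → State
  output : State → Out

/-- A port numbering: every node numbers its incident edges by `0, …, deg - 1`, arbitrarily and
independently of the other nodes; `port v j` is the neighbour of `v` behind its port `j`. -/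
abbrev PortNumbering {V : Type u} [Fintype V] (G : SimpleGraph V) [DecidableRel G.Adj] :=
  (v : V) → Fin (G.degree v) ≃ G.neighborSet v

namespace LocalAlgorithm

variable {Out : Type} {V : Type u} [Fintype V]

/-- The state of each node after `t` synchronous rounds. In a round, every node sends one message
through each of its ports, and then updates its state by the messages from all its neighbours. -/
def stateAfter (A : LocalAlgorithm Out) (G : SimpleGraph V) [DecidableRel G.Adj]
    (port : PortNumbering G) (ident : V → ℕ) : ℕ → V → A.State
  | 0, v => A.init (Fintype.card V) G.maxDegree (ident v) (G.degree v)
  | t + 1, v =>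
    A.receive (stateAfter A G port ident t v)
      (List.ofFn fun j : Fin (G.degree v) =>
        let w : G.neighborSet v := port v j
        A.send (stateAfter A G port ident t w.1) ((port w.1).symm ⟨v, w.2.symm⟩ : ℕ))

/-- The local outputs after `t` rounds. -/
def outputAfter (A : LocalAlgorithm Out) (G : SimpleGraph V) [DecidableRel G.Adj]
    (port : PortNumbering G) (ident : V → ℕ) (t : ℕ) (v : V) : Out :=
  A.output (A.stateAfter G port ident t v)

end LocalAlgorithm

/-- An assignment of distinct identifiers from `{1, …, n ^ c}`, where `n` is the number of nodes. -/
def IsIdAssignment {V : Type u} [Fintype V] (c : ℕ) (ident : V → ℕ) : Prop :=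
  Function.Injective ident ∧ ∀ v, 1 ≤ ident v ∧ ident v ≤ Fintype.card V ^ c

/-- `X` is a `(p : q)`-coloring of `G`. -/
def IsPQColoring {V : Type u} (G : SimpleGraph V) (p q : ℕ) (X : V → Finset ℕ) : Prop :=
  1 ≤ q ∧ q ≤ p ∧ (∀ v, X v ⊆ Finset.Icc 1 p) ∧ (∀ v, q ≤ (X v).card) ∧
    ∀ v w, G.Adj v w → Disjoint (X v) (X w)

/-- `X` is a fractional `r`-coloring of `G`: a `(p : q)`-coloring with `p / q ≤ r`. -/
def IsFractionalColoring {V : Type u} (G : SimpleGraph V) (r : ℝ) (X : V → Finset ℕ) : Prop :=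
  ∃ p q : ℕ, IsPQColoring G p q X ∧ (p : ℝ) / (q : ℝ) ≤ r

/-! Randomness is traded for fractionality. Suppose a random process yields, for every seed, a
proper partial colouring with `Δ` colours, and leaves each single node uncoloured with probability
at most `ε / (Δ + ε)`. Using pairs (seed, colour) as colours, each node gets enough of them for a
fractional `(Δ + ε)`-coloring (`isFractionalColoring_of_prob`). The seeds are functions of the
identifiers, from a finite space that is known to all nodes, and messages are unbounded, so all
seeds are run in parallel in the rounds of one run. Only the failure probability of one node
matters, never a union bound over all nodes; this is why the time does not depend on `n` or `c`.

For `ε < 1` the partial colouring rests on a dichotomy. Call a set flexible if it can be coloured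
after everything outside it. A node of degree below `Δ` is flexible, and so is an even cycle whose
nodes do not form a clique (`flexible_of_chain`). If a ball of radius `g` contains no flexible set,
then it is nearly a tree: parents in the distance layering are unique and every node has at least `Δ
- 1` grandchildren, so the ball has at least `(Δ - 1) ^ k` nodes for `2 * k ≤ g`
(`Rigid.pow_le_card_ball`).

Nodes are removed at random with probability `1 / Q`. A ball without flexible sets most likely
contains a removed node; the other nodes are centres, and a ruling set of them, found through random
labels, selects flexible sets that neither meet nor touch. Removed nodes and selected sets form the
base. With probability at least `1 - 1 / Q` a node is within distance `R` of the base
(`Params.prob_not_within_le`). Layers of equal distance to the base are coloured from the outside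
inwards by random trials. A node whose turn it is still has an uncoloured neighbour closer to the
base, hence a spare colour, so each trial succeeds with probability at least `1 / 4`
(`prob_trial_le`). The selected flexible sets are coloured at the end. In total a node fails with
probability at most `3 / Q`, where `Q = Δ ^ k` and `k` is about `3 + log (1 / ε) / log Δ`; the time
is dominated by `R * K`, of order `k ^ 3 * log Δ ^ 2`.

For `ε ≥ 1` a random order suffices: a node precedes all its neighbours with probability at least `1
/ (Δ + 1)`, and one round decides this. -/

/-! ### Views and the full-information algorithm. -/

/-- What a node has seen of its network: its initial knowledge, extended in every round by the
views of its neighbours. -/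
inductive View : Type
  | leaf (n Δ i d : ℕ) : View
  | node (s : View) (l : List View) : View

namespace View

/-- The number of nodes, as known from a view. -/
def size : View → ℕ
  | leaf n _ _ _ => n
  | node s _ => s.size

/-- The maximum degree, as known from a view. -/
def maxDeg : View → ℕ
  | leaf _ Δ _ _ => Δ
  | node s _ => s.maxDeg

variable {V : Type u} [Fintype V]

/-- The view of each node after `t` rounds. -/
def after (G : SimpleGraph V) [DecidableRel G.Adj] (port : PortNumbering G) (ident : V → ℕ) :
    ℕ → V → View
  | 0, v => leaf (Fintype.card V) G.maxDegree (ident v) (G.degree v)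
  | t + 1, v => node (after G port ident t v)
      (List.ofFn fun j : Fin (G.degree v) => after G port ident t (port v j).1)

theorem size_after (G : SimpleGraph V) [DecidableRel G.Adj] (port : PortNumbering G)
    (ident : V → ℕ) (t : ℕ) (v : V) : (after G port ident t v).size = Fintype.card V := by
  induction t with
  | zero => rfl
  | succ t ih => exact ih

theorem maxDeg_after (G : SimpleGraph V) [DecidableRel G.Adj] (port : PortNumbering G)
    (ident : V → ℕ) (t : ℕ) (v : V) : (after G port ident t v).maxDeg = G.maxDegree := by
  induction t with
  | zero => rfl
  | succ t ih => exact ih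

end View

/-- The algorithm that forwards complete views and evaluates `out` in the end. -/
def gatherAlgorithm {Out : Type} (out : View → Out) : LocalAlgorithm Out where
  State := View
  Msg := View
  init := View.leaf
  send s _ := s
  receive := View.node
  output := out

theorem gatherAlgorithm_outputAfter {Out : Type} (out : View → Out) {V : Type u} [Fintype V]
    (G : SimpleGraph V) [DecidableRel G.Adj] (port : PortNumbering G) (ident : V → ℕ)
    (t : ℕ) (v : V) :
    (gatherAlgorithm out).outputAfter G port ident t v = out (View.after G port ident t v) := by
  have h : ∀ t v, (gatherAlgorithm out).stateAfter G port ident t v =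
      View.after G port ident t v := by
    intro t
    induction t with
    | zero => intro v; rfl
    | succ t ih =>
      intro v
      simp only [LocalAlgorithm.stateAfter, View.after, ih]
      rfl
  simp only [LocalAlgorithm.outputAfter, h]
  rfl

/-! ### Calculus of node functions computable in a given number of rounds. -/

/-- The node function `f` on graphs with nodes in `Fin N` can be computed from the views after
`t` rounds, if the nodes of the network are identified with their identifiers. -/
def IsLocal {N : ℕ} {X : Type} (t : ℕ) (f : SimpleGraph (Fin N) → Fin N → X) : Prop :=
  ∃ D : View → X, ∀ (V : Type u) [Fintype V] (G : SimpleGraph V) [DecidableRel G.Adj]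
    (port : PortNumbering G) (e : V ↪ Fin N) (v : V),
    f (G.map e) (e v) = D (View.after G port (fun w => (e w : ℕ)) t v)

namespace IsLocal

variable {N : ℕ} {X Y Z : Type} {s t : ℕ}

theorem const (x : X) : IsLocal.{u} t (fun (_ : SimpleGraph (Fin N)) _ => x) :=
  ⟨fun _ => x, fun _ _ _ _ _ _ _ => rfl⟩

theorem comp {f : SimpleGraph (Fin N) → Fin N → X} (φ : X → Y) (hf : IsLocal.{u} t f) :
    IsLocal.{u} t (fun G i => φ (f G i)) := by
  obtain ⟨D, hD⟩ := hf
  exact ⟨fun w => φ (D w), fun V _ G _ port e v => congrArg φ (hD V G port e v)⟩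

theorem comp₂ {f : SimpleGraph (Fin N) → Fin N → X} {g : SimpleGraph (Fin N) → Fin N → Y}
    (φ : X → Y → Z) (hf : IsLocal.{u} t f) (hg : IsLocal.{u} t g) :
    IsLocal.{u} t (fun G i => φ (f G i) (g G i)) := by
  obtain ⟨D, hD⟩ := hf
  obtain ⟨E, hE⟩ := hg
  exact ⟨fun w => φ (D w) (E w), fun V _ G _ port e v =>
    congrArg₂ φ (hD V G port e v) (hE V G port e v)⟩

/-- With unrestricted messages, a whole family of computations costs no more rounds than one. This
is what allows running all seeds simultaneously. -/
theorem pi {ι : Type} {f : ι → SimpleGraph (Fin N) → Fin N → X}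
    (hf : ∀ a, IsLocal.{u} t (f a)) : IsLocal.{u} t (fun G i a => f a G i) := by
  choose D hD using hf
  exact ⟨fun w a => D a w, fun V _ G _ port e v => funext fun a => hD a V G port e v⟩

theorem succ {f : SimpleGraph (Fin N) → Fin N → X} (hf : IsLocal.{u} t f) :
    IsLocal.{u} (t + 1) f := by
  obtain ⟨D, hD⟩ := hf
  refine ⟨fun w => match w with | .leaf n Δ i d => D (.leaf n Δ i d) | .node s _ => D s, ?_⟩
  intro V _ G _ port e v
  rw [hD V G port e v]
  rfl

theorem mono {f : SimpleGraph (Fin N) → Fin N → X} (hf : IsLocal.{u} s f) (h : s ≤ t) :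
    IsLocal.{u} t f := by
  induction h with
  | refl => exact hf
  | step _ ih => exact ih.succ

theorem ident [NeZero N] : IsLocal.{u} t (fun (_ : SimpleGraph (Fin N)) i => i) := by
  refine mono (s := 0) ⟨fun w => match w with
    | .leaf _ _ i _ => Fin.ofNat N i | .node _ _ => 0, ?_⟩ (Nat.zero_le _)
  intro V _ G _ port e v
  simp [View.after, Fin.ofNat, Nat.mod_eq_of_lt]

open Classical in
/-- In one more round a node learns the values of its neighbours. -/
theorem nbr [NeZero N] {f : SimpleGraph (Fin N) → Fin N → X} (hf : IsLocal.{u} t f) :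
    IsLocal.{u} (t + 1) (fun G i j => if G.Adj i j then some (f G j) else none) := by
  obtain ⟨D, hD⟩ := comp₂ (fun (i : Fin N) (x : X) => (i, x)) ident hf
  refine ⟨fun w j => match w with
    | .leaf _ _ _ _ => none
    | .node _ l => if h : ∃ x, (j, x) ∈ l.map D then some h.choose else none, ?_⟩
  intro V _ G _ port e v
  funext j
  -- The views received in the last round contain exactly the pairs (identifier, value) of the
  -- neighbours. As identifiers are distinct, the first component determines the second.
  have key : ∀ x, (j, x) ∈ (List.ofFn fun k : Fin (G.degree v) =>
      View.after G port (fun w => (e w : ℕ)) t (port v k).1).map D ↔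
      (G.map e).Adj (e v) j ∧ f (G.map e) j = x := by
    intro x
    simp only [List.mem_map, List.mem_ofFn, exists_exists_eq_and]
    constructor
    · rintro ⟨k, hk⟩
      rw [← hD V G port e] at hk
      simp only [Prod.mk.injEq] at hk
      obtain ⟨h1, h2⟩ := hk
      subst h1
      exact ⟨(SimpleGraph.map_adj_apply).2 (port v k).2, h2⟩
    · rintro ⟨h1, h2⟩
      rw [SimpleGraph.map_adj] at h1
      obtain ⟨a, w, haw, ha, hw⟩ := h1
      obtain rfl := e.injective ha
      refine ⟨(port a).symm ⟨w, haw⟩, ?_⟩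
      rw [Equiv.apply_symm_apply, ← hD V G port e]
      simp [hw, h2]
  simp only [View.after]
  simp only [key]
  split_ifs with h1 h2 h2
  · exact congrArg some h2.choose_spec.2
  · exact absurd ⟨_, h1, rfl⟩ h2
  · exact absurd h2.choose_spec.1 h1
  · rfl

theorem exists_nbr [NeZero N] {p : SimpleGraph (Fin N) → Fin N → Prop} (hp : IsLocal.{u} t p) :
    IsLocal.{u} (t + 1) (fun G i => ∃ j, G.Adj i j ∧ p G j) := by
  classical
  have := comp (fun F : Fin N → Option Prop => ∃ j, ∃ q, F j = some q ∧ q) (nbr hp)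
  refine Eq.mp (congrArg _ ?_) this
  funext G i
  simp only [Option.ite_none_right_eq_some, Option.some.injEq, eq_iff_iff]
  exact ⟨fun ⟨j, q, ⟨h, h'⟩, hq⟩ => ⟨j, h, h'.2 hq⟩, fun ⟨j, h, hq⟩ => ⟨j, _, ⟨h, Iff.rfl⟩, hq⟩⟩

end IsLocal

/-! ### Balls and the information gathered from them. -/

/-- `Near G r i j`: the distance of `i` and `j` is at most `r`. -/
def Near {V : Type*} (G : SimpleGraph V) : ℕ → V → V → Prop
  | 0, i, j => i = j
  | r + 1, i, j => Near G r i j ∨ ∃ k, G.Adj i k ∧ Near G r k j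

namespace Near

variable {V : Type*} {G : SimpleGraph V} {r s : ℕ} {i j k : V}

theorem refl (i : V) : Near G r i i := by
  induction r with
  | zero => rfl
  | succ r ih => exact Or.inl ih

theorem succ (h : Near G r i j) : Near G (r + 1) i j := Or.inl h

theorem mono (h : Near G r i j) (hrs : r ≤ s) : Near G s i j := by
  induction hrs with
  | refl => exact h
  | step _ ih => exact ih.succ

theorem cons (h : G.Adj i j) (hj : Near G r j k) : Near G (r + 1) i k := Or.inr ⟨j, h, hj⟩

theorem trans (h : Near G r i j) (h' : Near G s j k) : Near G (r + s) i k := by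
  induction r generalizing i with
  | zero => obtain rfl : i = j := h; simpa using h'
  | succ r ih =>
    rw [Nat.add_right_comm]
    obtain h | ⟨l, hl, h⟩ := h
    · exact (ih h).succ
    · exact cons hl (ih h)

theorem of_adj (h : G.Adj i j) : Near G 1 i j := cons h rfl

theorem snoc (h : Near G r i j) (hj : G.Adj j k) : Near G (r + 1) i k := h.trans (of_adj hj)

theorem symm (h : Near G r i j) : Near G r j i := by
  induction r generalizing i with
  | zero => exact Eq.symm h
  | succ r ih =>
    obtain h | ⟨l, hl, h⟩ := h
    · exact (ih h).succ
    · exact (ih h).snoc hl.symm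

theorem exists_of_succ (h : Near G (r + 1) i k) :
    Near G r i k ∨ ∃ j, Near G r i j ∧ G.Adj j k := by
  obtain h | ⟨j, hj, h⟩ := h.symm
  · exact Or.inl h.symm
  · exact Or.inr ⟨j, h.symm, hj.symm⟩

end Near

namespace IsLocal

variable {N : ℕ} {X Y Z : Type} {s t r : ℕ}

theorem exists_near [NeZero N] {p : SimpleGraph (Fin N) → Fin N → Prop} (hp : IsLocal.{u} t p) :
    IsLocal.{u} (t + r) (fun G i => ∃ j, Near G r i j ∧ p G j) := by
  induction r with
  | zero =>
    refine Eq.mp (congrArg _ ?_) hp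
    funext G i
    simp [Near]
  | succ r ih =>
    refine Eq.mp (congrArg _ ?_) (comp₂ (· ∨ ·) ih.succ (exists_nbr ih))
    funext G i
    simp only [Near, eq_iff_iff]
    constructor
    · rintro (⟨j, h, hj⟩ | ⟨k, hk, j, h, hj⟩)
      · exact ⟨j, Or.inl h, hj⟩
      · exact ⟨j, Or.inr ⟨k, hk, h⟩, hj⟩
    · rintro ⟨j, h | ⟨k, hk, h⟩, hj⟩
      · exact Or.inl ⟨j, h, hj⟩
      · exact Or.inr ⟨k, hk, j, h, hj⟩

/-- In `r` more rounds a node learns the values of all nodes at distance at most `r`. -/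
theorem ball [NeZero N] {f : SimpleGraph (Fin N) → Fin N → X} (hf : IsLocal.{u} t f) :
    IsLocal.{u} (t + r) (fun G i (p : Fin N × X) => Near G r i p.1 ∧ f G p.1 = p.2) := by
  refine pi fun p => ?_
  refine Eq.mp (congrArg _ ?_)
    (exists_near (r := r) (comp₂ (fun (j : Fin N) (x : X) => j = p.1 ∧ x = p.2) ident hf))
  funext G i
  simp only [eq_iff_iff]
  exact ⟨fun ⟨j, h, hj, hx⟩ => by subst hj; exact ⟨h, hx⟩, fun ⟨h, hx⟩ => ⟨p.1, h, rfl, hx⟩⟩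

theorem adj [NeZero N] : IsLocal.{u} 1 (fun (G : SimpleGraph (Fin N)) i j => G.Adj i j) := by
  classical
  refine Eq.mp (congrArg _ ?_)
    (comp (fun F : Fin N → Option Unit => fun j => F j = some ()) (nbr (const (t := 0) ())))
  funext G i j
  simp

/-- A node function that depends only on values and adjacencies at nodes at distance at most `r`. -/
theorem of_ball [NeZero N] {f : SimpleGraph (Fin N) → Fin N → X}
    (hf : IsLocal.{u} t f) (ht : 1 ≤ t) (F : SimpleGraph (Fin N) → (Fin N → X) → Fin N → Y)
    (hF : ∀ G G' x x' i, (∀ j, Near G r i j → x j = x' j ∧ ∀ k, G.Adj j k ↔ G'.Adj j k) →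
      F G x i = F G' x' i) :
    IsLocal.{u} (t + r) (fun G i => F G (f G) i) := by
  classical
  have h1 := ball (r := r) (comp₂ Prod.mk hf (adj.mono ht))
  -- The node rebuilds a graph from the adjacency lists it has seen. It agrees with the true one at
  -- the nodes of the ball. Unseen nodes get the value `f ⊥ i`, an arbitrary element of `X`.
  let graphOf : (Fin N × (X × (Fin N → Prop)) → Prop) → SimpleGraph (Fin N) := fun S =>
    SimpleGraph.fromRel fun j k => ∃ y, S (j, y) ∧ y.2 k
  have h2 := comp₂ (fun (i : Fin N) (S : Fin N × (X × (Fin N → Prop)) → Prop) =>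
    F (graphOf S) (fun j => if h : ∃ y, S (j, y) then h.choose.1 else f ⊥ i) i) ident h1
  refine Eq.mp (congrArg _ ?_) h2
  funext G i
  refine (hF _ _ _ _ _ fun j hj => ⟨?_, fun k => ?_⟩).symm
  · have h : ∃ y, Near G r i (j, y).1 ∧ (f G (j, y).1, fun k => G.Adj (j, y).1 k) = (j, y).2 :=
      ⟨(f G j, fun k => G.Adj j k), hj, rfl⟩
    rw [dif_pos h]
    exact congrArg Prod.fst h.choose_spec.2
  · simp only [graphOf, SimpleGraph.fromRel_adj]
    constructor
    · exact fun h => ⟨h.ne, Or.inl ⟨_, ⟨hj, rfl⟩, h⟩⟩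
    · rintro ⟨_, ⟨y, ⟨_, rfl⟩, h⟩ | ⟨y, ⟨_, rfl⟩, h⟩⟩
      · exact h
      · exact h.symm

end IsLocal

/-! ### Colouring even cycles from lists as large as the degrees. -/

section ListColoring

open scoped Classical

variable {V : Type*} {K : Type*}

/-- The number of neighbours of `v` in `F`. -/
noncomputable def degIn (G : SimpleGraph V) (F : Finset V) (v : V) : ℕ :=
  (F.filter fun w => G.Adj v w).card

/-- `F` can be properly coloured from the lists `L`. -/
def ListColorable (G : SimpleGraph V) (F : Finset V) (L : V → Finset K) : Prop :=
  ∃ c : V → K, (∀ v ∈ F, c v ∈ L v) ∧ ∀ v ∈ F, ∀ w ∈ F, G.Adj v w → c v ≠ c w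

variable {G : SimpleGraph V}

theorem degIn_mono {F F' : Finset V} (h : F ⊆ F') (v : V) : degIn G F v ≤ degIn G F' v :=
  Finset.card_le_card (Finset.filter_subset_filter _ h)

/-- A cyclic sequence of `n` distinct nodes in which consecutive nodes are adjacent. -/
structure IsCyclicSeq (G : SimpleGraph V) (n : ℕ) (c : ℕ → V) : Prop where
  eq_iff : ∀ j k, c j = c k ↔ j ≡ k [MOD n]
  adj : ∀ j, G.Adj (c j) (c (j + 1))

namespace IsCyclicSeq

variable {n : ℕ} {c : ℕ → V}

theorem rotate (h : IsCyclicSeq G n c) (i : ℕ) : IsCyclicSeq G n (fun j => c (i + j)) where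
  eq_iff j k := by
    rw [h.eq_iff]
    exact ⟨Nat.ModEq.add_left_cancel' i, Nat.ModEq.add_left i⟩
  adj j := h.adj (i + j)

theorem exists_lt (h : IsCyclicSeq G n c) (hn : 0 < n) (j : ℕ) : ∃ k < n, c k = c j :=
  ⟨j % n, Nat.mod_lt _ hn, (h.eq_iff _ _).2 (Nat.mod_modEq j n)⟩

theorem eq_of_lt (h : IsCyclicSeq G n c) {j k : ℕ} (hj : j < n) (hk : k < n) (e : c j = c k) :
    j = k :=
  Nat.ModEq.eq_of_lt_of_lt ((h.eq_iff _ _).1 e) hj hk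

theorem exists_rank (h : IsCyclicSeq G n c) (φ : ℕ → ℕ) : ∃ ρ : V → ℕ, ∀ j < n, ρ (c j) = φ j := by
  refine ⟨fun v => if hv : ∃ j < n, c j = v then φ hv.choose else 0, fun j hj => ?_⟩
  have hv : ∃ k < n, c k = c j := ⟨j, hj, rfl⟩
  beta_reduce
  rw [dif_pos hv, h.eq_of_lt hv.choose_spec.1 hj hv.choose_spec.2]

end IsCyclicSeq

variable [DecidableEq V] [DecidableEq K]

theorem degIn_sdiff_lt {F P : Finset V} {v p : V} (hp : p ∈ P) (hpF : p ∈ F) (h : G.Adj v p) :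
    degIn G (F \ P) v < degIn G F v := by
  refine Finset.card_lt_card ⟨Finset.filter_subset_filter _ Finset.sdiff_subset, fun hs => ?_⟩
  have := hs (Finset.mem_filter.2 ⟨hpF, h⟩)
  simp [hp] at this

theorem degIn_sdiff_add_two_le {F P : Finset V} {v p q : V} (hp : p ∈ P) (hpF : p ∈ F)
    (h : G.Adj v p) (hq : q ∈ P) (hqF : q ∈ F) (hpq : p ≠ q) (h' : G.Adj v q) :
    degIn G (F \ P) v + 2 ≤ degIn G F v := by
  have h1 : degIn G (F \ P) v ≤ degIn G ((F \ {p}) \ {q}) v := by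
    refine Finset.card_le_card (Finset.filter_subset_filter _ fun x hx => ?_)
    simp only [Finset.mem_sdiff, Finset.mem_singleton] at hx ⊢
    exact ⟨⟨hx.1, fun e => hx.2 (e ▸ hp)⟩, fun e => hx.2 (e ▸ hq)⟩
  have h2 : degIn G ((F \ {p}) \ {q}) v < degIn G (F \ {p}) v :=
    degIn_sdiff_lt (Finset.mem_singleton_self q) (by simp [hqF, hpq.symm]) h'
  have h3 : degIn G (F \ {p}) v < degIn G F v :=
    degIn_sdiff_lt (Finset.mem_singleton_self p) hpF h
  omega

/-- The lists that remain after an independent set `P` was coloured with `x`. -/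
noncomputable def listAfter (G : SimpleGraph V) (P : Finset V) (x : K) (L : V → Finset K) (v : V) :
    Finset K :=
  if ∃ p ∈ P, G.Adj v p then (L v).erase x else L v

theorem ListColorable.of_sdiff {F P : Finset V} {L : V → Finset K} {x : K} (hx : ∀ p ∈ P, x ∈ L p)
    (hind : ∀ p ∈ P, ∀ q ∈ P, ¬ G.Adj p q) (h : ListColorable G (F \ P) (listAfter G P x L)) :
    ListColorable G F L := by
  obtain ⟨c, hc, hc'⟩ := h
  have hmem : ∀ v ∈ F, v ∉ P → c v ∈ L v ∧ ∀ p ∈ P, G.Adj v p → c v ≠ x := by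
    intro v hv hvP
    have := hc v (Finset.mem_sdiff.2 ⟨hv, hvP⟩)
    unfold listAfter at this
    split_ifs at this with h
    · exact ⟨Finset.mem_of_mem_erase this, fun _ _ _ => Finset.ne_of_mem_erase this⟩
    · exact ⟨this, fun p hp hvp => absurd ⟨p, hp, hvp⟩ h⟩
  refine ⟨fun v => if v ∈ P then x else c v, fun v hv => ?_, fun v hv w hw hvw => ?_⟩
  · by_cases hvP : v ∈ P
    · simpa [hvP] using hx v hvP
    · simpa [hvP] using (hmem v hv hvP).1
  · by_cases hvP : v ∈ P <;> by_cases hwP : w ∈ P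
    · exact absurd hvw (hind v hvP w hwP)
    · simpa [hvP, hwP] using ((hmem w hw hwP).2 v hvP hvw.symm).symm
    · simpa [hvP, hwP] using (hmem v hv hvP).2 w hwP hvw
    · simpa [hvP, hwP] using
        hc' v (Finset.mem_sdiff.2 ⟨hv, hvP⟩) w (Finset.mem_sdiff.2 ⟨hw, hwP⟩) hvw

theorem degIn_sdiff_le_card_listAfter {F P : Finset V} (hPF : P ⊆ F) {L : V → Finset K} {x : K}
    {v : V} (h : degIn G F v ≤ (L v).card) :
    degIn G (F \ P) v ≤ (listAfter G P x L v).card := by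
  unfold listAfter
  split_ifs with h'
  · obtain ⟨p, hp, hvp⟩ := h'
    have := degIn_sdiff_lt hp (hPF hp) hvp
    have := Finset.pred_card_le_card_erase (s := L v) (a := x)
    omega
  · exact (degIn_mono Finset.sdiff_subset v).trans h

/-- Greedy colouring towards the nodes with spare colours. -/
theorem listColorable_of_rank [Nonempty K] (ρ : V → ℕ) (F : Finset V) (L : V → Finset K)
    (h : ∀ v ∈ F, degIn G F v < (L v).card ∨
      (degIn G F v ≤ (L v).card ∧ ∃ u ∈ F, G.Adj v u ∧ ρ u < ρ v)) : ListColorable G F L := by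
  induction hn : F.card generalizing F L with
  | zero =>
    obtain rfl := Finset.card_eq_zero.1 hn
    exact ⟨fun _ => Classical.arbitrary K, by simp, by simp⟩
  | succ n ih =>
    -- A node of highest rank goes first: any node that relies on a neighbour of lower rank keeps
    -- that neighbour uncoloured.
    obtain ⟨v, hv, hmax⟩ := F.exists_max_image ρ (Finset.card_pos.1 (by omega))
    have hL : (L v).Nonempty := by
      rw [← Finset.card_pos]
      rcases h v hv with h | ⟨h, u, hu, hvu, _⟩
      · omega
      · exact lt_of_lt_of_le (Finset.card_pos.2 ⟨u, Finset.mem_filter.2 ⟨hu, hvu⟩⟩) h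
    obtain ⟨x, hx⟩ := hL
    refine ListColorable.of_sdiff (P := {v}) (x := x) (by simpa using hx) (by simp) ?_
    refine ih _ _ (fun w hw => ?_) ?_
    · obtain ⟨hwF, hwv⟩ := Finset.mem_sdiff.1 hw
      rw [Finset.mem_singleton] at hwv
      rcases h w hwF with h | ⟨h, u, hu, hwu, hr⟩
      · left
        unfold listAfter
        split_ifs with h'
        · obtain ⟨p, hp, hwp⟩ := h'
          have h1 : p ∈ F := by rw [Finset.mem_singleton.1 hp]; exact hv
          have := degIn_sdiff_lt hp h1 hwp
          have := Finset.pred_card_le_card_erase (s := L w) (a := x)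
          omega
        · exact (degIn_mono Finset.sdiff_subset w).trans_lt h
      · right
        refine ⟨degIn_sdiff_le_card_listAfter (by simpa using hv) h, u, ?_, hwu, hr⟩
        simp only [Finset.mem_sdiff, Finset.mem_singleton]
        refine ⟨hu, ?_⟩
        rintro rfl
        exact absurd (hmax w hwF) (not_le.2 hr)
    · rw [Finset.card_sdiff_of_subset (by simpa using hv)]
      simp [hn]

/-- Greedy colouring after an independent set `P` was coloured with `x`. -/
theorem listColorable_of_precoloring [Nonempty K] (ρ : V → ℕ) {F P : Finset V} {L : V → Finset K}
    {x : K} (hPF : P ⊆ F) (hx : ∀ p ∈ P, x ∈ L p) (hind : ∀ p ∈ P, ∀ q ∈ P, ¬ G.Adj p q)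
    (hL : ∀ v ∈ F, degIn G F v ≤ (L v).card)
    (h : ∀ v ∈ F, v ∉ P → (∃ u ∈ F, u ∉ P ∧ G.Adj v u ∧ ρ u < ρ v) ∨
      (degIn G F v < (L v).card ∧ ∀ p ∈ P, ¬ G.Adj v p) ∨
      (x ∉ L v ∧ ∃ p ∈ P, G.Adj v p) ∨ ∃ p ∈ P, ∃ q ∈ P, p ≠ q ∧ G.Adj v p ∧ G.Adj v q) :
    ListColorable G F L := by
  refine ListColorable.of_sdiff hx hind (listColorable_of_rank ρ _ _ fun v hv => ?_)
  obtain ⟨hvF, hvP⟩ := Finset.mem_sdiff.1 hv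
  -- Colouring `P` leaves a node with a spare colour if it had one and has no neighbour in `P`, if
  -- it loses a neighbour but no colour, or if it loses two neighbours and at most one colour. All
  -- other nodes are ranked towards such nodes.
  rcases h v hvF hvP with ⟨u, hu, huP, hvu, hr⟩ | ⟨h1, h2⟩ | ⟨h1, p, hp, h2⟩ |
    ⟨p, hp, q, hq, hpq, h1, h2⟩
  · exact Or.inr ⟨degIn_sdiff_le_card_listAfter hPF (hL v hvF), u,
      Finset.mem_sdiff.2 ⟨hu, huP⟩, hvu, hr⟩
  · left
    rw [listAfter, if_neg (by simpa using h2)]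
    exact (degIn_mono Finset.sdiff_subset v).trans_lt h1
  · left
    rw [listAfter, if_pos ⟨p, hp, h2⟩, Finset.erase_eq_of_notMem h1]
    exact (degIn_sdiff_lt hp (hPF hp) h2).trans_le (hL v hvF)
  · left
    have h3 := degIn_sdiff_add_two_le hp (hPF hp) h1 hq (hPF hq) hpq h2
    have h4 := Finset.pred_card_le_card_erase (s := L v) (a := x)
    have h5 := hL v hvF
    rw [listAfter, if_pos ⟨p, hp, h1⟩]
    omega

namespace IsCyclicSeq

variable {n : ℕ} {c : ℕ → V} {L : V → Finset K}

theorem image_rotate (h : IsCyclicSeq G n c) (hn : 0 < n) (i : ℕ) :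
    (Finset.range n).image (fun j => c (i + j)) = (Finset.range n).image c := by
  ext v
  simp only [Finset.mem_image, Finset.mem_range]
  constructor
  · rintro ⟨j, _, rfl⟩
    exact h.exists_lt hn (i + j)
  · rintro ⟨j, _, rfl⟩
    -- Adding `i * (n - 1)` undoes the shift by `i` modulo `n` without subtraction.
    obtain ⟨k, hk, hk'⟩ := (h.rotate i).exists_lt hn (j + i * (n - 1))
    refine ⟨k, hk, hk'.trans ((h.eq_iff _ _).2 ?_)⟩
    have : i + (j + i * (n - 1)) = j + n * i := by
      obtain ⟨m, rfl⟩ : ∃ m, n = m + 1 := ⟨n - 1, by omega⟩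
      simp only [Nat.add_sub_cancel]
      ring
    rw [this]
    simp [Nat.ModEq]

theorem mem_image (h : IsCyclicSeq G n c) (hn : 0 < n) (j : ℕ) : c j ∈ (Finset.range n).image c := by
  obtain ⟨k, hk, e⟩ := h.exists_lt hn j
  exact Finset.mem_image.2 ⟨k, Finset.mem_range.2 hk, e⟩

theorem listColorable_of_spare [Nonempty K] (h : IsCyclicSeq G n c) (hn : 0 < n)
    (hL : ∀ v ∈ (Finset.range n).image c, degIn G ((Finset.range n).image c) v ≤ (L v).card)
    (h0 : degIn G ((Finset.range n).image c) (c 0) < (L (c 0)).card) :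
    ListColorable G ((Finset.range n).image c) L := by
  obtain ⟨ρ, hρ⟩ := h.exists_rank id
  refine listColorable_of_rank ρ _ L fun v hv => ?_
  obtain ⟨j, hj, rfl⟩ := Finset.mem_image.1 hv
  rw [Finset.mem_range] at hj
  rcases j with _ | j
  · exact Or.inl h0
  · refine Or.inr ⟨hL _ hv, c j, h.mem_image hn j, (h.adj j).symm, ?_⟩
    rw [hρ _ hj, hρ _ (by omega)]
    simp

/-- A colour of `c 0` that is missing from the list of `c 1` costs `c 1` nothing, so `c 1` has a
spare colour and the others can be coloured back along the cycle towards it. -/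
theorem listColorable_of_not_subset [Nonempty K] (h : IsCyclicSeq G n c) (hn : 2 ≤ n)
    (hL : ∀ v ∈ (Finset.range n).image c, degIn G ((Finset.range n).image c) v ≤ (L v).card)
    (h0 : ¬ L (c 0) ⊆ L (c 1)) :
    ListColorable G ((Finset.range n).image c) L := by
  obtain ⟨x, hx, hx'⟩ := Finset.not_subset.1 h0
  obtain ⟨ρ, hρ⟩ := h.exists_rank id
  refine listColorable_of_precoloring ρ (P := {c 0}) (x := x) ?_ (by simpa using hx) (by simp) hL
    fun v hv hvP => ?_
  · simpa using ⟨0, by omega, rfl⟩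
  obtain ⟨j, hj, rfl⟩ := Finset.mem_image.1 hv
  rw [Finset.mem_range] at hj
  rcases j with _ | _ | j
  · simp at hvP
  · exact Or.inr (Or.inr (Or.inl ⟨hx', c 0, by simp, (h.adj 0).symm⟩))
  · refine Or.inl ⟨c (j + 1), h.mem_image (by omega) _, ?_, (h.adj _).symm, ?_⟩
    · rw [Finset.mem_singleton]
      intro e
      have := h.eq_of_lt (by omega) (by omega) e
      omega
    · rw [hρ _ hj, hρ _ (by omega)]
      simp

/-- The case of equal lists, when `c 0` and `c t` are the closest non-adjacent nodes. -/
theorem listColorable_of_minimal_gap [Nonempty K] (h : IsCyclicSeq G n c) (hn : Even n) {A : Finset K}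
    (hLA : ∀ j, L (c j) = A)
    (hA : ∀ v ∈ (Finset.range n).image c, degIn G ((Finset.range n).image c) v = A.card)
    {t : ℕ} (ht2 : 2 ≤ t) (htn : t < n) (ht : ¬ G.Adj (c 0) (c t))
    (hmin : ∀ s, 1 ≤ s → s < t → ∀ i, G.Adj (c i) (c (i + s))) :
    ListColorable G ((Finset.range n).image c) L := by
  have hn0 : 0 < n := by omega
  have hF : ∀ j, c j ∈ (Finset.range n).image c := h.mem_image hn0
  have hwrap : ∀ j, G.Adj (c j) (c (j + (n - 1))) := fun j => by
    have h1 := (h.adj (j + (n - 1))).symm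
    have h2 : c (j + (n - 1) + 1) = c j := by
      rw [h.eq_iff, show j + (n - 1) + 1 = j + n by omega]
      simp [Nat.ModEq]
    rwa [h2] at h1
  -- The first and the last node of the cycle are adjacent, so the gap `t` cannot be `n - 1`.
  have htn' : t + 1 < n := by
    rcases Nat.lt_or_ge (t + 1) n with h' | h'
    · exact h'
    · exfalso
      have := hwrap 0
      rw [show 0 + (n - 1) = t by omega] at this
      exact ht this
  have hApos : A.Nonempty := by
    rw [← Finset.card_pos, ← hA (c 0) (hF 0)]
    exact Finset.card_pos.2 ⟨c 1, Finset.mem_filter.2 ⟨hF 1, h.adj 0⟩⟩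
  obtain ⟨x, hx⟩ := hApos
  have hL : ∀ v ∈ (Finset.range n).image c,
      degIn G ((Finset.range n).image c) v ≤ (L v).card := by
    intro v hv
    rw [hA v hv]
    obtain ⟨j, _, rfl⟩ := Finset.mem_image.1 hv
    rw [hLA]
  have hPF : ({c 0, c t} : Finset V) ⊆ (Finset.range n).image c := by
    intro v hv
    rcases Finset.mem_insert.1 hv with rfl | hv
    · exact hF 0
    · rw [Finset.mem_singleton.1 hv]; exact hF t
  have hxP : ∀ p ∈ ({c 0, c t} : Finset V), x ∈ L p := by
    intro v hv
    rcases Finset.mem_insert.1 hv with rfl | hv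
    · rwa [hLA]
    · rwa [Finset.mem_singleton.1 hv, hLA]
  have hind : ∀ p ∈ ({c 0, c t} : Finset V), ∀ q ∈ ({c 0, c t} : Finset V), ¬ G.Adj p q := by
    simp only [Finset.mem_insert, Finset.mem_singleton]
    rintro p (rfl | rfl) q (rfl | rfl)
    · exact G.loopless.irrefl _
    · exact ht
    · exact fun h => ht h.symm
    · exact G.loopless.irrefl _
  have hnP : ∀ j < n, j ≠ 0 → j ≠ t → c j ∉ ({c 0, c t} : Finset V) := by
    intro j hj h0 h1 hm
    rcases Finset.mem_insert.1 hm with e | e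
    · exact h0 (h.eq_of_lt hj hn0 e)
    · exact h1 (h.eq_of_lt hj htn (Finset.mem_singleton.1 e))
  have hroot : ∃ p ∈ ({c 0, c t} : Finset V), ∃ q ∈ ({c 0, c t} : Finset V),
      p ≠ q ∧ G.Adj (c 1) p ∧ G.Adj (c 1) q := by
    refine ⟨c 0, by simp, c t, by simp, fun e => ?_, (h.adj 0).symm, ?_⟩
    · have := h.eq_of_lt hn0 htn e
      omega
    · have := hmin (t - 1) (by omega) (by omega) 1
      rwa [show 1 + (t - 1) = t by omega] at this
  -- With `c 0` and `c t` both coloured `x`, their common neighbour `c 1` has a spare colour. For `2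
  -- < t` the remaining nodes are ranked along the cycle towards `c 1`; only `c (t + 1)` has to jump
  -- over `c t`, by the chord to `c (t - 1)`.
  rcases Nat.lt_or_ge 2 t with ht3 | ht3
  · obtain ⟨ρ, hρ⟩ := h.exists_rank id
    refine listColorable_of_precoloring ρ hPF hxP hind hL fun v hv hvP => ?_
    obtain ⟨j, hj, rfl⟩ := Finset.mem_image.1 hv
    rw [Finset.mem_range] at hj
    have hj0 : j ≠ 0 := by rintro rfl; simp at hvP
    have hjt : j ≠ t := by rintro rfl; simp at hvP
    rcases Nat.lt_or_ge 1 j with hj1 | hj1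
    · left
      by_cases hjt1 : j = t + 1
      · refine ⟨c (t - 1), hF _, hnP _ (by omega) (by omega) (by omega), ?_, ?_⟩
        · have := hmin 2 (by omega) ht3 (t - 1)
          rw [show t - 1 + 2 = j by omega] at this
          exact this.symm
        · rw [hρ _ hj, hρ _ (by omega)]
          simp only [id_eq]; omega
      · refine ⟨c (j - 1), hF _, hnP _ (by omega) (by omega) (by omega), ?_, ?_⟩
        · have := h.adj (j - 1)
          rw [show j - 1 + 1 = j by omega] at this
          exact this.symm
        · rw [hρ _ hj, hρ _ (by omega)]
          simp only [id_eq]; omega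
    · obtain rfl : j = 1 := by omega
      exact Or.inr (Or.inr (Or.inr hroot))
  · obtain rfl : t = 2 := by omega
    -- For `t = 2` both cycle neighbours of `c 1` are already coloured. A further neighbour `c s`
    -- reconnects it: the remaining path is ranked by distance to `c s`, and `c 1` is below `c s`.
    by_cases hs : ∃ s, 3 ≤ s ∧ s < n ∧ G.Adj (c 1) (c s)
    · obtain ⟨s, hs3, hsn, hs⟩ := hs
      obtain ⟨ρ, hρ⟩ := h.exists_rank fun j => if j = 1 then 0 else 1 + (j - s) + (s - j)
      refine listColorable_of_precoloring ρ hPF hxP hind hL fun v hv hvP => ?_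
      obtain ⟨j, hj, rfl⟩ := Finset.mem_image.1 hv
      rw [Finset.mem_range] at hj
      have hj0 : j ≠ 0 := by rintro rfl; simp at hvP
      have hjt : j ≠ 2 := by rintro rfl; simp at hvP
      by_cases hj1 : j = 1
      · subst hj1
        exact Or.inr (Or.inr (Or.inr hroot))
      left
      rcases lt_trichotomy j s with hjs | rfl | hjs
      · refine ⟨c (j + 1), hF _, hnP _ (by omega) (by omega) (by omega), h.adj j, ?_⟩
        rw [hρ _ hj, hρ _ (by omega), if_neg (by omega), if_neg (by omega)]
        omega
      · refine ⟨c 1, hF _, hnP _ (by omega) (by omega) (by omega), hs.symm, ?_⟩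
        rw [hρ _ hj, hρ _ (by omega), if_pos rfl, if_neg (by omega)]
        omega
      · refine ⟨c (j - 1), hF _, hnP _ (by omega) (by omega) (by omega), ?_, ?_⟩
        · have := h.adj (j - 1)
          rw [show j - 1 + 1 = j by omega] at this
          exact this.symm
        · rw [hρ _ hj, hρ _ (by omega), if_neg (by omega), if_neg (by omega)]
          omega
    -- Without a further neighbour, `c 1` has degree two, hence so has every node and all lists are
    -- the same pair. The induced graph is the even cycle itself, coloured by parity.
    · have hA2 : A.card = 2 := by
        rw [← hA (c 1) (hF 1), degIn]
        have : ((Finset.range n).image c).filter (fun w => G.Adj (c 1) w) = {c 0, c 2} := by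
          ext w
          simp only [Finset.mem_filter, Finset.mem_insert, Finset.mem_singleton]
          constructor
          · rintro ⟨hw, hw'⟩
            obtain ⟨j, hj, rfl⟩ := Finset.mem_image.1 hw
            rw [Finset.mem_range] at hj
            have : j < 3 := by
              by_contra hj3
              exact hs ⟨j, by omega, hj, hw'⟩
            interval_cases j
            · exact Or.inl rfl
            · exact absurd hw' (G.loopless.irrefl _)
            · exact Or.inr rfl
          · rintro (rfl | rfl)
            · exact ⟨hF _, (h.adj 0).symm⟩
            · exact ⟨hF _, h.adj 1⟩
        rw [this, Finset.card_pair]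
        intro e
        have := h.eq_of_lt hn0 htn e
        omega
      obtain ⟨a, b, hab, rfl⟩ := Finset.card_eq_two.1 hA2
      obtain ⟨ρ, hρ⟩ := h.exists_rank id
      refine ⟨fun v => if Even (ρ v) then a else b, fun v hv => ?_, fun v hv w hw hvw => ?_⟩
      · obtain ⟨j, _, rfl⟩ := Finset.mem_image.1 hv
        rw [hLA]
        beta_reduce
        split_ifs <;> simp
      · obtain ⟨j, hj, rfl⟩ := Finset.mem_image.1 hv
        obtain ⟨k, hk, rfl⟩ := Finset.mem_image.1 hw
        rw [Finset.mem_range] at hj hk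
        have hsub : ({c (j + 1), c (j + (n - 1))} : Finset V) ⊆
            ((Finset.range n).image c).filter fun w => G.Adj (c j) w := by
          intro y hy
          rcases Finset.mem_insert.1 hy with rfl | hy
          · exact Finset.mem_filter.2 ⟨hF _, h.adj j⟩
          · rw [Finset.mem_singleton.1 hy]
            exact Finset.mem_filter.2 ⟨hF _, hwrap j⟩
        have hne : c (j + 1) ≠ c (j + (n - 1)) := by
          intro e
          have := Nat.ModEq.add_left_cancel' j ((h.eq_iff _ _).1 e)
          have := Nat.ModEq.eq_of_lt_of_lt this (by omega) (by omega)
          omega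
        have heq := Finset.eq_of_subset_of_card_le hsub (by
          rw [Finset.card_pair hne]
          exact (hA _ (hF j)).trans_le hA2.le)
        have hmem : c k ∈ ({c (j + 1), c (j + (n - 1))} : Finset V) := by
          rw [heq]
          exact Finset.mem_filter.2 ⟨hF k, hvw⟩
        have hpar : k % 2 = (j + 1) % 2 := by
          have h2n : 2 ∣ n := hn.two_dvd
          rcases Finset.mem_insert.1 hmem with e | e
          · exact ((h.eq_iff _ _).1 e).of_dvd h2n
          · have := ((h.eq_iff _ _).1 (Finset.mem_singleton.1 e)).of_dvd h2n
            unfold Nat.ModEq at this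
            omega
        simp only [hρ _ hj, hρ _ hk, id_eq, Nat.even_iff]
        split_ifs
        · omega
        · exact hab
        · exact hab.symm
        · omega

/-- An even cycle that does not induce a complete graph is colourable from lists of the size of
the degrees. -/
theorem listColorable [Nonempty K] (h : IsCyclicSeq G n c) (hn : Even n) (hn2 : 2 ≤ n)
    (hna : ∃ i j, c i ≠ c j ∧ ¬ G.Adj (c i) (c j))
    (hL : ∀ v ∈ (Finset.range n).image c, degIn G ((Finset.range n).image c) v ≤ (L v).card) :
    ListColorable G ((Finset.range n).image c) L := by
  -- In a counterexample no node has a spare colour and each list is contained in the next one.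
  -- Going around the cycle makes all lists equal, and a non-adjacent pair at minimal cyclic
  -- distance gives the contradiction.
  by_contra hcon
  have hn0 : 0 < n := by omega
  have hcard : ∀ v ∈ (Finset.range n).image c,
      degIn G ((Finset.range n).image c) v = (L v).card := by
    intro v hv
    refine le_antisymm (hL v hv) (not_lt.1 fun hlt => hcon ?_)
    obtain ⟨j, _, rfl⟩ := Finset.mem_image.1 hv
    have := (h.rotate j).listColorable_of_spare (L := L) hn0
    rw [h.image_rotate hn0] at this
    exact this hL hlt
  have hstep : ∀ i, L (c i) ⊆ L (c (i + 1)) := by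
    intro i
    by_contra hsub
    have := (h.rotate i).listColorable_of_not_subset (L := L) hn2
    rw [h.image_rotate hn0] at this
    exact hcon (this hL hsub)
  have hstep' : ∀ m i, L (c i) ⊆ L (c (i + m)) := by
    intro m
    induction m with
    | zero => intro i; exact subset_rfl
    | succ m ih => intro i; exact (ih i).trans (hstep (i + m))
  have hall : ∀ j, L (c j) = L (c 0) := by
    intro j
    refine Finset.Subset.antisymm ?_ (by simpa using hstep' j 0)
    have h1 := hstep' (j * (n - 1)) j
    have h2 : c (j + j * (n - 1)) = c 0 := by
      rw [h.eq_iff]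
      have : j + j * (n - 1) = n * j := by
        obtain ⟨m, rfl⟩ : ∃ m, n = m + 1 := ⟨n - 1, by omega⟩
        simp only [Nat.add_sub_cancel]
        ring
      rw [this]
      simp [Nat.ModEq]
    rwa [h2] at h1
  have hgap : ∃ t, 1 ≤ t ∧ t < n ∧ ∃ i, ¬ G.Adj (c i) (c (i + t)) := by
    obtain ⟨i, j, hne, hij⟩ := hna
    obtain ⟨k, hk, e⟩ := (h.rotate i).exists_lt hn0 (j + i * (n - 1))
    have h2 : c (i + (j + i * (n - 1))) = c j := by
      rw [h.eq_iff]
      have : i + (j + i * (n - 1)) = j + n * i := by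
        obtain ⟨m, rfl⟩ : ∃ m, n = m + 1 := ⟨n - 1, by omega⟩
        simp only [Nat.add_sub_cancel]
        ring
      rw [this]
      simp [Nat.ModEq]
    simp only [h2] at e
    refine ⟨k, ?_, hk, i, by rwa [e]⟩
    rcases k with _ | k
    · exact absurd e hne
    · omega
  obtain ⟨ht1, htn, i, hi⟩ := Nat.find_spec hgap
  have hmin : ∀ s, 1 ≤ s → s < Nat.find hgap → ∀ i, G.Adj (c i) (c (i + s)) := by
    intro s hs1 hst i
    by_contra hsi
    exact Nat.find_min hgap hst ⟨hs1, by omega, i, hsi⟩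
  have ht2 : 2 ≤ Nat.find hgap := by
    by_contra hlt
    rw [show Nat.find hgap = 1 by omega] at hi
    exact hi (h.adj i)
  have := (h.rotate i).listColorable_of_minimal_gap (L := L) hn (A := L (c 0))
    (fun j => hall _) (t := Nat.find hgap)
  rw [h.image_rotate hn0] at this
  refine hcon (this (fun v hv => ?_) ht2 htn hi fun s h1 h2 j => ?_)
  · rw [hcard v hv]
    obtain ⟨j, _, rfl⟩ := Finset.mem_image.1 hv
    rw [hall]
  · rw [← Nat.add_assoc]
    exact hmin s h1 h2 (i + j)

end IsCyclicSeq

variable [Fintype V]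

/-- `F` can be coloured last in every partial colouring with `Δ` colours. -/
def Flexible (Δ : ℕ) (G : SimpleGraph V) (F : Finset V) : Prop :=
  ∀ L : V → Finset (Fin Δ),
    (∀ v ∈ F, Δ ≤ (L v).card + (Finset.univ.filter fun w => G.Adj v w ∧ w ∉ F).card) →
    ListColorable G F L

theorem degIn_add_card_outside (G : SimpleGraph V) (F : Finset V) (v : V) :
    degIn G F v + (Finset.univ.filter fun w => G.Adj v w ∧ w ∉ F).card =
      degIn G Finset.univ v := by
  unfold degIn
  rw [← Finset.card_union_of_disjoint]
  · congr 1
    ext w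
    by_cases hw : w ∈ F <;> simp [hw]
  · rw [Finset.disjoint_left]
    intro w hw hw'
    simp only [Finset.mem_filter] at hw hw'
    exact hw'.2.2 hw.1

/-- Fewer than `Δ` neighbours cannot block all `Δ` colours. -/
theorem flexible_singleton {Δ : ℕ} {v : V} (h : degIn G Finset.univ v < Δ) :
    Flexible Δ G {v} := by
  have : NeZero Δ := ⟨by omega⟩
  intro L hL
  refine listColorable_of_rank (fun _ => 0) _ _ fun w hw => Or.inl ?_
  have h1 := hL w hw
  have h2 := degIn_add_card_outside G {v} w
  rw [Finset.mem_singleton.1 hw] at *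
  omega

/-- An even closed chain of distinct nodes with two non-adjacent nodes is flexible. -/
theorem flexible_of_chain {Δ : ℕ} [NeZero Δ] (hΔ : ∀ v, degIn G Finset.univ v ≤ Δ)
    {l : List V} (hnd : l.Nodup) (hch : l.IsChain G.Adj) (hne : l ≠ [])
    (hwrap : G.Adj (l.getLast hne) (l.head hne)) (heven : Even l.length)
    (hna : ∃ x ∈ l, ∃ y ∈ l, x ≠ y ∧ ¬ G.Adj x y) : Flexible Δ G l.toFinset := by
  have hn0 : 0 < l.length := List.length_pos_of_ne_nil hne
  have hn2 : 2 ≤ l.length := by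
    obtain ⟨m, hm⟩ := heven
    omega
  let c : ℕ → V := fun j => l[j % l.length]'(Nat.mod_lt _ hn0)
  have hc : IsCyclicSeq G l.length c := by
    refine ⟨fun j k => ?_, fun j => ?_⟩
    · simp only [c]
      rw [hnd.getElem_inj_iff]
      rfl
    · simp only [c]
      have hlt := Nat.mod_lt j hn0
      rcases Nat.lt_or_ge (j % l.length + 1) l.length with h | h
      · have h1 : (j + 1) % l.length = j % l.length + 1 := by
          rw [Nat.add_mod, Nat.mod_eq_of_lt (show 1 < l.length by omega), Nat.mod_eq_of_lt h]
        simp only [h1]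
        exact List.isChain_iff_getElem.1 hch _ h
      · have h1 : (j + 1) % l.length = 0 := by
          rw [Nat.add_mod, Nat.mod_eq_of_lt (show 1 < l.length by omega),
            show j % l.length + 1 = l.length by omega, Nat.mod_self]
        have h2 : j % l.length = l.length - 1 := by omega
        simp only [h1, h2]
        rw [List.getLast_eq_getElem, List.head_eq_getElem] at hwrap
        exact hwrap
  have himg : (Finset.range l.length).image c = l.toFinset := by
    ext v
    simp only [Finset.mem_image, Finset.mem_range, List.mem_toFinset, List.mem_iff_getElem, c]
    constructor
    · rintro ⟨j, hj, rfl⟩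
      exact ⟨j % l.length, Nat.mod_lt _ hn0, rfl⟩
    · rintro ⟨j, hj, rfl⟩
      exact ⟨j, hj, by simp only [Nat.mod_eq_of_lt hj]⟩
  intro L hL
  rw [← himg] at hL ⊢
  refine hc.listColorable heven hn2 ?_ fun v hv => ?_
  · obtain ⟨x, hx, y, hy, hxy, hxy'⟩ := hna
    rw [← List.mem_toFinset, ← himg] at hx hy
    obtain ⟨i, _, rfl⟩ := Finset.mem_image.1 hx
    obtain ⟨j, _, rfl⟩ := Finset.mem_image.1 hy
    exact ⟨i, j, hxy, hxy'⟩
  · have h1 := hL v hv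
    have h2 := degIn_add_card_outside G ((Finset.range l.length).image c) v
    have h3 := hΔ v
    omega

end ListColoring

/-! ### Exponential growth of balls without flexible sets. -/

section Growth

open scoped Classical

variable {V : Type*}

/-- `w` has distance exactly `r` from `o`. -/
def AtLevel (G : SimpleGraph V) (o : V) (r : ℕ) (w : V) : Prop :=
  Near G r o w ∧ ∀ s < r, ¬ Near G s o w

namespace AtLevel

variable {G : SimpleGraph V} {o v w : V} {r s : ℕ}

theorem unique (h : AtLevel G o r w) (h' : AtLevel G o s w) : r = s := by
  rcases lt_trichotomy r s with hlt | rfl | hlt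
  · exact absurd h.1 (h'.2 r hlt)
  · rfl
  · exact absurd h'.1 (h.2 s hlt)

theorem le_succ_of_adj (h : AtLevel G o r v) (hvw : G.Adj v w) (h' : AtLevel G o s w) :
    s ≤ r + 1 := by
  by_contra hlt
  exact h'.2 (r + 1) (by omega) (h.1.snoc hvw)

theorem exists_le (h : Near G r o w) : ∃ s ≤ r, AtLevel G o s w := by
  have hex : ∃ s, Near G s o w := ⟨r, h⟩
  exact ⟨Nat.find hex, Nat.find_min' hex h, Nat.find_spec hex, fun s hs => Nat.find_min hex hs⟩

theorem exists_of_adj (h : AtLevel G o r v) (hvw : G.Adj v w) :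
    ∃ s, AtLevel G o s w ∧ s ≤ r + 1 ∧ r ≤ s + 1 := by
  obtain ⟨s, hs, hw⟩ := exists_le (h.1.snoc hvw)
  exact ⟨s, hw, hs, hw.le_succ_of_adj hvw.symm h⟩

theorem exists_parent (h : AtLevel G o (r + 1) w) : ∃ p, G.Adj p w ∧ AtLevel G o r p := by
  obtain h' | ⟨p, hp, hpw⟩ := h.1.exists_of_succ
  · exact absurd h' (h.2 r (Nat.lt_succ_self r))
  · refine ⟨p, hpw, hp, fun s hs hs' => h.2 (s + 1) (by omega) (hs'.snoc hpw)⟩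

theorem not_adj (h : AtLevel G o r v) (h' : AtLevel G o s w) (hrs : r + 2 ≤ s) : ¬ G.Adj v w := by
  intro hvw
  have := h.le_succ_of_adj hvw h'
  omega

theorem ne (h : AtLevel G o r v) (h' : AtLevel G o s w) (hrs : r ≠ s) : v ≠ w := by
  rintro rfl
  exact hrs (h.unique h')

/-- Two nodes of the same level are joined by a path through lower levels. -/
theorem exists_cap {a b : V} (ha : AtLevel G o r a) (hb : AtLevel G o r b) (hab : a ≠ b) :
    ∃ m : List V, (a :: (m ++ [b])).IsChain G.Adj ∧ m.Nodup ∧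
      (∀ x ∈ m, ∃ s < r, AtLevel G o s x) ∧ Odd m.length ∧
      ((∃ q, m = [q]) ∨ ∃ q ∈ m, ∃ s, s + 2 ≤ r ∧ AtLevel G o s q) := by
  induction r generalizing a b with
  | zero =>
    have h1 : o = a := ha.1
    have h2 : o = b := hb.1
    exact absurd (h1.symm.trans h2) hab
  | succ r ih =>
    obtain ⟨p, hpa, hp⟩ := ha.exists_parent
    obtain ⟨q, hqb, hq⟩ := hb.exists_parent
    -- A common parent is a cap by itself. Otherwise the cap of the two parents is extended by both
    -- of them, which keeps its length odd; its nonempty old interior lies at least two levels below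
    -- `a` and `b`.
    by_cases hpq : p = q
    · subst hpq
      refine ⟨[p], ?_, List.nodup_singleton p, ?_, ⟨0, rfl⟩, Or.inl ⟨p, rfl⟩⟩
      · simp [hpa.symm, hqb]
      · simpa using ⟨r, by omega, hp⟩
    · obtain ⟨m, hch, hnd, hlev, hodd, -⟩ := ih hp hq hpq
      have hne : m ≠ [] := by
        rintro rfl
        simp at hodd
      refine ⟨p :: (m ++ [q]), ?_, ?_, ?_, ?_, Or.inr ?_⟩
      · have h1 : (a :: (p :: (m ++ [q]) ++ [b])) = (a :: p :: m) ++ q :: [b] := by simp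
        rw [h1, List.isChain_split]
        refine ⟨?_, by simp [hqb]⟩
        have h2 : a :: p :: m ++ [q] = a :: p :: (m ++ [q]) := rfl
        rw [h2, List.isChain_cons_cons]
        exact ⟨hpa.symm, hch⟩
      · have hnot : ∀ x, AtLevel G o r x → x ∉ m := fun x hx hxm => by
          obtain ⟨s, hs, hs'⟩ := hlev x hxm
          exact absurd (hx.unique hs') (by omega)
        rw [List.nodup_cons, List.nodup_append]
        refine ⟨?_, hnd, List.nodup_singleton q, ?_⟩
        · simp only [List.mem_append, List.mem_singleton, not_or]
          exact ⟨hnot p hp, hpq⟩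
        · rintro x hx y hy rfl
          rw [List.mem_singleton] at hy
          subst hy
          exact hnot _ hq hx
      · intro x hx
        simp only [List.mem_cons, List.mem_append, List.not_mem_nil, or_false] at hx
        rcases hx with rfl | hx | rfl
        · exact ⟨r, by omega, hp⟩
        · obtain ⟨s, hs, hs'⟩ := hlev x hx
          exact ⟨s, by omega, hs'⟩
        · exact ⟨r, by omega, hq⟩
      · simp only [List.length_cons, List.length_append, List.length_nil]
        obtain ⟨k, hk⟩ := hodd
        exact ⟨k + 1, by omega⟩
      · obtain ⟨x, hx⟩ := List.exists_mem_of_ne_nil m hne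
        obtain ⟨s, hs, hs'⟩ := hlev x hx
        exact ⟨x, by simp [hx], s, by omega, hs'⟩

end AtLevel

variable [Fintype V]

/-- The neighbours of `v` at level `s`. -/
noncomputable def nbrsAt (G : SimpleGraph V) (o : V) (s : ℕ) (v : V) : Finset V :=
  Finset.univ.filter fun w => G.Adj v w ∧ AtLevel G o s w

theorem mem_nbrsAt {G : SimpleGraph V} {o : V} {s : ℕ} {v w : V} : w ∈ nbrsAt G o s v ↔ G.Adj v w ∧ AtLevel G o s w := by
  simp [nbrsAt]

theorem disjoint_nbrsAt {G : SimpleGraph V} {o : V} {s t : ℕ} (hst : s ≠ t) (v w : V) :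
    Disjoint (nbrsAt G o s v) (nbrsAt G o t w) := by
  rw [Finset.disjoint_left]
  intro x hx hx'
  exact hst ((mem_nbrsAt.1 hx).2.unique (mem_nbrsAt.1 hx').2)

variable [DecidableEq V]

/-- Around `o` every nonempty flexible set leaves the ball of radius `g`. -/
structure Rigid (Δ : ℕ) (G : SimpleGraph V) (o : V) (g : ℕ) : Prop where
  degree_le : ∀ v, degIn G Finset.univ v ≤ Δ
  three_le : 3 ≤ Δ
  cliqueFree : G.CliqueFree (Δ + 1)
  not_flexible : ∀ F : Finset V, F.Nonempty → (∀ x ∈ F, Near G g o x) → ¬ Flexible Δ G F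

namespace Rigid

variable {Δ : ℕ} {G : SimpleGraph V} {o : V} {g r : ℕ}

theorem false_of_chain (h : Rigid Δ G o g) {l : List V} (hnd : l.Nodup) (hch : l.IsChain G.Adj)
    (hne : l ≠ []) (hwrap : G.Adj (l.getLast hne) (l.head hne)) (heven : Even l.length)
    (hna : ∃ x ∈ l, ∃ y ∈ l, x ≠ y ∧ ¬ G.Adj x y) (hnear : ∀ x ∈ l, Near G g o x) : False := by
  have : NeZero Δ := ⟨by have := h.three_le; omega⟩
  exact h.not_flexible l.toFinset (List.toFinset_nonempty_iff l |>.2 hne) (by simpa using hnear)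
    (flexible_of_chain h.degree_le hnd hch hne hwrap heven hna)

theorem degIn_eq (h : Rigid Δ G o g) {v : V} (hv : Near G g o v) : degIn G Finset.univ v = Δ := by
  refine le_antisymm (h.degree_le v) (not_lt.1 fun hlt => ?_)
  exact h.not_flexible {v} (Finset.singleton_nonempty v) (by simpa using hv) (flexible_singleton hlt)

/-- A common neighbour `v` of `a` and `b` closes the cap to an even cycle, as `v`, `a`, `b` are
added to an odd number of nodes. -/
theorem false_of_cap_one (h : Rigid Δ G o g) {a b v : V} (hr : r ≤ g) (ha : AtLevel G o r a)
    (hb : AtLevel G o r b) (hab : a ≠ b) (hva : G.Adj v a) (hvb : G.Adj v b)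
    {s : ℕ} (hs : r ≤ s) (hsg : s ≤ g) (hv : AtLevel G o s v) {m : List V}
    (hch : (a :: (m ++ [b])).IsChain G.Adj) (hnd : m.Nodup)
    (hlev : ∀ x ∈ m, ∃ s < r, AtLevel G o s x) (hodd : Odd m.length)
    (hna : ∃ x ∈ v :: a :: (m ++ [b]), ∃ y ∈ v :: a :: (m ++ [b]), x ≠ y ∧ ¬ G.Adj x y) :
    False := by
  have hnot : ∀ x s, AtLevel G o s x → r ≤ s → x ∉ m := fun x s hx hs hxm => by
    obtain ⟨s', hs', h'⟩ := hlev x hxm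
    exact absurd (hx.unique h') (by omega)
  refine h.false_of_chain (l := v :: a :: (m ++ [b])) ?_ ?_ (by simp) ?_ ?_ hna ?_
  · simp only [List.nodup_cons, List.mem_cons, List.mem_append, List.not_mem_nil, or_false, not_or,
      List.nodup_append, List.nodup_nil, not_false_eq_true, and_true, true_and]
    refine ⟨⟨hva.ne, hnot v s hv hs, hvb.ne⟩, ⟨hnot a r ha le_rfl, hab⟩, hnd, ?_⟩
    rintro x hx y rfl rfl
    exact hnot _ r hb le_rfl hx
  · rw [List.isChain_cons_cons]
    exact ⟨hva, hch⟩
  · simpa [List.getLast_append] using hvb.symm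
  · obtain ⟨k, hk⟩ := hodd
    simp only [List.length_cons, List.length_append, List.length_nil, hk]
    exact ⟨k + 2, by omega⟩
  · intro x hx
    simp only [List.mem_cons, List.mem_append, List.not_mem_nil, or_false] at hx
    rcases hx with rfl | rfl | hx | rfl
    · exact hv.1.mono hsg
    · exact ha.1.mono hr
    · obtain ⟨s', hs', h'⟩ := hlev x hx
      exact h'.1.mono (by omega)
    · exact hb.1.mono hr

/-- Two parents of `v` together with their cap would give an even cycle through `v`. It is not a
clique, since an interior node of the cap is at least two levels away from `v`. -/
theorem parent_unique (h : Rigid Δ G o g) (hr : r + 1 ≤ g) {p q v : V}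
    (hv : AtLevel G o (r + 1) v) (hp : AtLevel G o r p) (hq : AtLevel G o r q)
    (hpv : G.Adj p v) (hqv : G.Adj q v) : p = q := by
  by_contra hpq
  obtain ⟨m, hch, hnd, hlev, hodd, -⟩ := hp.exists_cap hq hpq
  have hne : m ≠ [] := by
    rintro rfl
    simp at hodd
  obtain ⟨x, hx⟩ := List.exists_mem_of_ne_nil m hne
  obtain ⟨s, hs, hxs⟩ := hlev x hx
  exact h.false_of_cap_one (by omega) hp hq hpq hpv.symm hqv.symm (Nat.le_succ r) hr hv hch hnd hlev
    hodd ⟨x, by simp [hx], v, by simp, hxs.ne hv (by omega), hxs.not_adj hv (by omega)⟩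

/-- The cycle through `v`, `a`, `b` and the cap has to induce a clique. This excludes a long cap,
which contains a node two levels below `a`, so the cap is the unique parent of `a` alone, and the
clique gives the two edges. -/
theorem siblings (h : Rigid Δ G o g) (hr : r + 1 ≤ g) {v a b p : V}
    (hv : AtLevel G o (r + 1) v) (ha : AtLevel G o (r + 1) a) (hb : AtLevel G o (r + 1) b)
    (hva : G.Adj v a) (hvb : G.Adj v b) (hab : a ≠ b) (hp : AtLevel G o r p) (hpa : G.Adj p a) :
    G.Adj a b ∧ G.Adj p v := by
  by_contra hcon
  obtain ⟨m, hch, hnd, hlev, hodd, hm⟩ := ha.exists_cap hb hab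
  refine h.false_of_cap_one hr ha hb hab hva hvb le_rfl hr hv hch hnd hlev hodd ?_
  rcases hm with ⟨q, rfl⟩ | ⟨q, hq, s, hs, hqs⟩
  · have hqa : G.Adj q a := by
      have := (List.isChain_cons_cons.1 hch).1
      exact this.symm
    obtain ⟨s, hs, hqs⟩ := hlev q (by simp)
    obtain rfl : s = r := by
      have := hqs.le_succ_of_adj hqa ha
      omega
    obtain rfl := h.parent_unique hr ha hp hqs hpa hqa
    by_cases hadj : G.Adj a b
    · exact ⟨p, by simp, v, by simp, hp.ne hv (by omega), fun h' => hcon ⟨hadj, h'⟩⟩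
    · exact ⟨a, by simp, b, by simp, hab, hadj⟩
  · exact ⟨q, by simp [hq], a, by simp, hqs.ne ha (by omega), hqs.not_adj ha (by omega)⟩

/-- Otherwise `w'` has a parent `p ≠ v`, and `v`, `w'` are non-adjacent nodes of an even cycle: `p,
v, w, w'` if `p = v'`, else `w', w, v, v'` followed by the cap from `v'` to `p`. -/
theorem adj_of_cousin (h : Rigid Δ G o g) (hr : r + 1 ≤ g) {v v' w w' : V}
    (hv : AtLevel G o r v) (hv' : AtLevel G o r v') (hvv' : G.Adj v v')
    (hw : AtLevel G o (r + 1) w) (hw' : AtLevel G o (r + 1) w') (hvw : G.Adj v w)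
    (hww' : G.Adj w w') : G.Adj v w' := by
  by_contra hcon
  obtain ⟨p, hpw', hp⟩ := hw'.exists_parent
  have hvw'ne : v ≠ w' := hv.ne hw' (by omega)
  have hpv : p ≠ v := by
    rintro rfl
    exact hcon hpw'
  by_cases hpv' : p = v'
  · subst hpv'
    refine h.false_of_chain (l := [p, v, w, w']) ?_ ?_ (by simp) ?_ ⟨2, rfl⟩
      ⟨v, by simp, w', by simp, hvw'ne, hcon⟩ ?_
    · simp [hpv, hp.ne hw (by omega), hp.ne hw' (by omega), hv.ne hw (by omega),
        hvw'ne, hww'.ne]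
    · simp [hvv'.symm, hvw, hww']
    · simpa using hpw'.symm
    · simp only [List.mem_cons, List.not_mem_nil, or_false]
      rintro x (rfl | rfl | rfl | rfl)
      · exact hp.1.mono (by omega)
      · exact hv.1.mono (by omega)
      · exact hw.1.mono hr
      · exact hw'.1.mono hr
  · obtain ⟨m, hch, hnd, hlev, hodd, -⟩ := hv'.exists_cap hp (Ne.symm hpv')
    have hnot : ∀ x s, AtLevel G o s x → r ≤ s → x ∉ m := fun x s hx hs hxm => by
      obtain ⟨s', hs', h'⟩ := hlev x hxm
      exact absurd (hx.unique h') (by omega)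
    refine h.false_of_chain (l := w' :: w :: v :: v' :: (m ++ [p])) ?_ ?_ (by simp) ?_ ?_
      ⟨v, by simp, w', by simp, hvw'ne, hcon⟩ ?_
    · simp only [List.nodup_cons, List.mem_cons, List.mem_append, List.not_mem_nil, or_false,
        not_or, List.nodup_append, List.nodup_nil, not_false_eq_true, and_true, true_and]
      refine ⟨⟨hww'.ne.symm, hvw'ne.symm, (hv'.ne hw' (by omega)).symm, hnot w' _ hw' (by omega),
        (hp.ne hw' (by omega)).symm⟩, ⟨hvw.ne.symm, (hv'.ne hw (by omega)).symm,
        hnot w _ hw (by omega), (hp.ne hw (by omega)).symm⟩, ⟨hvv'.ne, hnot v _ hv le_rfl,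
        hpv.symm⟩, ⟨hnot v' _ hv' le_rfl, Ne.symm hpv'⟩, hnd, ?_⟩
      rintro x hx y rfl rfl
      exact hnot _ r hp le_rfl hx
    · simp only [List.isChain_cons_cons]
      exact ⟨hww'.symm, hvw.symm, hvv', hch⟩
    · simpa [List.getLast_append] using hpw'
    · obtain ⟨k, hk⟩ := hodd
      simp only [List.length_cons, List.length_append, List.length_nil, hk]
      exact ⟨k + 3, by omega⟩
    · intro x hx
      simp only [List.mem_cons, List.mem_append, List.not_mem_nil, or_false] at hx
      rcases hx with rfl | rfl | rfl | rfl | hx | rfl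
      · exact hw'.1.mono hr
      · exact hw.1.mono hr
      · exact hv.1.mono (by omega)
      · exact hv'.1.mono (by omega)
      · obtain ⟨s', hs', h'⟩ := hlev x hx
        exact h'.1.mono (by omega)
      · exact hp.1.mono (by omega)

theorem card_nbrsAt_zero (h : Rigid Δ G o g) : (nbrsAt G o 1 o).card = Δ := by
  rw [← h.degIn_eq (Near.refl o), degIn]
  congr 1
  ext w
  simp only [mem_nbrsAt, Finset.mem_filter, Finset.mem_univ, true_and, and_iff_left_iff_imp]
  intro how
  refine ⟨Near.of_adj how, fun s hs hs' => ?_⟩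
  obtain rfl : s = 0 := by omega
  exact how.ne hs'

/-- All degrees in the ball are exactly `Δ`, the parent is unique, and neighbours differ by at most
one level. -/
theorem card_nbrsAt_succ (h : Rigid Δ G o g) (hr : r + 1 ≤ g) {v : V}
    (hv : AtLevel G o (r + 1) v) :
    1 + (nbrsAt G o (r + 1) v).card + (nbrsAt G o (r + 2) v).card = Δ := by
  obtain ⟨p, hpv, hp⟩ := hv.exists_parent
  have h1 : nbrsAt G o r v = {p} := by
    ext w
    rw [mem_nbrsAt, Finset.mem_singleton]
    constructor
    · exact fun ⟨hvw, hw⟩ => h.parent_unique hr hv hw hp hvw.symm hpv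
    · rintro rfl
      exact ⟨hpv.symm, hp⟩
  have h2 : nbrsAt G o r v ∪ nbrsAt G o (r + 1) v ∪ nbrsAt G o (r + 2) v =
      Finset.univ.filter fun w => G.Adj v w := by
    ext w
    simp only [Finset.mem_union, mem_nbrsAt, Finset.mem_filter, Finset.mem_univ, true_and]
    constructor
    · rintro ((h | h) | h) <;> exact h.1
    · intro hvw
      obtain ⟨s, hs, h1, h2⟩ := hv.exists_of_adj hvw
      have : s = r ∨ s = r + 1 ∨ s = r + 2 := by omega
      rcases this with rfl | rfl | rfl
      · exact Or.inl (Or.inl ⟨hvw, hs⟩)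
      · exact Or.inl (Or.inr ⟨hvw, hs⟩)
      · exact Or.inr ⟨hvw, hs⟩
  have h3 := h.degIn_eq (hv.1.mono hr)
  rw [degIn, ← h2, Finset.card_union_of_disjoint, Finset.card_union_of_disjoint, h1,
    Finset.card_singleton] at h3
  · exact h3
  · exact disjoint_nbrsAt (by omega) v v
  · rw [Finset.disjoint_union_left]
    exact ⟨disjoint_nbrsAt (by omega) v v, disjoint_nbrsAt (by omega) v v⟩

/-- A childless node has `Δ - 1 ≥ 2` neighbours on its own level. By `siblings` they are pairwise
adjacent and adjacent to its parent, so together with the node and the parent they form a forbidden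
clique on `Δ + 1` nodes. -/
theorem one_le_card_children (h : Rigid Δ G o g) (hr : r + 1 ≤ g) {v : V}
    (hv : AtLevel G o (r + 1) v) : 1 ≤ (nbrsAt G o (r + 2) v).card := by
  by_contra hcon
  have h1 := h.card_nbrsAt_succ hr hv
  have h3 := h.three_le
  obtain ⟨p, hpv, hp⟩ := hv.exists_parent
  set S := nbrsAt G o (r + 1) v with hS
  have hS2 : 1 < S.card := by omega
  have hpair : ∀ a ∈ S, ∀ b ∈ S, a ≠ b → G.Adj a b := by
    intro a ha b hb hab
    obtain ⟨hva, ha⟩ := mem_nbrsAt.1 ha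
    obtain ⟨hvb, hb⟩ := mem_nbrsAt.1 hb
    obtain ⟨q, hqa, hq⟩ := ha.exists_parent
    exact (h.siblings hr hv ha hb hva hvb hab hq hqa).1
  have hpar : ∀ a ∈ S, G.Adj p a := by
    intro a ha
    obtain ⟨b, hb, hab⟩ := Finset.exists_mem_ne hS2 a
    obtain ⟨hva, ha⟩ := mem_nbrsAt.1 ha
    obtain ⟨hvb, hb⟩ := mem_nbrsAt.1 hb
    obtain ⟨q, hqa, hq⟩ := ha.exists_parent
    have := (h.siblings hr hv ha hb hva hvb hab.symm hq hqa).2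
    rwa [h.parent_unique hr hv hp hq hpv this]
  have hvS : v ∉ S := fun hm => (mem_nbrsAt.1 hm).1.ne rfl
  have hpS : p ∉ insert v S := by
    rw [Finset.mem_insert, not_or]
    exact ⟨hpv.ne, fun hm => absurd (hp.unique (mem_nbrsAt.1 hm).2) (by omega)⟩
  refine h.cliqueFree (insert p (insert v S)) ⟨?_, ?_⟩
  · rw [Finset.coe_insert, SimpleGraph.isClique_insert, Finset.coe_insert,
      SimpleGraph.isClique_insert]
    refine ⟨⟨fun a ha b hb hab => hpair a ha b hb hab, fun a ha _ => (mem_nbrsAt.1 ha).1⟩, ?_⟩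
    intro a ha _
    rcases ha with rfl | ha
    · exact hpv
    · exact hpar a ha
  · rw [Finset.card_insert_of_notMem hpS, Finset.card_insert_of_notMem hvS]
    omega

/-- If `v` has no neighbour on its level, it has at least `Δ - 1` children, each with a child.
Otherwise `adj_of_cousin` confines the same-level neighbours of a child to the set `C` of children,
so each child has at least `Δ - |C|` children, and `|C| * (Δ - |C|) ≥ Δ - 1` because `1 ≤ |C| ≤ Δ -
2`. -/
theorem le_sum_card_children (h : Rigid Δ G o g) (hr : r + 2 ≤ g) {v : V}
    (hv : AtLevel G o r v) :
    Δ - 1 ≤ ∑ w ∈ nbrsAt G o (r + 1) v, (nbrsAt G o (r + 2) w).card := by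
  have h3 := h.three_le
  have hpos : ∀ w ∈ nbrsAt G o (r + 1) v, 1 ≤ (nbrsAt G o (r + 2) w).card := fun w hw =>
    h.one_le_card_children (by omega) (mem_nbrsAt.1 hw).2
  have hsum1 : (nbrsAt G o (r + 1) v).card ≤
      ∑ w ∈ nbrsAt G o (r + 1) v, (nbrsAt G o (r + 2) w).card := by
    simpa using Finset.sum_le_sum hpos
  rcases r with _ | r
  · obtain rfl : o = v := hv.1
    rw [h.card_nbrsAt_zero] at hsum1
    omega
  have hcard : 1 + (nbrsAt G o (r + 1) v).card + (nbrsAt G o (r + 1 + 1) v).card = Δ :=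
    h.card_nbrsAt_succ (by omega) hv
  rcases (nbrsAt G o (r + 1) v).eq_empty_or_nonempty with hS | ⟨v', hv'⟩
  · rw [hS, Finset.card_empty] at hcard
    omega
  · obtain ⟨hvv', hv'⟩ := mem_nbrsAt.1 hv'
    have hSpos : 1 ≤ (nbrsAt G o (r + 1) v).card :=
      Finset.card_pos.2 ⟨v', mem_nbrsAt.2 ⟨hvv', hv'⟩⟩
    have hCpos : 1 ≤ (nbrsAt G o (r + 1 + 1) v).card := h.one_le_card_children (by omega) hv
    set C := nbrsAt G o (r + 1 + 1) v with hC
    have hbig : ∀ w ∈ C, Δ - C.card ≤ (nbrsAt G o (r + 3) w).card := by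
      intro w hw
      obtain ⟨hvw, hwl⟩ := mem_nbrsAt.1 hw
      have h1 : 1 + (nbrsAt G o (r + 2) w).card + (nbrsAt G o (r + 3) w).card = Δ :=
        h.card_nbrsAt_succ (by omega) hwl
      have h2 : nbrsAt G o (r + 2) w ⊆ C.erase w := by
        intro w' hw'
        obtain ⟨hww', hw'l⟩ := mem_nbrsAt.1 hw'
        rw [Finset.mem_erase]
        exact ⟨hww'.ne.symm, mem_nbrsAt.2
          ⟨h.adj_of_cousin (by omega) hv hv' hvv' hwl hw'l hvw hww', hw'l⟩⟩
      have h4 := Finset.card_le_card h2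
      rw [Finset.card_erase_of_mem hw] at h4
      omega
    have h7 : C.card * (Δ - C.card) ≤ ∑ w ∈ C, (nbrsAt G o (r + 3) w).card := by
      have := Finset.sum_le_sum hbig
      simpa using this
    refine le_trans ?_ h7
    have hlt : C.card + 2 ≤ Δ := by omega
    obtain ⟨d, hd⟩ := Nat.exists_eq_add_of_le hlt
    obtain ⟨k, hk⟩ := Nat.exists_eq_add_of_le hCpos
    rw [hd, hk]
    have e1 : 1 + k + 2 + d - (1 + k) = d + 2 := by omega
    have e2 : 1 + k + 2 + d - 1 = k + 2 + d := by omega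
    rw [e1, e2]
    nlinarith [Nat.zero_le (k * d)]

/-- Unique parents make the sets of grandchildren of distinct nodes disjoint, so the local count
adds up over the level. -/
theorem card_level_add_two (h : Rigid Δ G o g) (hr : r + 2 ≤ g) :
    (Δ - 1) * (Finset.univ.filter (AtLevel G o r)).card ≤
      (Finset.univ.filter (AtLevel G o (r + 2))).card := by
  set A := Finset.univ.filter (AtLevel G o r) with hA
  let gc : V → Finset V := fun v => (nbrsAt G o (r + 1) v).biUnion (nbrsAt G o (r + 2))
  have hgc : ∀ v ∈ A, Δ - 1 ≤ (gc v).card := by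
    intro v hv
    rw [hA, Finset.mem_filter] at hv
    simp only [gc]
    rw [Finset.card_biUnion]
    · exact h.le_sum_card_children hr hv.2
    · intro w hw w' hw' hne
      refine Finset.disjoint_left.2 fun x hx hx' => ?_
      obtain ⟨hwx, hxl⟩ := mem_nbrsAt.1 hx
      exact hne (h.parent_unique hr hxl (mem_nbrsAt.1 hw).2 (mem_nbrsAt.1 hw').2 hwx
        (mem_nbrsAt.1 hx').1)
  have hdisj : ∀ v ∈ A, ∀ v' ∈ A, v ≠ v' → Disjoint (gc v) (gc v') := by
    intro v hv v' hv' hne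
    rw [hA, Finset.mem_filter] at hv hv'
    rw [Finset.disjoint_left]
    intro x hx hx'
    obtain ⟨w, hw, hx⟩ := Finset.mem_biUnion.1 hx
    obtain ⟨w', hw', hx'⟩ := Finset.mem_biUnion.1 hx'
    rw [mem_nbrsAt] at hw hw' hx hx'
    obtain rfl := h.parent_unique hr hx.2 hw.2 hw'.2 hx.1 hx'.1
    exact hne (h.parent_unique (by omega) hw.2 hv.2 hv'.2 hw.1 hw'.1)
  have hsub : A.biUnion gc ⊆ Finset.univ.filter (AtLevel G o (r + 2)) := by
    intro x hx
    obtain ⟨v, _, hx⟩ := Finset.mem_biUnion.1 hx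
    obtain ⟨w, _, hx⟩ := Finset.mem_biUnion.1 hx
    exact Finset.mem_filter.2 ⟨Finset.mem_univ x, (mem_nbrsAt.1 hx).2⟩
  refine le_trans ?_ (Finset.card_le_card hsub)
  rw [Finset.card_biUnion hdisj, mul_comm]
  simpa using Finset.sum_le_sum hgc

/-- Balls without flexible sets grow exponentially. -/
theorem pow_le_card_ball (h : Rigid Δ G o g) {k : ℕ} (hk : 2 * k ≤ g) :
    (Δ - 1) ^ k ≤ (Finset.univ.filter (Near G g o)).card := by
  have hlev : ∀ k, 2 * k ≤ g →
      (Δ - 1) ^ k ≤ (Finset.univ.filter (AtLevel G o (2 * k))).card := by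
    intro k
    induction k with
    | zero =>
      intro _
      rw [pow_zero, Nat.one_le_iff_ne_zero, ← Nat.pos_iff_ne_zero, Finset.card_pos]
      exact ⟨o, Finset.mem_filter.2 ⟨Finset.mem_univ o, rfl, fun s hs => absurd hs (by omega)⟩⟩
    | succ k ih =>
      intro hk
      refine le_trans ?_ (h.card_level_add_two (r := 2 * k) (by omega))
      rw [pow_succ, mul_comm]
      exact Nat.mul_le_mul_left _ (ih (by omega))
  refine (hlev k hk).trans (Finset.card_le_card fun x hx => ?_)
  rw [Finset.mem_filter] at hx ⊢
  exact ⟨hx.1, hx.2.1.mono hk⟩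

end Rigid

theorem card_ball_le {Δ : ℕ} {G : SimpleGraph V} (hΔ : ∀ v, degIn G Finset.univ v ≤ Δ) (r : ℕ)
    (v : V) : (Finset.univ.filter (Near G r v)).card ≤ (Δ + 1) ^ r := by
  induction r generalizing v with
  | zero =>
    rw [pow_zero, Finset.card_le_one]
    intro a ha b hb
    exact (Finset.mem_filter.1 ha).2.symm.trans (Finset.mem_filter.1 hb).2
  | succ r ih =>
    have hsub : Finset.univ.filter (Near G (r + 1) v) ⊆
        (insert v (Finset.univ.filter fun w => G.Adj v w)).biUnion
          fun w => Finset.univ.filter (Near G r w) := by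
      intro x hx
      rw [Finset.mem_filter] at hx
      rw [Finset.mem_biUnion]
      rcases hx.2 with hx | ⟨w, hvw, hx⟩
      · exact ⟨v, by simp, by simpa using hx⟩
      · exact ⟨w, by simp [hvw], by simpa using hx⟩
    refine (Finset.card_le_card hsub).trans (Finset.card_biUnion_le.trans ?_)
    refine (Finset.sum_le_sum fun w _ => ih w).trans ?_
    rw [Finset.sum_const, smul_eq_mul, pow_succ, mul_comm]
    exact Nat.mul_le_mul_left _ ((Finset.card_insert_le _ _).trans (Nat.succ_le_succ (hΔ v)))

end Growth

/-! ### The random partial colouring: ruling set, layers, colour trials, completion. -/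

section Algorithm

open scoped Classical

theorem Near.congr {V : Type*} {G G' : SimpleGraph V} {r : ℕ} {i j : V}
    (h : ∀ k, Near G r i k → ∀ l, G.Adj k l ↔ G'.Adj k l) : Near G r i j ↔ Near G' r i j := by
  induction r generalizing i with
  | zero => exact Iff.rfl
  | succ r ih =>
    refine or_congr (ih fun k hk => h k hk.succ) (exists_congr fun k => ?_)
    rw [h i (Near.refl i) k]
    refine and_congr_right fun hik => ih fun l hl => h l ?_
    exact Near.cons ((h i (Near.refl i) k).2 hik) hl

variable {V : Type*}

theorem ListColorable.congr {K : Type*} {G G' : SimpleGraph V} {F : Finset V} {L L' : V → Finset K}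
    (h : ∀ v ∈ F, L v = L' v ∧ ∀ w, G.Adj v w ↔ G'.Adj v w) (c : V → K) :
    ((∀ v ∈ F, c v ∈ L v) ∧ ∀ v ∈ F, ∀ w ∈ F, G.Adj v w → c v ≠ c w) ↔
      ((∀ v ∈ F, c v ∈ L' v) ∧ ∀ v ∈ F, ∀ w ∈ F, G'.Adj v w → c v ≠ c w) := by
  refine and_congr (forall₂_congr fun v hv => by rw [(h v hv).1])
    (forall₂_congr fun v hv => forall₂_congr fun w _ => by rw [(h v hv).2])

/-- The centres whose label differs from those of all centres at distance at most `α`. -/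
def IsCandidate (α : ℕ) (h : V → ℕ) (G : SimpleGraph V) (C : V → Prop) (w : V) : Prop :=
  C w ∧ ∀ w', Near G α w w' → w' ≠ w → C w' → h w' ≠ h w

/-- Among the nodes whose labels agree but for the `j` last bits, those with bit `j` set give way
to those at distance at most `α` with bit `j` not set. -/
def rulingStep (α : ℕ) (h : V → ℕ) (j : ℕ) (G : SimpleGraph V) (S : V → Prop) (w : V) : Prop :=
  S w ∧ (h w / 2 ^ j % 2 = 1 → ∀ w', Near G α w w' → S w' → h w' / 2 ^ j % 2 = 0 →
    h w' / 2 ^ j / 2 ≠ h w / 2 ^ j / 2)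

/-- A ruling set of the candidates, computed bit by bit. -/
def ruling (α : ℕ) (h : V → ℕ) (G : SimpleGraph V) (C : V → Prop) : ℕ → V → Prop
  | 0 => IsCandidate α h G C
  | j + 1 => rulingStep α h j G (ruling α h G C j)

section Ruling

variable {α : ℕ} {h : V → ℕ} {G : SimpleGraph V} {C : V → Prop}

theorem ruling_isCandidate {j : ℕ} {w : V} (hw : ruling α h G C j w) : IsCandidate α h G C w := by
  induction j with
  | zero => exact hw
  | succ j ih => exact ih hw.1

/-- Each step forgets one more bit. If two nearby survivors agreed after forgetting bit `j` but not
before, they would differ in that bit, and the one with bit 1 would have given way. -/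
theorem ruling_separated {j : ℕ} {w w' : V} (hw : ruling α h G C j w) (hw' : ruling α h G C j w')
    (hne : w ≠ w') (hn : Near G α w w') : h w / 2 ^ j ≠ h w' / 2 ^ j := by
  induction j with
  | zero =>
    simp only [pow_zero, Nat.div_one]
    exact fun e => hw.2 w' hn hne.symm hw'.1 e.symm
  | succ j ih =>
    have h1 := ih hw.1 hw'.1
    rw [pow_succ, ← Nat.div_div_eq_div_mul, ← Nat.div_div_eq_div_mul]
    intro e
    rcases Nat.mod_two_eq_zero_or_one (h w / 2 ^ j) with h2 | h2 <;>
      rcases Nat.mod_two_eq_zero_or_one (h w' / 2 ^ j) with h3 | h3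
    · omega
    · exact hw'.2 h3 w hn.symm hw.1 h2 e
    · exact hw.2 h2 w' hn hw'.1 h3 e.symm
    · omega

/-- After `b` steps all bits are forgotten, so no two distinct survivors can be within distance `α`.
-/
theorem ruling_far {b : ℕ} (hb : ∀ v, h v < 2 ^ b) {w w' : V} (hw : ruling α h G C b w)
    (hw' : ruling α h G C b w') (hn : Near G α w w') : w = w' := by
  by_contra hne
  refine ruling_separated hw hw' hne hn ?_
  rw [Nat.div_eq_of_lt (hb w), Nat.div_eq_of_lt (hb w')]

/-- A node gives way only to one within distance `α` whose bit is 0, and such a node survives the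
step. Hence each of the `j` steps adds at most `α` to the distance. -/
theorem exists_ruling_near {w : V} (hw : IsCandidate α h G C w) (j : ℕ) :
    ∃ w', ruling α h G C j w' ∧ Near G (j * α) w w' := by
  induction j with
  | zero => exact ⟨w, hw, Near.refl w⟩
  | succ j ih =>
    obtain ⟨w', hw', hn⟩ := ih
    by_cases h' : ruling α h G C (j + 1) w'
    · exact ⟨w', h', hn.mono (Nat.mul_le_mul_right _ (Nat.le_succ j))⟩
    · have : ¬ (h w' / 2 ^ j % 2 = 1 → ∀ w'', Near G α w' w'' → ruling α h G C j w'' →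
          h w'' / 2 ^ j % 2 = 0 → h w'' / 2 ^ j / 2 ≠ h w' / 2 ^ j / 2) := fun hc => h' ⟨hw', hc⟩
      push Not at this
      obtain ⟨_, w'', hn', hw'', h0, _⟩ := this
      refine ⟨w'', ⟨hw'', fun h1 => by omega⟩, ?_⟩
      rw [Nat.succ_mul]
      exact hn.trans hn'

end Ruling

/-- The nodes from which the colouring starts to be missing: the removed nodes, and the nodes of
the flexible sets of the centres in `S`, with flexible sets `H`. -/
def IsBase (g : ℕ) (rem : V → Prop) (G : SimpleGraph V) (x : V → Prop × Finset V) (v : V) : Prop :=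
  rem v ∨ ∃ s, Near G g v s ∧ (x s).1 ∧ v ∈ (x s).2

/-- The nodes at distance at most `l` from `B`. -/
def Within (l : ℕ) (G : SimpleGraph V) (B : V → Prop) (v : V) : Prop := ∃ z, Near G l v z ∧ B z

theorem Within.mono {l l' : ℕ} {G : SimpleGraph V} {B : V → Prop} {v : V} (h : Within l G B v)
    (hl : l ≤ l') : Within l' G B v := by
  obtain ⟨z, hz, hB⟩ := h
  exact ⟨z, hz.mono hl, hB⟩

theorem Within.exists_adj {l : ℕ} {G : SimpleGraph V} {B : V → Prop} {v : V}
    (h : Within (l + 1) G B v) (h' : ¬ Within l G B v) : ∃ u, G.Adj v u ∧ Within l G B u := by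
  obtain ⟨z, hz | ⟨k, hk, hz⟩, hB⟩ := h
  · exact absurd ⟨z, hz, hB⟩ h'
  · exact ⟨k, hk, z, hz, hB⟩

/-- A choice of an element from every nonempty set of colours. -/
abbrev ColorChoice (Δ : ℕ) : Type :=
  (A : {A : Finset (Fin Δ) // A.Nonempty}) → {c : Fin Δ // c ∈ A.1}

/-- The colours that do not occur at neighbours of `v`. -/
noncomputable def available {Δ : ℕ} (G : SimpleGraph V) (col : V → Option (Fin Δ)) (v : V) :
    Finset (Fin Δ) :=
  Finset.univ.filter fun c => ∀ u, G.Adj v u → col u ≠ some c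

theorem mem_available {Δ : ℕ} {G : SimpleGraph V} {col : V → Option (Fin Δ)} {v : V} {c : Fin Δ} :
    c ∈ available G col v ↔ ∀ u, G.Adj v u → col u ≠ some c := by
  simp only [available, Finset.mem_filter, Finset.mem_univ, true_and]

/-- The colour of `A` that is chosen, if `A` is not empty and `p` holds. -/
noncomputable def pick {Δ : ℕ} (p : Prop) (f : ColorChoice Δ) (A : Finset (Fin Δ)) :
    Option (Fin Δ) :=
  if h : p ∧ A.Nonempty then some (f ⟨A, h.2⟩).1 else none

/-- The colour that `v` tries: uncoloured nodes of `U` that are active choose an available one. -/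
noncomputable def attempt {Δ : ℕ} (r : V → Bool × ColorChoice Δ) (G : SimpleGraph V)
    (x : V → Prop × Option (Fin Δ)) (v : V) : Option (Fin Δ) :=
  pick ((x v).1 ∧ (x v).2 = none ∧ (r v).1 = true) (r v).2 (available G (fun u => (x u).2) v)

/-- `v` keeps the colour it tries if no neighbour tries the same. -/
noncomputable def keep {Δ : ℕ} (G : SimpleGraph V)
    (x : V → Option (Fin Δ) × Option (Fin Δ)) (v : V) : Option (Fin Δ) :=
  if (x v).1 ≠ none ∧ ∀ u, G.Adj v u → (x u).1 ≠ (x v).1 then (x v).1 else (x v).2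

theorem keep_congr {Δ : ℕ} {G G' : SimpleGraph V} {x x' : V → Option (Fin Δ) × Option (Fin Δ)}
    {v : V} (hG : ∀ k, G.Adj v k ↔ G'.Adj v k) (hv : x v = x' v)
    (hx : ∀ k, G.Adj v k → x k = x' k) : keep G x v = keep G' x' v := by
  unfold keep
  rw [hv]
  refine if_congr (and_congr_right fun _ => forall_congr' fun u => ?_) rfl rfl
  rw [← hG u]
  exact forall_congr' fun h => by rw [hx u h]

theorem available_congr {Δ : ℕ} {G G' : SimpleGraph V} {col col' : V → Option (Fin Δ)}
    {v : V} (hG : ∀ k, G.Adj v k ↔ G'.Adj v k) (hcol : ∀ k, G.Adj v k → col k = col' k) :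
    available G col v = available G' col' v := by
  ext c
  rw [mem_available, mem_available]
  refine forall_congr' fun u => ?_
  rw [← hG u]
  exact forall_congr' fun h => by rw [hcol u h]

/-- One step of random colour trials of the nodes of `U`. -/
noncomputable def trial {Δ : ℕ} (r : V → Bool × ColorChoice Δ) (G : SimpleGraph V)
    (U : V → Prop) (col : V → Option (Fin Δ)) (v : V) : Option (Fin Δ) :=
  keep G (fun w => (attempt r G (fun u => (U u, col u)) w, col w)) v

/-- `col` is a proper partial colouring. -/
def IsProper {Δ : ℕ} (G : SimpleGraph V) (col : V → Option (Fin Δ)) : Prop :=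
  ∀ v w, G.Adj v w → ∀ c, col v = some c → col w ≠ some c

section Trial

variable {Δ : ℕ} {G : SimpleGraph V} {U : V → Prop} {col : V → Option (Fin Δ)}
  {r : V → Bool × ColorChoice Δ}

theorem attempt_eq_some {v : V} {c : Fin Δ}
    (h : attempt r G (fun u => (U u, col u)) v = some c) :
    U v ∧ col v = none ∧ (r v).1 = true ∧ c ∈ available G col v := by
  unfold attempt pick at h
  split_ifs at h with h'
  obtain ⟨⟨h1, h2, h3⟩, h4⟩ := h'
  refine ⟨h1, h2, h3, ?_⟩
  rw [← Option.some.inj h]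
  exact ((r v).2 ⟨_, h4⟩).2

theorem trial_of_colored {v : V} (h : col v ≠ none) : trial r G U col v = col v := by
  have h1 : attempt r G (fun u => (U u, col u)) v = none := by
    unfold attempt pick
    rw [dif_neg]
    rintro ⟨⟨_, h2, _⟩, _⟩
    exact h h2
  unfold trial keep
  rw [if_neg]
  rintro ⟨h2, _⟩
  exact h2 h1

theorem trial_of_notMem {v : V} (h : ¬ U v) : trial r G U col v = col v := by
  have h1 : attempt r G (fun u => (U u, col u)) v = none := by
    unfold attempt pick
    rw [dif_neg]
    rintro ⟨⟨h2, _⟩, _⟩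
    exact h h2
  unfold trial keep
  rw [if_neg]
  rintro ⟨h2, _⟩
  exact h2 h1

theorem trial_eq_some {v : V} {c : Fin Δ} (h : trial r G U col v = some c) :
    col v = some c ∨ (attempt r G (fun u => (U u, col u)) v = some c ∧
      ∀ u, G.Adj v u → attempt r G (fun u => (U u, col u)) u ≠ some c) := by
  unfold trial keep at h
  split_ifs at h with h'
  · right
    refine ⟨h, fun u hu => ?_⟩
    have := h'.2 u hu
    simp only at this h
    rwa [h] at this
  · exact Or.inl h

theorem IsProper.trial (h : IsProper G col) : IsProper G (trial r G U col) := by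
  intro v w hvw c hv hw
  rcases trial_eq_some hv with hv | ⟨hv, hv'⟩ <;> rcases trial_eq_some hw with hw | ⟨hw, hw'⟩
  · exact h v w hvw c hv hw
  · have := (attempt_eq_some hw).2.2.2
    exact mem_available.1 this v hvw.symm hv
  · have := (attempt_eq_some hv).2.2.2
    exact mem_available.1 this w hvw hw
  · exact hv' w hvw hw

end Trial

/-- The nodes that try colours in step `τ`: those at distance `R - τ / K` from `B`. -/
def IsTurn (R K : ℕ) (G : SimpleGraph V) (B : V → Prop) (τ : ℕ) (v : V) : Prop :=
  Within (R - τ / K) G B v ∧ ¬ Within (R - τ / K - 1) G B v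

/-- The partial colouring after `τ` steps of colour trials. -/
noncomputable def colorAfter {Δ : ℕ} (R K : ℕ) (r : Fin (R * K) → V → Bool × ColorChoice Δ)
    (G : SimpleGraph V) (B : V → Prop) : ℕ → V → Option (Fin Δ)
  | 0 => fun _ => none
  | τ + 1 => if h : τ < R * K then
      trial (r ⟨τ, h⟩) G (IsTurn R K G B τ) (colorAfter R K r G B τ)
    else colorAfter R K r G B τ

section ColorAfter

variable {Δ R K : ℕ} {G : SimpleGraph V} {B : V → Prop}
  {r : Fin (R * K) → V → Bool × ColorChoice Δ}

theorem isProper_colorAfter (τ : ℕ) : IsProper G (colorAfter R K r G B τ) := by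
  induction τ with
  | zero => intro v w _ c h; simp [colorAfter] at h
  | succ τ ih =>
    unfold colorAfter
    split_ifs
    · exact ih.trial
    · exact ih

theorem colorAfter_succ_of_colored {τ : ℕ} {v : V} (h : colorAfter R K r G B τ v ≠ none) :
    colorAfter R K r G B (τ + 1) v = colorAfter R K r G B τ v := by
  rw [colorAfter]
  split_ifs
  · exact trial_of_colored h
  · rfl

theorem colorAfter_ne_none_mono {τ τ' : ℕ} (hτ : τ ≤ τ') {v : V}
    (h : colorAfter R K r G B τ v ≠ none) : colorAfter R K r G B τ' v ≠ none := by
  induction hτ with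
  | refl => exact h
  | step _ ih => rwa [colorAfter_succ_of_colored ih]

/-- Only nodes far from the base are coloured in the first steps. -/
theorem not_within_of_colorAfter {τ : ℕ} {v : V} (h : colorAfter R K r G B τ v ≠ none) :
    ∀ l < R - (τ - 1) / K, ¬ Within l G B v := by
  induction τ with
  | zero => exact absurd rfl h
  | succ τ ih =>
    intro l hl
    have hmono : (τ - 1) / K ≤ τ / K := Nat.div_le_div_right (by omega)
    rw [Nat.add_sub_cancel] at hl
    by_cases h' : colorAfter R K r G B τ v = none
    · rw [colorAfter] at h
      split_ifs at h with hτ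
      · by_cases hU : IsTurn R K G B τ v
        · exact fun hw => hU.2 (hw.mono (by omega))
        · rw [trial_of_notMem hU] at h
          exact absurd h' h
      · exact absurd h' h
    · exact ih h' l (by omega)

end ColorAfter

/-- `c` colours the part of `F` in the ball of radius `g` around `s` from the lists `L`. -/
def IsExtension {Δ : ℕ} (g : ℕ) (G : SimpleGraph V) (x : V → Finset V × Finset (Fin Δ)) (s : V)
    (c : V → Fin Δ) : Prop :=
  (∀ v ∈ (x s).1.filter (Near G g s), c v ∈ (x v).2) ∧
    ∀ v ∈ (x s).1.filter (Near G g s), ∀ w ∈ (x s).1.filter (Near G g s), G.Adj v w → c v ≠ c w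

/-- The colouring of its flexible set that a centre chooses. -/
noncomputable def extension {Δ : ℕ} [NeZero Δ] (g : ℕ) (G : SimpleGraph V)
    (x : V → Finset V × Finset (Fin Δ)) (s : V) : V → Fin Δ :=
  Classical.epsilon (IsExtension g G x s)

/-- The colouring in which the nodes of flexible sets of centres take the colour that the centre
has chosen. -/
noncomputable def complete {Δ : ℕ} (g : ℕ) (G : SimpleGraph V)
    (x : V → (Prop × Finset V) × (V → Fin Δ) × Option (Fin Δ)) (v : V) : Option (Fin Δ) :=
  if h : ∃ s, Near G g v s ∧ (x s).1.1 ∧ v ∈ (x s).1.2 then some ((x h.choose).2.1 v)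
  else (x v).2.2

variable [Fintype V] [DecidableEq V]

theorem Flexible.congr {Δ : ℕ} {G G' : SimpleGraph V} {F : Finset V}
    (h : ∀ v ∈ F, ∀ w, G.Adj v w ↔ G'.Adj v w) : Flexible Δ G F ↔ Flexible Δ G' F := by
  refine forall_congr' fun L => ?_
  have h1 : (∀ v ∈ F, Δ ≤ (L v).card + (Finset.univ.filter fun w => G.Adj v w ∧ w ∉ F).card) ↔
      (∀ v ∈ F, Δ ≤ (L v).card + (Finset.univ.filter fun w => G'.Adj v w ∧ w ∉ F).card) :=
    forall₂_congr fun v hv => by simp only [h v hv]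
  rw [h1]
  exact imp_congr_right fun _ => exists_congr fun c =>
    ListColorable.congr (fun v hv => ⟨rfl, h v hv⟩) c

/-- `F` is a nonempty flexible set in the ball of radius `g` around `w`. -/
def IsGadget (Δ g : ℕ) (G : SimpleGraph V) (w : V) (F : Finset V) : Prop :=
  (∀ x ∈ F, Near G g w x) ∧ F.Nonempty ∧ Flexible Δ G F

/-- `w` is the centre of a ball of radius `g` with a flexible set. -/
def IsCenter (Δ g : ℕ) (G : SimpleGraph V) (w : V) : Prop := ∃ F, IsGadget Δ g G w F

/-- The flexible set chosen by a centre. -/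
noncomputable def gadget (Δ g : ℕ) (G : SimpleGraph V) (w : V) : Finset V :=
  Classical.epsilon (IsGadget Δ g G w)

theorem isGadget_gadget {Δ g : ℕ} {G : SimpleGraph V} {w : V} (h : IsCenter Δ g G w) :
    IsGadget Δ g G w (gadget Δ g G w) :=
  Classical.epsilon_spec h

/-- An equality of predicates, because `gadget` is an epsilon choice: graphs that agree around `w`
then select the same set. -/
theorem IsGadget.congr {Δ g : ℕ} {G G' : SimpleGraph V} {w : V}
    (h : ∀ k, Near G g w k → ∀ l, G.Adj k l ↔ G'.Adj k l) :
    IsGadget Δ g G w = IsGadget Δ g G' w := by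
  funext F
  rw [IsGadget, IsGadget, eq_iff_iff]
  have h1 : (∀ x ∈ F, Near G g w x) ↔ (∀ x ∈ F, Near G' g w x) :=
    forall₂_congr fun x _ => Near.congr h
  rw [← h1]
  exact and_congr_right fun hF => and_congr_right fun _ => Flexible.congr fun v hv => h v (hF v hv)

/-- The parameters of the colouring algorithm. -/
structure Params where
  /-- the number of colours -/
  Δ : ℕ
  /-- the radius of the balls in which flexible sets are searched -/
  g : ℕ
  /-- the number of bits of the labels -/
  b : ℕ
  /-- a node is removed with probability `1 / Q` -/
  Q : ℕ
  /-- the number of colour trials of each node -/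
  K : ℕ
  three_le : 3 ≤ Δ
  Q_pos : 0 < Q

namespace Params

variable (P : Params)

instance : NeZero P.Δ := ⟨by have := P.three_le; omega⟩

instance : NeZero P.Q := ⟨P.Q_pos.ne'⟩

/-- The distance of the centres in the ruling set. -/
def α : ℕ := 2 * P.g + 1

/-- The number of layers. -/
def R : ℕ := P.b * P.α + P.g

/-- The random choices: labels, removals, and colour trials. -/
abbrev Seed (V : Type*) : Type _ :=
  (V → Fin (2 ^ P.b)) × (V → Fin P.Q) × (Fin (P.R * P.K) → V → Bool × ColorChoice P.Δ)

variable (ω : P.Seed V) (G : SimpleGraph V)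

/-- The ruling set of centres. -/
def rule (v : V) : Prop :=
  ruling P.α (fun w => (ω.1 w : ℕ)) G (IsCenter P.Δ P.g G) P.b v

/-- The base of the layers. -/
def base (v : V) : Prop :=
  IsBase P.g (fun w => ω.2.1 w = 0) G (fun s => (P.rule ω G s, gadget P.Δ P.g G s)) v

/-- The partial colouring by colour trials. -/
noncomputable def layered (v : V) : Option (Fin P.Δ) :=
  colorAfter P.R P.K ω.2.2 G (P.base ω G) (P.R * P.K) v

/-- The final partial colouring. -/
noncomputable def coloring (v : V) : Option (Fin P.Δ) :=
  complete P.g G (fun s => ((P.rule ω G s, gadget P.Δ P.g G s),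
    extension P.g G (fun w => (gadget P.Δ P.g G w, available G (P.layered ω G) w)) s,
    P.layered ω G s)) v

end Params

end Algorithm

/-! ### Round count of the random partial colouring for a fixed seed. -/

section AlgorithmLocality

open scoped Classical

namespace Params

variable (P : Params) {N : ℕ} [NeZero N] (ω : P.Seed (Fin N))

theorem isLocal_center :
    IsLocal.{u} (1 + P.g) (fun (G : SimpleGraph (Fin N)) i => IsCenter P.Δ P.g G i) :=
  IsLocal.of_ball (IsLocal.const ()) le_rfl (fun G _ i => IsCenter P.Δ P.g G i)
    fun G G' _ _ i h => by
      simp only [IsCenter, IsGadget.congr fun k hk => (h k hk).2]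

theorem isLocal_gadget :
    IsLocal.{u} (1 + P.g) (fun (G : SimpleGraph (Fin N)) i => gadget P.Δ P.g G i) :=
  IsLocal.of_ball (IsLocal.const ()) le_rfl (fun G _ i => gadget P.Δ P.g G i)
    fun G G' _ _ i h => by
      simp only [gadget, IsGadget.congr fun k hk => (h k hk).2]

theorem isLocal_ruling (h : Fin N → ℕ) (j : ℕ) : IsLocal.{u} (1 + P.g + (j + 1) * P.α)
    (fun (G : SimpleGraph (Fin N)) i => ruling P.α h G (IsCenter P.Δ P.g G) j i) := by
  induction j with
  | zero =>
    rw [zero_add, one_mul]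
    refine IsLocal.of_ball P.isLocal_center (by omega) (IsCandidate P.α h) fun G G' x x' i hx => ?_
    have h1 : ∀ w, Near G P.α i w ↔ Near G' P.α i w := fun w => Near.congr fun k hk => (hx k hk).2
    simp only [IsCandidate, ← h1, (hx i (Near.refl i)).1, eq_iff_iff]
    refine and_congr_right fun _ => forall₂_congr fun w hw => ?_
    rw [(hx w hw).1]
  | succ j ih =>
    rw [add_mul (j + 1), one_mul, ← add_assoc]
    refine IsLocal.of_ball ih (by omega) (rulingStep P.α h j) fun G G' x x' i hx => ?_
    have h1 : ∀ w, Near G P.α i w ↔ Near G' P.α i w := fun w => Near.congr fun k hk => (hx k hk).2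
    simp only [rulingStep, ← h1, (hx i (Near.refl i)).1, eq_iff_iff]
    refine and_congr_right fun _ => imp_congr_right fun _ => forall₂_congr fun w hw => ?_
    rw [(hx w hw).1]

theorem isLocal_rule_gadget : IsLocal.{u} (1 + P.g + (P.b + 1) * P.α)
    (fun (G : SimpleGraph (Fin N)) i => (P.rule ω G i, gadget P.Δ P.g G i)) :=
  IsLocal.comp₂ Prod.mk (P.isLocal_ruling _ P.b) (P.isLocal_gadget.mono (by omega))

theorem isLocal_base : IsLocal.{u} (1 + P.g + (P.b + 1) * P.α + P.g)
    (fun (G : SimpleGraph (Fin N)) i => P.base ω G i) := by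
  refine IsLocal.of_ball (P.isLocal_rule_gadget ω) (by omega)
    (IsBase P.g (fun w => ω.2.1 w = 0)) fun G G' x x' i hx => ?_
  have h1 : ∀ w, Near G P.g i w ↔ Near G' P.g i w := fun w => Near.congr fun k hk => (hx k hk).2
  simp only [IsBase, ← h1, eq_iff_iff]
  refine or_congr_right (exists_congr fun s => and_congr_right fun hs => ?_)
  rw [(hx s hs).1]

theorem isLocal_turn (τ : ℕ) : IsLocal.{u} (1 + P.g + (P.b + 1) * P.α + P.g + P.R)
    (fun (G : SimpleGraph (Fin N)) i => IsTurn P.R P.K G (P.base ω G) τ i) := by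
  have h : ∀ l ≤ P.R, IsLocal.{u} (1 + P.g + (P.b + 1) * P.α + P.g + P.R)
      (fun (G : SimpleGraph (Fin N)) i => Within l G (P.base ω G) i) := fun l hl =>
    (IsLocal.exists_near (r := l) (P.isLocal_base ω)).mono (by omega)
  exact IsLocal.comp₂ (fun p q => p ∧ ¬ q) (h _ (Nat.sub_le _ _))
    (h _ ((Nat.sub_le _ _).trans (Nat.sub_le _ _)))

/-- Two rounds per trial: one to learn the colours already taken by neighbours, one to compare the
attempts. -/
theorem isLocal_trial {Δ t : ℕ} (r : Fin N → Bool × ColorChoice Δ)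
    {U : SimpleGraph (Fin N) → Fin N → Prop} {col : SimpleGraph (Fin N) → Fin N → Option (Fin Δ)}
    (hU : IsLocal.{u} t U) (hcol : IsLocal.{u} t col) (ht : 1 ≤ t) :
    IsLocal.{u} (t + 2) (fun G i => trial r G (U G) (col G) i) := by
  have h1 : IsLocal.{u} (t + 1) (fun G i => attempt r G (fun u => (U G u, col G u)) i) := by
    refine IsLocal.of_ball (IsLocal.comp₂ Prod.mk hU hcol) ht (attempt r) fun G G' x x' i hx => ?_
    have h2 : available G (fun u => (x u).2) i = available G' (fun u => (x' u).2) i :=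
      available_congr (hx i (Near.refl i)).2 fun k hk => by rw [(hx k (Near.of_adj hk)).1]
    unfold attempt
    rw [h2, (hx i (Near.refl i)).1]
  refine IsLocal.of_ball (r := 1) (IsLocal.comp₂ Prod.mk h1 hcol.succ) (by omega) keep
    fun G G' x x' i hx => ?_
  exact keep_congr (hx i (Near.refl i)).2 (hx i (Near.refl i)).1
    fun k hk => (hx k (Near.of_adj hk)).1

theorem isLocal_colorAfter (τ : ℕ) :
    IsLocal.{u} (1 + P.g + (P.b + 1) * P.α + P.g + P.R + 2 * τ)
    (fun (G : SimpleGraph (Fin N)) i => colorAfter P.R P.K ω.2.2 G (P.base ω G) τ i) := by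
  induction τ with
  | zero => exact IsLocal.const none
  | succ τ ih =>
    by_cases h : τ < P.R * P.K
    · simp only [colorAfter, dif_pos h]
      exact isLocal_trial (t := 1 + P.g + (P.b + 1) * P.α + P.g + P.R + 2 * τ) _
        ((P.isLocal_turn ω τ).mono (Nat.le_add_right _ _)) ih (by omega)
    · simp only [colorAfter, dif_neg h]
      exact ih.mono (by omega)

/-- The number of rounds of the algorithm. -/
def time : ℕ := 1 + P.g + (P.b + 1) * P.α + P.g + P.R + 2 * (P.R * P.K) + 1 + P.g + P.g

theorem isLocal_coloring :
    IsLocal.{u} P.time (fun (G : SimpleGraph (Fin N)) i => P.coloring ω G i) := by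
  have hcol : IsLocal.{u} (1 + P.g + (P.b + 1) * P.α + P.g + P.R + 2 * (P.R * P.K))
      (fun (G : SimpleGraph (Fin N)) i => P.layered ω G i) :=
    P.isLocal_colorAfter ω (P.R * P.K)
  have hav : IsLocal.{u} (1 + P.g + (P.b + 1) * P.α + P.g + P.R + 2 * (P.R * P.K) + 1)
      (fun (G : SimpleGraph (Fin N)) i => available G (P.layered ω G) i) := by
    refine IsLocal.of_ball hcol (by omega) available fun G G' x x' i hx => ?_
    exact available_congr (hx i (Near.refl i)).2 fun k hk => (hx k (Near.of_adj hk)).1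
  have hext : IsLocal.{u} (1 + P.g + (P.b + 1) * P.α + P.g + P.R + 2 * (P.R * P.K) + 1 + P.g)
      (fun (G : SimpleGraph (Fin N)) i => extension P.g G
        (fun w => (gadget P.Δ P.g G w, available G (P.layered ω G) w)) i) := by
    refine IsLocal.of_ball (IsLocal.comp₂ Prod.mk (P.isLocal_gadget.mono (by omega)) hav)
      (by omega) (extension P.g) fun G G' x x' i hx => ?_
    have h1 : ∀ w, Near G P.g i w ↔ Near G' P.g i w := fun w => Near.congr fun k hk => (hx k hk).2
    unfold extension
    congr 1
    funext c
    unfold IsExtension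
    simp only [← h1, (hx i (Near.refl i)).1, eq_iff_iff]
    refine ListColorable.congr (fun v hv => ?_) c
    have := hx v (Finset.mem_filter.1 hv).2
    exact ⟨by rw [this.1], this.2⟩
  refine IsLocal.of_ball (IsLocal.comp₂ Prod.mk ((P.isLocal_rule_gadget ω).mono (by omega))
    (IsLocal.comp₂ Prod.mk hext (hcol.mono (by omega)))) (by omega) (complete P.g)
    fun G G' x x' i hx => ?_
  have h1 : ∀ w, Near G P.g i w ↔ Near G' P.g i w := fun w => Near.congr fun k hk => (hx k hk).2
  have h2 : (fun s => Near G P.g i s ∧ (x s).1.1 ∧ i ∈ (x s).1.2) =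
      (fun s => Near G' P.g i s ∧ (x' s).1.1 ∧ i ∈ (x' s).1.2) := by
    funext s
    rw [eq_iff_iff, ← h1]
    exact and_congr_right fun hs => by rw [(hx s hs).1]
  unfold complete
  by_cases h : ∃ s, Near G P.g i s ∧ (x s).1.1 ∧ i ∈ (x s).1.2
  · have h' : ∃ s, Near G' P.g i s ∧ (x' s).1.1 ∧ i ∈ (x' s).1.2 := by
      rwa [← h2]
    rw [dif_pos h, dif_pos h']
    have e : h.choose = h'.choose := by
      congr 1
    rw [← e, (hx _ h.choose_spec.1).1]
  · have h' : ¬ ∃ s, Near G' P.g i s ∧ (x' s).1.1 ∧ i ∈ (x' s).1.2 := by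
      rwa [← h2]
    rw [dif_neg h, dif_neg h', (hx i (Near.refl i)).1]

end Params

end AlgorithmLocality

/-! ### The colouring is proper for every seed. -/

section Properness

open scoped Classical

variable {V : Type*} [Fintype V]

/-- Each coloured neighbour blocks at most one of the `Δ` colours. -/
theorem le_card_available_add {Δ : ℕ} (G : SimpleGraph V) (col : V → Option (Fin Δ)) (v : V) :
    Δ ≤ (available G col v).card +
      (Finset.univ.filter fun w => G.Adj v w ∧ col w ≠ none).card := by
  have h1 : (available G col v)ᶜ ⊆
      ((Finset.univ.filter fun w => G.Adj v w ∧ col w ≠ none).image col).biUnion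
        Option.toFinset := by
    intro c hc
    rw [Finset.mem_compl, mem_available] at hc
    push Not at hc
    obtain ⟨u, hu, hc⟩ := hc
    simp only [Finset.mem_biUnion, Finset.mem_image, Finset.mem_filter, Finset.mem_univ, true_and,
      Option.mem_toFinset]
    exact ⟨_, ⟨u, ⟨hu, by simp [hc]⟩, rfl⟩, hc⟩
  have h2 := Finset.card_add_card_compl (available G col v)
  rw [Fintype.card_fin] at h2
  have h3 := (Finset.card_le_card h1).trans (Finset.card_biUnion_le)
  have h4 : ∑ x ∈ (Finset.univ.filter fun w => G.Adj v w ∧ col w ≠ none).image col,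
      x.toFinset.card ≤ ((Finset.univ.filter fun w => G.Adj v w ∧ col w ≠ none).image col).card := by
    rw [Finset.card_eq_sum_ones]
    refine Finset.sum_le_sum fun x _ => ?_
    cases x <;> simp
  have h5 := Finset.card_image_le (s := Finset.univ.filter fun w => G.Adj v w ∧ col w ≠ none)
    (f := col)
  omega

variable [DecidableEq V]

namespace Params

variable (P : Params) (ω : P.Seed V) {G : SimpleGraph V}

/-- The trials stop at the layer of distance 1, so the base itself never gets a turn. -/
theorem layered_eq_none_of_base {v : V} (h : P.base ω G v) : P.layered ω G v = none := by
  by_contra hne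
  rcases Nat.eq_zero_or_pos (P.R * P.K) with h0 | h0
  · have h1 : ∀ τ, τ = 0 → colorAfter P.R P.K ω.2.2 G (P.base ω G) τ v = none := by
      rintro _ rfl
      rfl
    exact hne (h1 _ h0)
  · have hK : 0 < P.K := Nat.pos_of_mul_pos_left h0
    have h1 : (P.R * P.K - 1) / P.K < P.R := by
      rw [Nat.div_lt_iff_lt_mul hK]
      omega
    exact not_within_of_colorAfter hne 0 (by omega) ⟨v, rfl, h⟩

variable {P ω}

theorem base_of_mem_gadget {s v : V} (hs : P.rule ω G s) (hv : v ∈ gadget P.Δ P.g G s) :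
    Near G P.g v s ∧ P.base ω G v := by
  have h1 := (isGadget_gadget (ruling_isCandidate hs).1).1 v hv
  exact ⟨h1.symm, Or.inr ⟨s, h1.symm, hs, hv⟩⟩

theorem rule_unique {s s' : V} (hs : P.rule ω G s) (hs' : P.rule ω G s') (h : Near G P.α s s') :
    s = s' :=
  ruling_far (fun v => (ω.1 v).2) hs hs' h

/-- The nodes of the flexible set belong to the base and are still uncoloured. Only neighbours
outside the set have taken colours, which is the hypothesis on the lists in `Flexible`, so an
extension exists and the epsilon choice is one. -/
theorem isExtension_extension {s : V} (hs : P.rule ω G s) :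
    (∀ v ∈ gadget P.Δ P.g G s, extension P.g G
      (fun w => (gadget P.Δ P.g G w, available G (P.layered ω G) w)) s v ∈
        available G (P.layered ω G) v) ∧
    ∀ v ∈ gadget P.Δ P.g G s, ∀ w ∈ gadget P.Δ P.g G s, G.Adj v w →
      extension P.g G (fun w => (gadget P.Δ P.g G w, available G (P.layered ω G) w)) s v ≠
      extension P.g G (fun w => (gadget P.Δ P.g G w, available G (P.layered ω G) w)) s w := by
  have h1 := isGadget_gadget (ruling_isCandidate hs).1
  have h2 : (gadget P.Δ P.g G s).filter (Near G P.g s) = gadget P.Δ P.g G s :=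
    Finset.filter_true_of_mem h1.1
  have h3 : ∃ c, IsExtension P.g G
      (fun w => (gadget P.Δ P.g G w, available G (P.layered ω G) w)) s c := by
    unfold IsExtension
    simp only [h2]
    refine h1.2.2 (available G (P.layered ω G)) fun v hv => ?_
    refine (le_card_available_add G (P.layered ω G) v).trans (Nat.add_le_add_left ?_ _)
    refine Finset.card_le_card fun w hw => ?_
    rw [Finset.mem_filter] at hw ⊢
    refine ⟨hw.1, hw.2.1, fun hw' => hw.2.2 ?_⟩
    exact P.layered_eq_none_of_base ω (base_of_mem_gadget hs hw').2
  have h4 : IsExtension P.g G (fun w => (gadget P.Δ P.g G w, available G (P.layered ω G) w)) s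
      (extension P.g G (fun w => (gadget P.Δ P.g G w, available G (P.layered ω G) w)) s) :=
    Classical.epsilon_spec h3
  rw [IsExtension] at h4
  simp only [h2] at h4
  exact h4

theorem coloring_of_mem_gadget {s v : V} (hs : P.rule ω G s) (hv : v ∈ gadget P.Δ P.g G s) :
    P.coloring ω G v = some (extension P.g G
      (fun w => (gadget P.Δ P.g G w, available G (P.layered ω G) w)) s v) := by
  have h : ∃ s, Near G P.g v s ∧ P.rule ω G s ∧ v ∈ gadget P.Δ P.g G s :=
    ⟨s, (base_of_mem_gadget hs hv).1, hs, hv⟩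
  have e : h.choose = s := by
    refine rule_unique h.choose_spec.2.1 hs ?_
    exact (h.choose_spec.1.symm.trans (base_of_mem_gadget hs hv).1).mono (by unfold α; omega)
  unfold coloring complete
  rw [dif_pos h, e]

theorem coloring_of_forall_notMem {v : V}
    (h : ∀ s, P.rule ω G s → v ∉ gadget P.Δ P.g G s) : P.coloring ω G v = P.layered ω G v := by
  unfold coloring complete
  rw [dif_neg]
  rintro ⟨s, _, hs, hv⟩
  exact h s hs hv

/-- Adjacent nodes of selected flexible sets have centres at distance at most `2 * g + 1 = α`, so
the centres coincide. All other edges are safe because the extension uses available colours and the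
layered colouring is proper. -/
theorem isProper_coloring : IsProper G (P.coloring ω G) := by
  intro v w hvw c hv hw
  by_cases h1 : ∃ s, P.rule ω G s ∧ v ∈ gadget P.Δ P.g G s <;>
    by_cases h2 : ∃ s, P.rule ω G s ∧ w ∈ gadget P.Δ P.g G s
  · obtain ⟨s, hs, hvs⟩ := h1
    obtain ⟨s', hs', hws'⟩ := h2
    obtain rfl : s = s' := by
      refine rule_unique hs hs' ?_
      exact ((base_of_mem_gadget hs hvs).1.symm.snoc hvw).trans (base_of_mem_gadget hs' hws').1
        |>.mono (by unfold α; omega)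
    rw [coloring_of_mem_gadget hs hvs] at hv
    rw [coloring_of_mem_gadget hs hws'] at hw
    exact (isExtension_extension hs).2 v hvs w hws' hvw (Option.some.inj (hv.trans hw.symm))
  · obtain ⟨s, hs, hvs⟩ := h1
    push Not at h2
    rw [coloring_of_mem_gadget hs hvs] at hv
    rw [coloring_of_forall_notMem h2] at hw
    have := (isExtension_extension hs).1 v hvs
    rw [Option.some.inj hv] at this
    exact mem_available.1 this w hvw hw
  · obtain ⟨s, hs, hws⟩ := h2
    push Not at h1
    rw [coloring_of_mem_gadget hs hws] at hw
    rw [coloring_of_forall_notMem h1] at hv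
    have := (isExtension_extension hs).1 w hws
    rw [Option.some.inj hw] at this
    exact mem_available.1 this v hvw.symm hv
  · push Not at h1 h2
    rw [coloring_of_forall_notMem h1] at hv
    rw [coloring_of_forall_notMem h2] at hw
    exact isProper_colorAfter _ v w hvw c hv hw

/-- How a node can remain uncoloured. -/
theorem of_coloring_eq_none {v : V} (h : P.coloring ω G v = none) :
    ω.2.1 v = 0 ∨ ¬ Within P.R G (P.base ω G) v ∨
      ∃ l < P.R, Within (l + 1) G (P.base ω G) v ∧ ¬ Within l G (P.base ω G) v ∧
        P.layered ω G v = none := by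
  by_cases h0 : ω.2.1 v = 0
  · exact Or.inl h0
  by_cases hR : Within P.R G (P.base ω G) v
  swap
  · exact Or.inr (Or.inl hR)
  refine Or.inr (Or.inr ?_)
  have hng : ∀ s, P.rule ω G s → v ∉ gadget P.Δ P.g G s := by
    intro s hs hv
    rw [coloring_of_mem_gadget hs hv] at h
    simp at h
  rw [coloring_of_forall_notMem hng] at h
  have hex : ∃ l, Within l G (P.base ω G) v := ⟨_, hR⟩
  obtain ⟨l, hl⟩ : ∃ l, Nat.find hex = l + 1 := by
    refine Nat.exists_eq_succ_of_ne_zero fun e => ?_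
    obtain ⟨z, hz, hb⟩ := (Nat.find_eq_zero hex).1 e
    obtain rfl : v = z := hz
    rcases hb with hb | ⟨s, _, hs, hv⟩
    · exact h0 hb
    · exact hng s hs hv
  refine ⟨l, ?_, hl ▸ Nat.find_spec hex, Nat.find_min hex (by omega), h⟩
  have := Nat.find_min' hex hR
  omega

end Params

end Properness

/-! ### Finite uniform probability and the success rate of colour trials. -/

section Probability

open scoped Classical BigOperators

/-- The indicator of a proposition. -/
noncomputable def ind (p : Prop) : ℝ := if p then 1 else 0

theorem ind_of {p : Prop} (h : p) : ind p = 1 := if_pos h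

theorem ind_of_not {p : Prop} (h : ¬ p) : ind p = 0 := if_neg h

theorem ind_nonneg (p : Prop) : 0 ≤ ind p := by
  unfold ind
  split_ifs <;> norm_num

theorem ind_le_one (p : Prop) : ind p ≤ 1 := by
  unfold ind
  split_ifs <;> norm_num

/-- The probability of `p` under the uniform distribution. -/
noncomputable def prob {Ω : Type*} [Fintype Ω] (p : Ω → Prop) : ℝ := 𝔼 ω, ind (p ω)

section

variable {Ω Ω' : Type*} [Fintype Ω] [Fintype Ω'] {p q : Ω → Prop}

theorem prob_le_one [Nonempty Ω] : prob p ≤ 1 :=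
  Finset.expect_le Finset.univ_nonempty fun _ _ => ind_le_one _

theorem prob_mono (h : ∀ ω, p ω → q ω) : prob p ≤ prob q := by
  refine Finset.expect_le_expect fun ω _ => ?_
  by_cases hp : p ω
  · rw [ind_of hp, ind_of (h ω hp)]
  · rw [ind_of_not hp]
    exact ind_nonneg _

theorem prob_eq_zero (h : ∀ ω, ¬ p ω) : prob p = 0 :=
  Finset.expect_eq_zero fun ω _ => ind_of_not (h ω)

theorem prob_or_le : prob (fun ω => p ω ∨ q ω) ≤ prob p + prob q := by
  unfold prob
  rw [← Finset.expect_add_distrib]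
  refine Finset.expect_le_expect fun ω _ => ?_
  by_cases hp : p ω
  · rw [ind_of hp]
    linarith [ind_le_one (p ω ∨ q ω), ind_nonneg (q ω)]
  · simp only [hp, false_or]
    linarith [ind_nonneg False]

theorem prob_exists_le {ι : Type*} (s : Finset ι) (p : ι → Ω → Prop) :
    prob (fun ω => ∃ i ∈ s, p i ω) ≤ ∑ i ∈ s, prob (p i) := by
  induction s using Finset.induction_on with
  | empty => rw [Finset.sum_empty, prob_eq_zero (by simp)]
  | insert a s ha ih =>
    rw [Finset.sum_insert ha]
    refine le_trans ?_ (add_le_add_right ih _)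
    refine le_trans (prob_mono fun ω h => ?_) prob_or_le
    obtain ⟨i, hi, h⟩ := h
    rcases Finset.mem_insert.1 hi with rfl | hi
    · exact Or.inl h
    · exact Or.inr ⟨i, hi, h⟩

theorem prob_prod (p : Ω × Ω' → Prop) : prob p = 𝔼 ω, prob fun ω' => p (ω, ω') := by
  unfold prob
  rw [← Finset.univ_product_univ, Finset.expect_product]

theorem prob_prod_le {p : Ω × Ω' → Prop} {a : ℝ} [Nonempty Ω]
    (h : ∀ ω, prob (fun ω' => p (ω, ω')) ≤ a) : prob p ≤ a := by
  rw [prob_prod]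
  exact Finset.expect_le Finset.univ_nonempty fun ω _ => h ω

theorem prob_fst [Nonempty Ω'] (p : Ω → Prop) : prob (fun ω : Ω × Ω' => p ω.1) = prob p := by
  rw [prob_prod]
  unfold prob
  simp only [Fintype.expect_const]

theorem prob_snd [Nonempty Ω] (p : Ω' → Prop) : prob (fun ω : Ω × Ω' => p ω.2) = prob p := by
  rw [prob_prod]
  simp only [Fintype.expect_const]

theorem prob_eq_card_div (p : Ω → Prop) [DecidablePred p] :
    prob p = ((Finset.univ.filter p).card : ℝ) / Fintype.card Ω := by
  unfold prob
  rw [Fintype.expect_eq_sum_div_card]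
  have : ∀ ω, ind (p ω) = if p ω then 1 else 0 := fun ω => by
    by_cases h : p ω
    · rw [ind_of h, if_pos h]
    · rw [ind_of_not h, if_neg h]
  simp only [this, Finset.sum_boole]

theorem prob_le_of_unique (h : ∀ ω ω', p ω → p ω' → ω = ω') : prob p ≤ 1 / Fintype.card Ω := by
  rw [prob_eq_card_div]
  refine div_le_div_of_nonneg_right ?_ (Nat.cast_nonneg _)
  norm_cast
  rw [Finset.card_le_one]
  intro x hx y hy
  exact h x y (Finset.mem_filter.1 hx).2 (Finset.mem_filter.1 hy).2

end

section Resampling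

variable {ι : Type*} [Fintype ι] [DecidableEq ι] {R : ι → Type*} [∀ i, Fintype (R i)]
  [∀ i, Nonempty (R i)]

/-- Resampling one coordinate does not change the expectation. -/
theorem expect_resample (i : ι) (f : (∀ i, R i) → ℝ) :
    𝔼 ω, f ω = 𝔼 ω, 𝔼 r : R i, f (Function.update ω i r) := by
  have h1 : 𝔼 x : (∀ i, R i) × R i, f (Function.update x.1 i x.2) =
      𝔼 x : (∀ i, R i) × R i, f x.1 := by
    -- Exchanging coordinate `i` with the fresh sample is an involution of the product space.
    let e : ((∀ i, R i) × R i) ≃ ((∀ i, R i) × R i) :=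
      { toFun := fun x => (Function.update x.1 i x.2, x.1 i)
        invFun := fun x => (Function.update x.1 i x.2, x.1 i)
        left_inv := fun x => by simp
        right_inv := fun x => by simp }
    exact Fintype.expect_equiv e _ _ fun x => rfl
  rw [← Finset.univ_product_univ, Finset.expect_product, Finset.expect_product] at h1
  simp only [Fintype.expect_const] at h1
  exact h1.symm

theorem prob_resample (i : ι) (p : (∀ i, R i) → Prop) :
    prob p = 𝔼 ω, prob fun r : R i => p (Function.update ω i r) :=
  expect_resample i _

/-- This replaces conditional probability: `q` is necessary for `p` whatever coordinate `i` is, and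
given `q` the fresh coordinate produces `p` with probability at most `a`. -/
theorem prob_resample_le {i : ι} {p q : (∀ i, R i) → Prop} {a : ℝ}
    (h : ∀ ω, q ω → prob (fun r : R i => p (Function.update ω i r)) ≤ a)
    (h' : ∀ ω r, ¬ q ω → ¬ p (Function.update ω i r)) : prob p ≤ a * prob q := by
  rw [prob_resample i]
  unfold prob
  rw [Finset.mul_expect]
  refine Finset.expect_le_expect fun ω _ => ?_
  by_cases hq : q ω
  · rw [ind_of hq, mul_one]
    exact h ω hq
  · rw [ind_of_not hq, mul_zero]
    exact (Finset.expect_eq_zero fun r _ => ind_of_not (h' ω r hq)).le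

theorem prob_coord (i : ι) (p : R i → Prop) :
    prob (fun ω : ∀ i, R i => p (ω i)) = prob p := by
  rw [prob_resample i]
  simp only [Function.update_self, Fintype.expect_const]

end Resampling

instance (Δ : ℕ) : Nonempty (ColorChoice Δ) :=
  ⟨fun A => ⟨A.2.choose, A.2.choose_spec⟩⟩

/-- A seed holds one independent choice for every nonempty colour set, so it can be drawn before the
graph is known. Whichever set `A` occurs, its coordinate is uniform on `A`. -/
theorem prob_choice_eq_le {Δ : ℕ} (A : {A : Finset (Fin Δ) // A.Nonempty}) (c : Fin Δ) :
    prob (fun f : ColorChoice Δ => (f A).1 = c) ≤ 1 / A.1.card := by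
  have : ∀ B : {A : Finset (Fin Δ) // A.Nonempty}, Nonempty {c : Fin Δ // c ∈ B.1} :=
    fun B => B.2.to_subtype
  rw [prob_coord (R := fun B : {A : Finset (Fin Δ) // A.Nonempty} => {c : Fin Δ // c ∈ B.1}) A
    (fun x => x.1 = c)]
  have h1 : Fintype.card {c : Fin Δ // c ∈ A.1} = A.1.card := Fintype.card_coe A.1
  rw [← h1]
  exact prob_le_of_unique fun x y hx hy => Subtype.ext (hx.trans hy.symm)

theorem prob_bool_eq_le (s : Bool) : prob (fun s' : Bool => s' = s) ≤ 1 / 2 := by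
  have := prob_le_of_unique (p := fun s' : Bool => s' = s) fun x y hx hy => hx.trans hy.symm
  simpa using this

theorem prob_active_le {Δ : ℕ} {V : Type*} [Fintype V] [DecidableEq V] (v : V) (s : Bool) :
    prob (fun r : V → Bool × ColorChoice Δ => (r v).1 = s) ≤ 1 / 2 := by
  rw [prob_coord (R := fun _ : V => Bool × ColorChoice Δ) v (fun x => x.1 = s),
    prob_fst (fun s' : Bool => s' = s)]
  exact prob_bool_eq_le s

/-- An active node picks a given colour with small probability. -/
theorem prob_pick_le {Δ : ℕ} {A : Finset (Fin Δ)} (hA : A.Nonempty) (p : Prop) (c : Fin Δ) :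
    prob (fun x : Bool × ColorChoice Δ => x.1 = true ∧ pick p x.2 A = some c) ≤
      1 / 2 * (1 / A.card) := by
  rw [prob_prod]
  have h2 : ∀ s : Bool, prob (fun f : ColorChoice Δ => s = true ∧ pick p f A = some c) ≤
      ind (s = true) * (1 / A.card) := by
    intro s
    by_cases hs : s = true
    · rw [ind_of hs, one_mul]
      refine le_trans (prob_mono fun f hf => ?_) (prob_choice_eq_le ⟨A, hA⟩ c)
      have hf := hf.2
      unfold pick at hf
      split_ifs at hf with h
      exact Option.some.inj hf
    · rw [ind_of_not hs, zero_mul, prob_eq_zero fun f hf => hs hf.1]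
  refine (Finset.expect_le_expect fun s _ => h2 s).trans ?_
  rw [← Finset.expect_mul]
  exact mul_le_mul_of_nonneg_right (prob_bool_eq_le true) (by positivity)

variable {V : Type*}

theorem colorAfter_congr {Δ R K : ℕ} {G : SimpleGraph V} {B : V → Prop}
    {r r' : Fin (R * K) → V → Bool × ColorChoice Δ} {τ : ℕ}
    (h : ∀ i : Fin (R * K), i < τ → r i = r' i) :
    colorAfter R K r G B τ = colorAfter R K r' G B τ := by
  induction τ with
  | zero => rfl
  | succ τ ih =>
    rw [colorAfter, colorAfter, ih fun i hi => h i (by omega)]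
    split_ifs with hτ
    · rw [h ⟨τ, hτ⟩ (Nat.lt_succ_self τ)]
    · rfl

variable [Fintype V] [DecidableEq V]

/-- `u` must be active, with probability at most `1 / 2`. Its attempt does not depend on the
randomness of `v`, and `v` is active and hits that one colour with probability at most `1 / 2`
divided by the number of available colours. -/
theorem prob_conflict_le {Δ : ℕ} {G : SimpleGraph V} {U : V → Prop} {col : V → Option (Fin Δ)}
    {v u : V} (huv : u ≠ v) (hA : (available G col v).Nonempty) :
    prob (fun r : V → Bool × ColorChoice Δ => (r v).1 = true ∧
      ∃ c, attempt r G (fun w => (U w, col w)) u = some c ∧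
        attempt r G (fun w => (U w, col w)) v = some c) ≤
      1 / (4 * (available G col v).card) := by
  have hstep : ∀ r : V → Bool × ColorChoice Δ, (r u).1 = true →
      prob (fun x : Bool × ColorChoice Δ => (Function.update r v x v).1 = true ∧
        ∃ c, attempt (Function.update r v x) G (fun w => (U w, col w)) u = some c ∧
          attempt (Function.update r v x) G (fun w => (U w, col w)) v = some c) ≤
        1 / 2 * (1 / (available G col v).card) := by
    intro r _
    have h1 : ∀ x, attempt (Function.update r v x) G (fun w => (U w, col w)) u =
        attempt r G (fun w => (U w, col w)) u := by
      intro x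
      unfold attempt
      rw [Function.update_of_ne huv]
    simp only [h1, Function.update_self]
    rcases hu : attempt r G (fun w => (U w, col w)) u with _ | c
    · rw [prob_eq_zero (by simp)]
      positivity
    · refine (prob_mono fun x hx => ?_).trans
        (prob_pick_le hA (U v ∧ col v = none) c)
      obtain ⟨h2, c', hc, h3⟩ := hx
      obtain rfl := Option.some.inj hc
      refine ⟨h2, ?_⟩
      unfold attempt at h3
      simpa [h2] using h3
  have h3 := prob_resample_le (i := v) (R := fun _ : V => Bool × ColorChoice Δ)
    (p := fun r => (r v).1 = true ∧ ∃ c, attempt r G (fun w => (U w, col w)) u = some c ∧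
      attempt r G (fun w => (U w, col w)) v = some c)
    (q := fun r => (r u).1 = true) hstep ?_
  · refine h3.trans ?_
    refine (mul_le_mul_of_nonneg_left (prob_active_le u true) (by positivity)).trans (le_of_eq ?_)
    simp only [one_div, mul_inv]
    ring
  · rintro r x hr ⟨_, c, hc, _⟩
    have := (attempt_eq_some hc).2.2.1
    rw [Function.update_of_ne huv] at this
    exact hr this

/-- A colour trial fails with probability at most `3 / 4`. -/
theorem prob_trial_le {Δ : ℕ} {G : SimpleGraph V} {U : V → Prop} {col : V → Option (Fin Δ)} {v : V}
    (hU : U v) (hv : col v = none)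
    (hA : (Finset.univ.filter fun u => G.Adj v u ∧ U u ∧ col u = none).card + 1 ≤
      (available G col v).card) :
    prob (fun r : V → Bool × ColorChoice Δ => trial r G U col v = none) ≤ 3 / 4 := by
  set M := Finset.univ.filter fun u => G.Adj v u ∧ U u ∧ col u = none with hM
  have hApos : (available G col v).Nonempty := Finset.card_pos.1 (by omega)
  have h1 : ∀ r : V → Bool × ColorChoice Δ, trial r G U col v = none →
      (¬ (r v).1 = true) ∨ ∃ u ∈ M, (r v).1 = true ∧
        ∃ c, attempt r G (fun w => (U w, col w)) u = some c ∧
          attempt r G (fun w => (U w, col w)) v = some c := by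
    intro r hr
    by_cases hact : (r v).1 = true
    swap
    · exact Or.inl hact
    right
    obtain ⟨c, hc⟩ : ∃ c, attempt r G (fun w => (U w, col w)) v = some c := by
      unfold attempt pick
      rw [dif_pos ⟨⟨hU, hv, hact⟩, hApos⟩]
      exact ⟨_, rfl⟩
    by_contra hcon
    unfold trial keep at hr
    rw [if_pos] at hr
    · simp only at hr
      rw [hr] at hc
      simp at hc
    · refine ⟨by simp [hc], fun u hu e => hcon ?_⟩
      simp only at e
      have := attempt_eq_some (e.trans hc)
      exact ⟨u, by simp [hM, hu, this.1, this.2.1], hact, c, e.trans hc, hc⟩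
  -- Inactivity accounts for `1 / 2`. There are fewer competitors than available colours, so all
  -- conflicts together account for at most `1 / 4`.
  refine (prob_mono h1).trans (prob_or_le.trans ?_)
  have h2 : prob (fun r : V → Bool × ColorChoice Δ => ¬ (r v).1 = true) ≤ 1 / 2 := by
    simp only [Bool.not_eq_true]
    exact prob_active_le v false
  have h3 := (prob_exists_le M (fun u (r : V → Bool × ColorChoice Δ) => (r v).1 = true ∧
        ∃ c, attempt r G (fun w => (U w, col w)) u = some c ∧
          attempt r G (fun w => (U w, col w)) v = some c)).trans
    (Finset.sum_le_sum fun u hu => prob_conflict_le (U := U)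
      ((Finset.mem_filter.1 hu).2.1.ne.symm) hApos)
  rw [Finset.sum_const, nsmul_eq_mul] at h3
  have hpos : (0 : ℝ) < (available G col v).card := by exact_mod_cast Finset.card_pos.2 hApos
  have h4 : (M.card : ℝ) * (1 / (4 * (available G col v).card)) ≤ 1 / 4 := by
    rw [mul_one_div, div_le_div_iff₀ (by positivity) (by norm_num)]
    have : (M.card : ℝ) + 1 ≤ (available G col v).card := by exact_mod_cast hA
    linarith
  linarith

/-- A node at distance `l + 1` from the base remains uncoloured with small probability. -/
theorem prob_colorAfter_le {Δ R K : ℕ} {G : SimpleGraph V} (hΔ : ∀ v, degIn G Finset.univ v ≤ Δ)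
    {B : V → Prop} {v : V} {l : ℕ} (hl : l < R) (h1 : Within (l + 1) G B v)
    (h2 : ¬ Within l G B v) :
    prob (fun r : Fin (R * K) → V → Bool × ColorChoice Δ =>
      colorAfter R K r G B (R * K) v = none) ≤ (3 / 4) ^ K := by
  have hwin : ∀ j ≤ K, prob (fun r : Fin (R * K) → V → Bool × ColorChoice Δ =>
      colorAfter R K r G B ((R - (l + 1)) * K + j) v = none) ≤ (3 / 4) ^ j := by
    intro j
    induction j with
    | zero =>
      intro _
      rw [pow_zero]
      exact prob_le_one
    | succ j ih =>
      intro hj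
      have hτ : (R - (l + 1)) * K + j < R * K := by
        have : (R - (l + 1)) * K + K ≤ R * K := by
          rw [← Nat.succ_mul]
          exact Nat.mul_le_mul_right K (by omega)
        omega
      have hdiv : ((R - (l + 1)) * K + j) / K = R - (l + 1) := by
        rw [mul_comm, Nat.mul_add_div (by omega), Nat.div_eq_of_lt (by omega), add_zero]
      rw [pow_succ, mul_comm ((3 / 4 : ℝ) ^ j)]
      set τ := (R - (l + 1)) * K + j with hτdef
      refine le_trans ?_ (mul_le_mul_of_nonneg_left (ih (by omega)) (by norm_num))
      -- The state before step `τ` does not depend on the randomness of step `τ`, so that coordinate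
      -- can be resampled.
      have hup : ∀ (r : Fin (R * K) → V → Bool × ColorChoice Δ) s,
          colorAfter R K (Function.update r ⟨τ, hτ⟩ s) G B τ = colorAfter R K r G B τ := by
        intro r s
        refine colorAfter_congr fun i hi => Function.update_of_ne ?_ _ _
        rintro rfl
        exact lt_irrefl _ hi
      have hsucc : ∀ (r : Fin (R * K) → V → Bool × ColorChoice Δ) s,
          colorAfter R K (Function.update r ⟨τ, hτ⟩ s) G B (τ + 1) =
            trial s G (IsTurn R K G B τ) (colorAfter R K r G B τ) := by
        intro r s
        rw [colorAfter, dif_pos hτ, Function.update_self, hup]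
      rw [show (R - (l + 1)) * K + (j + 1) = τ + 1 by omega]
      refine prob_resample_le (i := (⟨τ, hτ⟩ : Fin (R * K)))
        (R := fun _ : Fin (R * K) => V → Bool × ColorChoice Δ) (fun r hr => ?_) (fun r s hr => ?_)
      · simp only [hsucc]
        refine prob_trial_le ?_ hr ?_
        · unfold IsTurn
          rw [hdiv]
          refine ⟨h1.mono (by omega), fun h => h2 (h.mono (by omega))⟩
        -- The neighbour `u` nearer to the base is neither coloured nor competing. So coloured
        -- neighbours and competitors number at most `Δ - 1` together, and the available colours
        -- outnumber the competitors.
        · obtain ⟨u, hvu, hu⟩ := h1.exists_adj h2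
          have hucol : colorAfter R K r G B τ u = none := by
            by_contra hne
            refine not_within_of_colorAfter hne l ?_ hu
            have : (τ - 1) / K ≤ τ / K := Nat.div_le_div_right (by omega)
            omega
          have huU : ¬ IsTurn R K G B τ u := by
            unfold IsTurn
            rw [hdiv]
            exact fun h => h.2 (hu.mono (by omega))
          have h3 := le_card_available_add G (colorAfter R K r G B τ) v
          have h4 := hΔ v
          unfold degIn at h4
          set X := Finset.univ.filter fun w => G.Adj v w ∧ colorAfter R K r G B τ w ≠ none
          set Y := Finset.univ.filter fun w => G.Adj v w ∧ IsTurn R K G B τ w ∧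
            colorAfter R K r G B τ w = none
          have h5 : insert u (X ∪ Y) ⊆ Finset.univ.filter fun w => G.Adj v w := by
            intro w hw
            simp only [X, Y, Finset.mem_insert, Finset.mem_union, Finset.mem_filter,
              Finset.mem_univ, true_and] at hw ⊢
            rcases hw with rfl | hw | hw
            · exact hvu
            · exact hw.1
            · exact hw.1
          have h6 : u ∉ X ∪ Y := by
            simp [X, Y, hucol, huU]
          have h7 : Disjoint X Y := by
            rw [Finset.disjoint_left]
            intro w hw hw'
            exact (Finset.mem_filter.1 hw).2.2 (Finset.mem_filter.1 hw').2.2.2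
          have h8 := Finset.card_le_card h5
          rw [Finset.card_insert_of_notMem h6, Finset.card_union_of_disjoint h7] at h8
          omega
      · rw [hsucc, trial_of_colored hr]
        exact hr
  refine le_trans (prob_mono fun r hr => ?_) (hwin K le_rfl)
  by_contra hne
  refine colorAfter_ne_none_mono ?_ hne hr
  rw [← Nat.succ_mul]
  exact Nat.mul_le_mul_right K (by omega)

end Probability

/-! ### The probability that a node remains uncoloured. -/

section Failure

open scoped Classical BigOperators

variable {V : Type*} [Fintype V] [DecidableEq V]

theorem prob_forall_ne_zero_le {Q : ℕ} [NeZero Q] (S : Finset V) :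
    prob (fun f : V → Fin Q => ∀ x ∈ S, f x ≠ 0) ≤ (1 - 1 / (Q : ℝ)) ^ S.card := by
  induction S using Finset.induction_on with
  | empty =>
    rw [Finset.card_empty, pow_zero]
    exact prob_le_one
  | insert a S ha ih =>
    have hQ : (0 : ℝ) < Q := by exact_mod_cast Nat.pos_of_ne_zero (NeZero.ne Q)
    have hQ1 : (0 : ℝ) ≤ 1 - 1 / (Q : ℝ) := by
      rw [sub_nonneg, div_le_one hQ]
      exact_mod_cast Nat.one_le_iff_ne_zero.2 (NeZero.ne Q)
    have hne : prob (fun r : Fin Q => r ≠ 0) ≤ 1 - 1 / (Q : ℝ) := by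
      rw [prob_eq_card_div, Finset.filter_ne', Finset.card_erase_of_mem (Finset.mem_univ _),
        Finset.card_univ, Fintype.card_fin, Nat.cast_pred (Nat.pos_of_ne_zero (NeZero.ne Q)),
        sub_div, div_self hQ.ne']
    rw [Finset.card_insert_of_notMem ha, pow_succ, mul_comm]
    refine le_trans ?_ (mul_le_mul_of_nonneg_left ih hQ1)
    refine prob_resample_le (i := a) (R := fun _ : V => Fin Q)
      (p := fun f => ∀ x ∈ insert a S, f x ≠ 0) (q := fun f => ∀ x ∈ S, f x ≠ 0)
      (fun f _ => ?_) (fun f r hf hr => hf fun x hx => ?_)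
    · refine (prob_mono fun r hr => ?_).trans hne
      simpa using hr a (Finset.mem_insert_self a S)
    · have := hr x (Finset.mem_insert_of_mem hx)
      rwa [Function.update_of_ne (ne_of_mem_of_not_mem hx ha)] at this

/-- At least `Q ^ 2` chances of `1 / Q` each are all missed with probability at most `exp (-Q) ≤ 1 /
Q`. -/
theorem one_sub_inv_pow_le {Q n : ℕ} (hQ : 0 < Q) (hn : Q ^ 2 ≤ n) :
    (1 - 1 / (Q : ℝ)) ^ n ≤ 1 / Q := by
  have hQ' : (0 : ℝ) < Q := by exact_mod_cast hQ
  have h0 : (0 : ℝ) ≤ 1 - 1 / (Q : ℝ) := by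
    rw [sub_nonneg, div_le_one hQ']
    exact_mod_cast hQ
  have h1 : 1 - 1 / (Q : ℝ) ≤ Real.exp (-(1 / Q)) := by
    linarith [Real.add_one_le_exp (-(1 / (Q : ℝ)))]
  calc (1 - 1 / (Q : ℝ)) ^ n ≤ (1 - 1 / (Q : ℝ)) ^ (Q ^ 2) :=
        pow_le_pow_of_le_one h0 (by linarith [one_div_pos.2 hQ']) hn
    _ ≤ Real.exp (-(1 / Q)) ^ (Q ^ 2) := pow_le_pow_left₀ h0 h1 _
    _ = Real.exp (-Q) := by
        rw [← Real.exp_nat_mul]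
        congr 1
        push_cast
        field_simp
    _ ≤ 1 / Q := by
        rw [Real.exp_neg, ← one_div]
        exact one_div_le_one_div_of_le hQ' (by linarith [Real.add_one_le_exp (Q : ℝ)])

theorem prob_label_eq_le {b : ℕ} {v w : V} (h : w ≠ v) :
    prob (fun f : V → Fin (2 ^ b) => f w = f v) ≤ 1 / 2 ^ b := by
  have := prob_resample_le (i := w) (R := fun _ : V => Fin (2 ^ b))
    (p := fun f => f w = f v) (q := fun _ => True) (a := 1 / 2 ^ b) (fun f _ => ?_) (by simp)
  · refine this.trans (mul_le_of_le_one_right (by positivity) prob_le_one)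
  · simp only [Function.update_self, Function.update_of_ne h.symm]
    have := prob_le_of_unique (p := fun r : Fin (2 ^ b) => r = f v)
      fun x y hx hy => hx.trans hy.symm
    simpa using this

namespace Params

variable (P : Params) {G : SimpleGraph V} {v : V}

theorem prob_removed_le (v : V) : prob (fun ω : P.Seed V => ω.2.1 v = 0) ≤ 1 / P.Q := by
  rw [prob_snd (fun x : (V → Fin P.Q) × (Fin (P.R * P.K) → V → Bool × ColorChoice P.Δ) =>
    x.1 v = 0), prob_fst (fun x : V → Fin P.Q => x v = 0),
    prob_coord (R := fun _ : V => Fin P.Q) v (fun x => x = 0)]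
  have := prob_le_of_unique (p := fun r : Fin P.Q => r = 0) fun x y hx hy => hx.trans hy.symm
  simpa using this

/-- The ruling set is reached within `b * α`, and from there a node of the selected flexible set
within `g`; this is the choice of `R`. -/
theorem within_of_isCandidate {ω : P.Seed V}
    (h : IsCandidate P.α (fun w => (ω.1 w : ℕ)) G (IsCenter P.Δ P.g G) v) :
    Within P.R G (P.base ω G) v := by
  obtain ⟨s, hs, hn⟩ := exists_ruling_near h P.b
  have hs : P.rule ω G s := hs
  obtain ⟨h1, ⟨x, hx⟩, _⟩ := isGadget_gadget (ruling_isCandidate hs).1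
  exact ⟨x, hn.trans (h1 x hx), (base_of_mem_gadget hs hx).2⟩

/-- A centre can fail only if some node in its `α`-ball shares its label, and a union bound over at
most `(Δ + 1) ^ α` nodes applies. Any other node sees no flexible set, so by rigid growth its
`g`-ball has at least `Q ^ 2` nodes, and one of them is probably removed. -/
theorem prob_not_within_le (hΔ : ∀ v, degIn G Finset.univ v ≤ P.Δ)
    (hG : G.CliqueFree (P.Δ + 1)) (hb : (P.Δ + 1) ^ P.α * P.Q ≤ 2 ^ P.b) {k : ℕ}
    (hk : 2 * k ≤ P.g) (hQ : P.Q ^ 2 ≤ (P.Δ - 1) ^ k) (v : V) :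
    prob (fun ω : P.Seed V => ¬ Within P.R G (P.base ω G) v) ≤ 1 / P.Q := by
  have hQ0 : (0 : ℝ) < P.Q := by exact_mod_cast P.Q_pos
  by_cases hc : IsCenter P.Δ P.g G v
  · have h1 : ∀ ω : P.Seed V, ¬ Within P.R G (P.base ω G) v →
        ∃ w ∈ (Finset.univ.filter (Near G P.α v)).erase v, ω.1 w = ω.1 v := by
      intro ω hω
      by_contra hcon
      push Not at hcon
      refine hω (P.within_of_isCandidate ⟨hc, fun w hw hwv _ e => ?_⟩)
      exact hcon w (Finset.mem_erase.2 ⟨hwv, Finset.mem_filter.2 ⟨Finset.mem_univ w, hw⟩⟩)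
        (Fin.ext e)
    refine (prob_mono h1).trans ((prob_exists_le _ _).trans ?_)
    have h2 : ∀ w ∈ (Finset.univ.filter (Near G P.α v)).erase v,
        prob (fun ω : P.Seed V => ω.1 w = ω.1 v) ≤ 1 / 2 ^ P.b := by
      intro w hw
      rw [prob_fst (fun f : V → Fin (2 ^ P.b) => f w = f v)]
      exact prob_label_eq_le (Finset.ne_of_mem_erase hw)
    refine (Finset.sum_le_sum h2).trans ?_
    rw [Finset.sum_const, nsmul_eq_mul, mul_one_div, div_le_div_iff₀ (by positivity) hQ0, one_mul]
    have h3 := Finset.card_erase_le (s := Finset.univ.filter (Near G P.α v)) (a := v)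
    have h4 := h3.trans (card_ball_le hΔ P.α v)
    exact_mod_cast (Nat.mul_le_mul_right P.Q h4).trans hb
  · have hrigid : Rigid P.Δ G v P.g :=
      ⟨hΔ, P.three_le, hG, fun F hne hF hfl => hc ⟨F, hF, hne, hfl⟩⟩
    have h1 : ∀ ω : P.Seed V, ¬ Within P.R G (P.base ω G) v →
        ∀ x ∈ Finset.univ.filter (Near G P.g v), ω.2.1 x ≠ 0 := by
      intro ω hω x hx h0
      refine hω ⟨x, (Finset.mem_filter.1 hx).2.mono ?_, Or.inl h0⟩
      unfold R
      omega
    refine (prob_mono h1).trans ?_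
    rw [prob_snd (fun y : (V → Fin P.Q) × (Fin (P.R * P.K) → V → Bool × ColorChoice P.Δ) =>
      ∀ x ∈ Finset.univ.filter (Near G P.g v), y.1 x ≠ 0),
      prob_fst (fun y : V → Fin P.Q => ∀ x ∈ Finset.univ.filter (Near G P.g v), y x ≠ 0)]
    exact (prob_forall_ne_zero_le _).trans
      (one_sub_inv_pow_le P.Q_pos (hQ.trans (hrigid.pow_le_card_ball hk)))

theorem prob_unlucky_le (hΔ : ∀ v, degIn G Finset.univ v ≤ P.Δ) (v : V) :
    prob (fun ω : P.Seed V => ∃ l < P.R, Within (l + 1) G (P.base ω G) v ∧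
      ¬ Within l G (P.base ω G) v ∧ P.layered ω G v = none) ≤ (3 / 4) ^ P.K := by
  refine prob_prod_le fun h => prob_prod_le fun rem => ?_
  -- The base depends only on labels and removals. With these fixed the layers are fixed, and the
  -- trial seed inserted here is irrelevant.
  let B : V → Prop := P.base (h, rem, Classical.arbitrary _) G
  change prob (fun r : Fin (P.R * P.K) → V → Bool × ColorChoice P.Δ =>
    ∃ l < P.R, Within (l + 1) G B v ∧ ¬ Within l G B v ∧
      colorAfter P.R P.K r G B (P.R * P.K) v = none) ≤ _
  by_cases hl : ∃ l < P.R, Within (l + 1) G B v ∧ ¬ Within l G B v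
  · obtain ⟨l, hl, h1, h2⟩ := hl
    refine (prob_mono fun r hr => ?_).trans (prob_colorAfter_le hΔ hl h1 h2)
    obtain ⟨_, _, _, _, hr⟩ := hr
    exact hr
  · rw [prob_eq_zero]
    · positivity
    · rintro r ⟨l, h0, h1, h2, _⟩
      exact hl ⟨l, h0, h1, h2⟩

/-- Every node is coloured with high probability. -/
theorem prob_coloring_eq_none_le (hΔ : ∀ v, degIn G Finset.univ v ≤ P.Δ)
    (hG : G.CliqueFree (P.Δ + 1)) (hb : (P.Δ + 1) ^ P.α * P.Q ≤ 2 ^ P.b) {k : ℕ}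
    (hk : 2 * k ≤ P.g) (hQ : P.Q ^ 2 ≤ (P.Δ - 1) ^ k) (hK : (3 / 4 : ℝ) ^ P.K ≤ 1 / P.Q) (v : V) :
    prob (fun ω : P.Seed V => P.coloring ω G v = none) ≤ 3 / P.Q := by
  refine (prob_mono fun ω hω => of_coloring_eq_none hω).trans (prob_or_le.trans ?_)
  have h1 := P.prob_removed_le v
  have h2 := P.prob_not_within_le hΔ hG hb hk hQ v
  have h3 := (P.prob_unlucky_le hΔ v).trans hK
  have h4 := prob_or_le (p := fun ω : P.Seed V => ¬ Within P.R G (P.base ω G) v)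
    (q := fun ω : P.Seed V => ∃ l < P.R, Within (l + 1) G (P.base ω G) v ∧
      ¬ Within l G (P.base ω G) v ∧ P.layered ω G v = none)
  have h5 : (3 : ℝ) / P.Q = 1 / P.Q + (1 / P.Q + 1 / P.Q) := by ring
  linarith

end Params

end Failure

/-! ### From random partial colourings to fractional colourings. -/

section Encoding

open scoped Classical

/-- A set of colours, encoded by positive integers. -/
noncomputable def encodeColors {C : Type} [Fintype C] (Y : C → Prop) : Finset ℕ :=
  (Finset.univ.filter Y).image fun c => (Fintype.equivFin C c : ℕ) + 1

variable {C : Type} [Fintype C]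

theorem encodeColors_injective :
    Function.Injective fun c : C => (Fintype.equivFin C c : ℕ) + 1 := fun _ _ h =>
  (Fintype.equivFin C).injective (Fin.ext (Nat.succ.inj h))

/-- The witnesses are `p = |C|` and `q = ⌈|C| / r⌉`. Set sizes are integers, so rounding up keeps
them at least `q`, and it can only lower `p / q`. -/
theorem isFractionalColoring_encodeColors [Nonempty C] {V : Type u} {G : SimpleGraph V} {r : ℝ}
    (hr : 1 ≤ r) {Y : V → C → Prop}
    (hcard : ∀ v, (Fintype.card C : ℝ) ≤ r * (Finset.univ.filter (Y v)).card)
    (hdisj : ∀ v w, G.Adj v w → ∀ c, Y v c → ¬ Y w c) :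
    IsFractionalColoring G r fun v => encodeColors (Y v) := by
  have hr0 : 0 < r := by linarith
  have hC : (0 : ℝ) < Fintype.card C := by exact_mod_cast Fintype.card_pos
  have hq : 0 < ⌈(Fintype.card C : ℝ) / r⌉₊ := Nat.ceil_pos.2 (by positivity)
  refine ⟨Fintype.card C, ⌈(Fintype.card C : ℝ) / r⌉₊, ⟨hq, ?_, ?_, ?_, ?_⟩, ?_⟩
  · exact Nat.ceil_le.2 (div_le_self hC.le hr)
  · intro v x hx
    obtain ⟨c, _, rfl⟩ := Finset.mem_image.1 hx
    rw [Finset.mem_Icc]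
    have := (Fintype.equivFin C c).2
    omega
  · intro v
    change _ ≤ (encodeColors (Y v)).card
    unfold encodeColors
    rw [Finset.card_image_of_injective _ encodeColors_injective, Nat.ceil_le,
      div_le_iff₀ hr0, mul_comm]
    exact hcard v
  · intro v w hvw
    rw [Finset.disjoint_left]
    intro x hx hx'
    obtain ⟨c, hc, rfl⟩ := Finset.mem_image.1 hx
    obtain ⟨d, hd, e⟩ := Finset.mem_image.1 hx'
    obtain rfl := encodeColors_injective e
    exact hdisj v w hvw _ (Finset.mem_filter.1 hc).2 (Finset.mem_filter.1 hd).2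
  · rw [div_le_iff₀ (by exact_mod_cast hq), ← div_le_iff₀' hr0]
    exact Nat.le_ceil _

/-- The colour sets given by random partial colourings. -/
theorem isFractionalColoring_of_prob {Ω : Type} [Fintype Ω] [Nonempty Ω] {Δ : ℕ} [NeZero Δ]
    {V : Type u} {G : SimpleGraph V} {χ : Ω → V → Option (Fin Δ)} (hχ : ∀ ω, IsProper G (χ ω))
    {ε : ℝ} (hε : 0 < ε) (hfail : ∀ v, prob (fun ω => χ ω v = none) ≤ ε / (Δ + ε)) :
    IsFractionalColoring G (Δ + ε)
      fun v => encodeColors fun x : Ω × Fin Δ => χ x.1 v = some x.2 := by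
  have hΔ : (1 : ℝ) ≤ Δ := by exact_mod_cast Nat.one_le_iff_ne_zero.2 (NeZero.ne Δ)
  refine isFractionalColoring_encodeColors (by linarith) (fun v => ?_) fun v w hvw x hv hw => ?_
  · have h1 : (Finset.univ.filter fun x : Ω × Fin Δ => χ x.1 v = some x.2).card =
        (Finset.univ.filter fun ω => ¬ χ ω v = none).card := by
      refine Finset.card_bij (fun x _ => x.1) (fun x hx => ?_) (fun x hx y hy e => ?_)
        (fun ω hω => ?_)
      · rw [Finset.mem_filter] at hx ⊢
        exact ⟨Finset.mem_univ _, by simp [hx.2]⟩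
      · rw [Finset.mem_filter] at hx hy
        refine Prod.ext e (Option.some.inj ?_)
        rw [← hx.2, ← hy.2, e]
      · obtain ⟨c, hc⟩ := Option.ne_none_iff_exists'.1 (Finset.mem_filter.1 hω).2
        exact ⟨(ω, c), Finset.mem_filter.2 ⟨Finset.mem_univ _, hc⟩, rfl⟩
    have h2 := Finset.card_filter_add_card_filter_not (s := (Finset.univ : Finset Ω))
      (fun ω => χ ω v = none)
    rw [Finset.card_univ] at h2
    have h3 := hfail v
    have hΩ : (0 : ℝ) < Fintype.card Ω := by exact_mod_cast Fintype.card_pos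
    rw [prob_eq_card_div, div_le_div_iff₀ hΩ (by linarith)] at h3
    rw [Finset.filter_congr_decidable, h1, Fintype.card_prod, Fintype.card_fin]
    have h4 : ((Finset.univ.filter fun ω => χ ω v = none).card : ℝ) +
        (Finset.univ.filter fun ω => ¬ χ ω v = none).card = Fintype.card Ω := by
      exact_mod_cast h2
    -- The failing seeds make up at most the fraction `ε / (Δ + ε)`, so at least `Δ * |Ω| / (Δ + ε)`
    -- seeds colour `v`, and each contributes one pair out of `Δ * |Ω|`.
    push_cast
    nlinarith
  · exact hχ x.1 v w hvw x.2 hv hw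

end Encoding

/-! ### The case `ε ≥ 1`: random orders of the identifiers. -/

section Permutations

open scoped Classical

/-- The permutations that rank `v` before its neighbours. -/
def IsFirst {V : Type*} [LinearOrder V] (G : SimpleGraph V) (v : V) (π : Equiv.Perm V) : Prop :=
  ∀ u, G.Adj v u → π v < π u

/-- Every permutation has its minimum over the closed neighbourhood at one of at most `Δ + 1` nodes.
Transposing such a node with `v` injects its permutations into those of `v`. -/
theorem card_perm_le {V : Type*} [LinearOrder V] [Fintype V] {Δ : ℕ} {G : SimpleGraph V} {v : V}
    (hΔ : degIn G Finset.univ v ≤ Δ) :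
    Fintype.card (Equiv.Perm V) ≤ (Δ + 1) * (Finset.univ.filter (IsFirst G v)).card := by
  set S := insert v (Finset.univ.filter fun u => G.Adj v u) with hS
  let Z : V → Finset (Equiv.Perm V) := fun w => Finset.univ.filter fun π => ∀ u ∈ S, π w ≤ π u
  have hcover : (Finset.univ : Finset (Equiv.Perm V)) ⊆ S.biUnion Z := by
    intro π _
    obtain ⟨w, hw, hmin⟩ := S.exists_min_image π ⟨v, Finset.mem_insert_self v _⟩
    exact Finset.mem_biUnion.2 ⟨w, hw, Finset.mem_filter.2 ⟨Finset.mem_univ π, hmin⟩⟩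
  have hswap : ∀ w ∈ S, (Z w).card ≤ (Z v).card := by
    intro w hw
    refine Finset.card_le_card_of_injOn (fun π => π * Equiv.swap v w) (fun π hπ => ?_)
      fun π _ π' _ e => mul_right_cancel e
    have hπ := (Finset.mem_filter.1 hπ).2
    refine Finset.mem_coe.2 (Finset.mem_filter.2 ⟨Finset.mem_univ _, fun u hu => ?_⟩)
    rw [Equiv.Perm.mul_apply, Equiv.Perm.mul_apply, Equiv.swap_apply_left]
    refine hπ _ ?_
    rcases eq_or_ne u v with rfl | huv
    · rwa [Equiv.swap_apply_left]
    rcases eq_or_ne u w with rfl | huw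
    · rw [Equiv.swap_apply_right]
      exact Finset.mem_insert_self v _
    · rwa [Equiv.swap_apply_of_ne_of_ne huv huw]
  have hZv : Z v ⊆ Finset.univ.filter (IsFirst G v) := by
    intro π hπ
    refine Finset.mem_filter.2 ⟨Finset.mem_univ _, fun u hu => ?_⟩
    refine lt_of_le_of_ne ((Finset.mem_filter.1 hπ).2 u ?_) fun e => hu.ne (π.injective e)
    exact Finset.mem_insert_of_mem (Finset.mem_filter.2 ⟨Finset.mem_univ u, hu⟩)
  calc Fintype.card (Equiv.Perm V) ≤ (S.biUnion Z).card := Finset.card_le_card hcover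
    _ ≤ ∑ w ∈ S, (Z w).card := Finset.card_biUnion_le
    _ ≤ ∑ w ∈ S, (Z v).card := Finset.sum_le_sum hswap
    _ = S.card * (Z v).card := by rw [Finset.sum_const, smul_eq_mul]
    _ ≤ (Δ + 1) * (Finset.univ.filter (IsFirst G v)).card := by
        refine Nat.mul_le_mul ((Finset.card_insert_le _ _).trans ?_) (Finset.card_le_card hZv)
        exact Nat.succ_le_succ hΔ

theorem isFractionalColoring_perm {N : ℕ} {Δ : ℕ} {G : SimpleGraph (Fin N)}
    (hΔ : ∀ v, degIn G Finset.univ v ≤ Δ) {ε : ℝ} (hε : 1 ≤ ε) :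
    IsFractionalColoring G (Δ + ε) fun v => encodeColors (IsFirst G v) := by
  have h0 : (0 : ℝ) ≤ Δ := Nat.cast_nonneg _
  refine isFractionalColoring_encodeColors (by linarith) (fun v => ?_) fun v w hvw π hv hw => ?_
  · have h1 : (Fintype.card (Equiv.Perm (Fin N)) : ℝ) ≤
        (Δ + 1) * (Finset.univ.filter (IsFirst G v)).card := by
      exact_mod_cast card_perm_le (hΔ v)
    exact h1.trans (mul_le_mul_of_nonneg_right (by linarith) (Nat.cast_nonneg _))
  · exact lt_asymm (hv w hvw) (hw v hvw.symm)

theorem isLocal_isFirst {N : ℕ} [NeZero N] : IsLocal.{u} 1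
    (fun (G : SimpleGraph (Fin N)) i => encodeColors (IsFirst G i)) :=
  IsLocal.comp₂ (fun (i : Fin N) (a : Fin N → Prop) => encodeColors fun π : Equiv.Perm (Fin N) =>
    ∀ u, a u → π i < π u) IsLocal.ident IsLocal.adj

end Permutations

/-! ### Choice of parameters and the time bounds. -/

section Choice

namespace Params

/-- The parameters for `Δ` colours and failure probability `O(Δ ^ (-k))`. -/
def ofExponent {Δ : ℕ} (hΔ : 3 ≤ Δ) (k : ℕ) : Params where
  Δ := Δ
  g := 8 * k
  b := (2 * (16 * k + 1) + k) * Nat.clog 2 Δ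
  Q := Δ ^ k
  K := 4 * k * Nat.clog 2 Δ
  three_le := hΔ
  Q_pos := by positivity

variable {Δ : ℕ} (hΔ : 3 ≤ Δ) {k : ℕ}

/-- The colour trials dominate: there are `R` layers, of order `k ^ 2 * log Δ`, with `K = 4 * k *
⌈log₂ Δ⌉` trials each. -/
theorem time_ofExponent_le (hk : 1 ≤ k) :
    (ofExponent hΔ k).time ≤ 10000 * (k ^ 3 * Nat.clog 2 Δ ^ 2) := by
  have hc : 1 ≤ Nat.clog 2 Δ := Nat.clog_pos (by norm_num) (by omega)
  have key : ∀ i ≤ 3, ∀ j ≤ 2, k ^ i * Nat.clog 2 Δ ^ j ≤ k ^ 3 * Nat.clog 2 Δ ^ 2 :=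
    fun i hi j hj => Nat.mul_le_mul (Nat.pow_le_pow_right hk hi) (Nat.pow_le_pow_right hc hj)
  simp only [time, R, α, ofExponent]
  generalize Nat.clog 2 Δ = c at *
  linarith [key 0 (by simp) 0 (by simp), key 1 (by simp) 0 (by simp), key 0 (by simp) 1 (by simp),
    key 1 (by simp) 1 (by simp), key 2 (by simp) 1 (by simp), key 2 (by simp) 2 (by simp),
    key 1 (by simp) 2 (by simp)]

theorem prob_ofExponent_le {V : Type*} [Fintype V] [DecidableEq V] {G : SimpleGraph V}
    (hdeg : ∀ v, degIn G Finset.univ v ≤ Δ) (hG : G.CliqueFree (Δ + 1)) (v : V) :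
    prob (fun ω : (ofExponent hΔ k).Seed V => (ofExponent hΔ k).coloring ω G v = none) ≤
      3 / (Δ : ℝ) ^ k := by
  have hclog : Δ ≤ 2 ^ Nat.clog 2 Δ := Nat.le_pow_clog (by norm_num) Δ
  have h := (ofExponent hΔ k).prob_coloring_eq_none_le hdeg hG ?_ (k := 4 * k) ?_ ?_ ?_ v
  · simpa [ofExponent] using h
  · change (Δ + 1) ^ (2 * (8 * k) + 1) * Δ ^ k ≤
      2 ^ ((2 * (16 * k + 1) + k) * Nat.clog 2 Δ)
    -- Here `α = 16 * k + 1`, and `Δ + 1 ≤ Δ ^ 2` doubles the exponent; this explains the value of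
    -- `b`.
    calc (Δ + 1) ^ (2 * (8 * k) + 1) * Δ ^ k ≤ (Δ ^ 2) ^ (2 * (8 * k) + 1) * Δ ^ k :=
          Nat.mul_le_mul_right _ (Nat.pow_le_pow_left (by nlinarith) _)
      _ = Δ ^ (2 * (16 * k + 1) + k) := by rw [← pow_mul, ← pow_add]; congr 1; ring
      _ ≤ (2 ^ Nat.clog 2 Δ) ^ (2 * (16 * k + 1) + k) := Nat.pow_le_pow_left hclog _
      _ = _ := by rw [← pow_mul, mul_comm]
  · change 2 * (4 * k) ≤ 8 * k
    omega
  · change (Δ ^ k) ^ 2 ≤ (Δ - 1) ^ (4 * k)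
    -- Passing from `Δ` to `Δ - 1` costs a factor 2 in the exponent and `Q ^ 2` another; with two
    -- levels per factor `Δ - 1` this gives `g = 8 * k`.
    have h1 : Δ ≤ (Δ - 1) ^ 2 := by
      obtain ⟨d, rfl⟩ : ∃ d, Δ = d + 1 := ⟨Δ - 1, by omega⟩
      rw [Nat.add_sub_cancel]
      nlinarith
    calc (Δ ^ k) ^ 2 ≤ (((Δ - 1) ^ 2) ^ k) ^ 2 :=
          Nat.pow_le_pow_left (Nat.pow_le_pow_left h1 _) _
      _ = _ := by rw [← pow_mul, ← pow_mul]; congr 1; ring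
  · change (3 / 4 : ℝ) ^ (4 * k * Nat.clog 2 Δ) ≤ 1 / ((Δ ^ k : ℕ) : ℝ)
    -- Four trials halve the failure probability, whence the 4 in `K`.
    have h1 : ((3 / 4 : ℝ) ^ 4) ^ (k * Nat.clog 2 Δ) ≤ (1 / 2) ^ (k * Nat.clog 2 Δ) :=
      pow_le_pow_left₀ (by norm_num) (by norm_num) _
    have h2 : ((Δ ^ k : ℕ) : ℝ) ≤ 2 ^ (k * Nat.clog 2 Δ) := by
      rw [mul_comm k, pow_mul]
      exact_mod_cast Nat.pow_le_pow_left hclog k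
    rw [mul_assoc, pow_mul]
    refine h1.trans ?_
    rw [one_div_pow]
    exact one_div_le_one_div_of_le (by positivity) h2

end Params

/-- The exponent for which the failure probability is small enough. -/
noncomputable def exponent (ε : ℝ) (Δ : ℕ) : ℕ := 3 + ⌈Real.log (1 / ε) / Real.log Δ⌉₊

theorem one_le_log_natCast {Δ : ℕ} (hΔ : 3 ≤ Δ) : 1 ≤ Real.log Δ := by
  have h : (3 : ℝ) ≤ Δ := by exact_mod_cast hΔ
  rw [Real.le_log_iff_exp_le (by linarith)]
  linarith [Real.exp_one_lt_d9]

/-- The ceiling contributes a factor at least `1 / ε`, and the summand 3 pays for `3 * (Δ + ε) ≤ Δ ^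
3`. -/
theorem three_div_pow_exponent_le {ε : ℝ} (hε : 0 < ε) (hε1 : ε < 1) {Δ : ℕ} (hΔ : 3 ≤ Δ) :
    3 / (Δ : ℝ) ^ exponent ε Δ ≤ ε / (Δ + ε) := by
  have h3 : (3 : ℝ) ≤ Δ := by exact_mod_cast hΔ
  have hx := one_le_log_natCast hΔ
  have h1 : 1 / ε ≤ (Δ : ℝ) ^ ⌈Real.log (1 / ε) / Real.log Δ⌉₊ := by
    rw [← Real.log_le_log_iff (by positivity) (by positivity), Real.log_pow]
    rw [← div_le_iff₀ (by linarith)]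
    exact Nat.le_ceil _
  rw [exponent, pow_add, div_le_div_iff₀ (by positivity) (by linarith)]
  have h2 : 1 ≤ ε * (Δ : ℝ) ^ ⌈Real.log (1 / ε) / Real.log Δ⌉₊ := by
    rwa [div_le_iff₀' hε] at h1
  have h4 : 3 * (Δ + ε) ≤ (Δ : ℝ) ^ 3 := by nlinarith [mul_self_nonneg ((Δ : ℝ) - 3)]
  calc 3 * (Δ + ε) ≤ (Δ : ℝ) ^ 3 * 1 := by rwa [mul_one]
    _ ≤ (Δ : ℝ) ^ 3 * (ε * (Δ : ℝ) ^ ⌈Real.log (1 / ε) / Real.log Δ⌉₊) :=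
        mul_le_mul_of_nonneg_left h2 (by positivity)
    _ = _ := by ring

theorem clog_two_le {Δ : ℕ} (hΔ : 3 ≤ Δ) : (Nat.clog 2 Δ : ℝ) ≤ 3 * Real.log Δ := by
  have hx := one_le_log_natCast hΔ
  have hc : 1 ≤ Nat.clog 2 Δ := Nat.clog_pos (by norm_num) (by omega)
  have h1 : (2 : ℝ) ^ (Nat.clog 2 Δ).pred ≤ Δ := by
    exact_mod_cast (Nat.pow_pred_clog_lt_self (by norm_num) (by omega)).le
  have h2 := Real.log_le_log (by positivity) h1
  rw [Real.log_pow, Nat.pred_eq_sub_one, Nat.cast_sub hc] at h2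
  have h3 := Real.log_two_gt_d9
  push_cast at h2
  nlinarith [(by exact_mod_cast hc : (1 : ℝ) ≤ Nat.clog 2 Δ)]

open Classical in
/-- The number of rounds of the algorithm for fractional `(Δ + ε)`-colouring. -/
noncomputable def rounds (ε : ℝ) (Δ : ℕ) : ℕ :=
  if h : 3 ≤ Δ ∧ ε < 1 then (Params.ofExponent h.1 (exponent ε Δ)).time else 1

theorem rounds_of_lt {ε : ℝ} (hε1 : ε < 1) {Δ : ℕ} (hΔ : 3 ≤ Δ) :
    rounds ε Δ = (Params.ofExponent hΔ (exponent ε Δ)).time := dif_pos ⟨hΔ, hε1⟩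

theorem rounds_of_le {ε : ℝ} (hε1 : 1 ≤ ε) (Δ : ℕ) : rounds ε Δ = 1 :=
  dif_neg fun h => absurd h.2 hε1.not_gt

theorem log_natCast_div {ε : ℝ} (hε : 0 < ε) {Δ : ℕ} (hΔ : 3 ≤ Δ) :
    Real.log (Δ / ε) = Real.log Δ + Real.log (1 / ε) := by
  rw [div_eq_mul_one_div, Real.log_mul (by positivity) (by positivity)]

/-- With `x = log Δ` and `y = log (1 / ε)`, the exponent satisfies `k * x ≤ 4 * x + y`. Multiplied
by `x`, the time is of order `(k * x) ^ 3`, hence at most a constant times `(x + y) ^ 3`, and `(x +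
y) ^ 2 ≤ 2 * (x ^ 2 + y ^ 2)`. -/
theorem rounds_le {ε : ℝ} (hε : 0 < ε) (hε1 : ε < 1) {Δ : ℕ} (hΔ : 3 ≤ Δ) :
    (rounds ε Δ : ℝ) ≤ 12000000 *
      ((Real.log Δ + Real.log (1 / ε) ^ 2 / Real.log Δ) * Real.log (Δ / ε)) := by
  have hx := one_le_log_natCast hΔ
  have hy : 0 ≤ Real.log (1 / ε) := Real.log_nonneg (one_le_one_div hε hε1.le)
  have hc := clog_two_le hΔ
  have hk : (exponent ε Δ : ℝ) * Real.log Δ ≤ 4 * Real.log Δ + Real.log (1 / ε) := by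
    have h1 := (Nat.ceil_lt_add_one (div_nonneg hy (by linarith : 0 ≤ Real.log Δ))).le
    have h2 : (exponent ε Δ : ℝ) ≤ 4 + Real.log (1 / ε) / Real.log Δ := by
      rw [exponent]
      push_cast
      linarith
    calc _ ≤ (4 + Real.log (1 / ε) / Real.log Δ) * Real.log Δ :=
          mul_le_mul_of_nonneg_right h2 (by linarith)
      _ = _ := by field_simp
  have ht : (rounds ε Δ : ℝ) ≤ 10000 * ((exponent ε Δ : ℝ) ^ 3 * (Nat.clog 2 Δ : ℝ) ^ 2) := by
    rw [rounds_of_lt hε1 hΔ]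
    exact_mod_cast Params.time_ofExponent_le hΔ (k := exponent ε Δ)
      (by rw [exponent]; omega)
  rw [log_natCast_div hε hΔ]
  have hk0 : (0 : ℝ) ≤ exponent ε Δ := Nat.cast_nonneg _
  have hc0 : (0 : ℝ) ≤ Nat.clog 2 Δ := Nat.cast_nonneg _
  generalize Real.log (Δ : ℝ) = x at *
  generalize Real.log (1 / ε) = y at *
  generalize (exponent ε Δ : ℝ) = k at *
  generalize (Nat.clog 2 Δ : ℝ) = c at *
  have hx0 : 0 < x := by linarith
  refine ht.trans ?_
  rw [← mul_le_mul_iff_left₀ hx0]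
  calc 10000 * (k ^ 3 * c ^ 2) * x ≤ 10000 * (k ^ 3 * (3 * x) ^ 2) * x := by gcongr
    _ = 90000 * (k * x) ^ 3 := by ring
    _ ≤ 90000 * (4 * x + y) ^ 3 := by gcongr
    _ ≤ 90000 * (4 * (x + y)) ^ 3 := by gcongr; linarith
    _ = 5760000 * ((x + y) ^ 2 * (x + y)) := by ring
    _ ≤ 5760000 * (2 * (x ^ 2 + y ^ 2) * (x + y)) := by
        gcongr
        nlinarith [sq_nonneg (x - y)]
    _ ≤ 12000000 * ((x ^ 2 + y ^ 2) * (x + y)) := by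
        have : 0 ≤ (x ^ 2 + y ^ 2) * (x + y) := by positivity
        linarith
    _ = 12000000 * ((x + y ^ 2 / x) * (x + y)) * x := by field_simp

/-- Expanding the product gives the sum of the second bound plus `x * y`, and `2 * x * y ≤ x ^ 2 + y
^ 2`. -/
theorem bounds_comparable {x y : ℝ} (hx : 0 < x) (hy : 0 ≤ y) :
    (x + y ^ 2 / x) * (x + y) ≤ 2 * (x ^ 2 + y ^ 2 + y ^ 3 / x) ∧
      x ^ 2 + y ^ 2 + y ^ 3 / x ≤ (x + y ^ 2 / x) * (x + y) := by
  have h : (x + y ^ 2 / x) * (x + y) = x ^ 2 + y ^ 2 + y ^ 3 / x + x * y := by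
    field_simp
    ring
  have h1 : 0 ≤ y ^ 3 / x := by positivity
  have h2 : 0 ≤ x * y := by positivity
  exact ⟨by nlinarith [sq_nonneg (x - y)], by linarith⟩

theorem rounds_le_of_lt {a : ℝ} (ha : 0 < a) {Δ : ℕ} (hΔ : 3 ≤ Δ) {ε : ℝ}
    (hε : 1 / (Δ : ℝ) ^ a < ε) :
    (rounds ε Δ : ℝ) ≤ 12000000 * ((1 + a ^ 2) * (1 + a)) * Real.log Δ ^ 2 := by
  have hx := one_le_log_natCast hΔ
  have hε0 : 0 < ε := lt_trans (by positivity) hε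
  rcases lt_or_ge ε 1 with hε1 | hε1
  · refine (rounds_le hε0 hε1 hΔ).trans ?_
    have hy : 0 ≤ Real.log (1 / ε) := Real.log_nonneg (one_le_one_div hε0 hε1.le)
    have hya : Real.log (1 / ε) ≤ a * Real.log Δ := by
      rw [← Real.log_rpow (by positivity)]
      refine Real.log_le_log (by positivity) ?_
      rw [div_le_iff₀ hε0]
      rw [div_lt_iff₀ (by positivity), mul_comm] at hε
      exact hε.le
    rw [log_natCast_div hε0 hΔ, mul_assoc]
    generalize Real.log (Δ : ℝ) = x at *
    generalize Real.log (1 / ε) = y at *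
    have hx0 : 0 < x := by linarith
    calc 12000000 * ((x + y ^ 2 / x) * (x + y))
        ≤ 12000000 * ((x + (a * x) ^ 2 / x) * (x + a * x)) := by gcongr
      _ = _ := by field_simp
  · rw [rounds_of_le hε1, Nat.cast_one]
    have h1 : 1 ≤ (1 + a ^ 2) * (1 + a) := by nlinarith [sq_nonneg a, mul_pos ha (sq_pos_of_pos ha)]
    nlinarith [mul_self_nonneg (Real.log (Δ : ℝ))]

end Choice

/-! ### Assembling the deterministic algorithm. -/

section Algorithm

variable {V : Type u} [Fintype V] {G : SimpleGraph V} [DecidableRel G.Adj] {N : ℕ}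

open Classical in
theorem degIn_univ_le {W : Type*} [Fintype W] {H : SimpleGraph W} {x : W} {S : Finset W}
    (h : ∀ y, H.Adj x y → y ∈ S) : degIn H Finset.univ x ≤ S.card :=
  Finset.card_le_card fun y hy => h y (Finset.mem_filter.1 hy).2

theorem degIn_map_le_maxDegree (e : V ↪ Fin N) (x : Fin N) :
    degIn (G.map e) Finset.univ x ≤ G.maxDegree := by
  by_cases hx : ∃ v, e v = x
  · obtain ⟨v, rfl⟩ := hx
    refine (degIn_univ_le (S := (G.neighborFinset v).map e) fun y hy => ?_).trans ?_
    · rw [SimpleGraph.map_adj] at hy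
      obtain ⟨a, w, haw, ha, rfl⟩ := hy
      obtain rfl := e.injective ha
      exact Finset.mem_map_of_mem e ((SimpleGraph.mem_neighborFinset _ _ _).2 haw)
    · rw [Finset.card_map]
      exact G.degree_le_maxDegree v
  · refine (degIn_univ_le (S := ∅) fun y hy => absurd ?_ hx).trans (Nat.zero_le _)
    rw [SimpleGraph.map_adj] at hy
    obtain ⟨a, _, _, ha, _⟩ := hy
    exact ⟨a, ha⟩

theorem IsFractionalColoring.of_map {W : Type*} {V : Type*} {G : SimpleGraph V} {e : V ↪ W} {r : ℝ}
    {X : W → Finset ℕ} (h : IsFractionalColoring (G.map e) r X) :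
    IsFractionalColoring G r fun v => X (e v) := by
  obtain ⟨p, q, ⟨h1, h2, h3, h4, h5⟩, h6⟩ := h
  exact ⟨p, q, ⟨h1, h2, fun v => h3 _, fun v => h4 _,
    fun v w hvw => h5 _ _ (SimpleGraph.map_adj_apply.2 hvw)⟩, h6⟩

theorem Params.isFractionalColoring_coloring (P : Params) {ε : ℝ} (hε : 0 < ε) {W : Type}
    [Fintype W] [DecidableEq W] {H : SimpleGraph W}
    (hP : ∀ x, prob (fun ω : P.Seed W => P.coloring ω H x = none) ≤ ε / (P.Δ + ε)) :
    IsFractionalColoring H (P.Δ + ε) fun v => encodeColors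
      fun x : P.Seed W × Fin P.Δ => P.coloring x.1 H v = some x.2 :=
  isFractionalColoring_of_prob (χ := fun (ω : P.Seed W) v => P.coloring ω H v)
    (fun _ => P.isProper_coloring) hε hP

/-- The seeds live on `Fin N` and not on the network, so one decoder `D` serves all networks
embedded by their identifiers. Nodes of `Fin N` outside the network are isolated and affect neither
degrees nor cliques harmfully. -/
theorem Params.exists_view_coloring (P : Params) {ε : ℝ} (hε : 0 < ε) (N : ℕ) [NeZero N]
    (hP : ∀ H : SimpleGraph (Fin N), (∀ x, degIn H Finset.univ x ≤ P.Δ) →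
      H.CliqueFree (P.Δ + 1) →
      ∀ x, prob (fun ω : P.Seed (Fin N) => P.coloring ω H x = none) ≤ ε / (P.Δ + ε)) :
    ∃ D : View → Finset ℕ, ∀ (V : Type u) [Fintype V] (G : SimpleGraph V) [DecidableRel G.Adj]
      (port : PortNumbering G) (e : V ↪ Fin N), G.maxDegree = P.Δ → G.CliqueFree (P.Δ + 1) →
      IsFractionalColoring G (P.Δ + ε)
        fun v => D (View.after G port (fun w => (e w : ℕ)) P.time v) := by
  obtain ⟨D, hD⟩ := IsLocal.comp (fun F : P.Seed (Fin N) → Option (Fin P.Δ) =>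
    encodeColors fun x : P.Seed (Fin N) × Fin P.Δ => F x.1 = some x.2)
    (IsLocal.pi fun ω : P.Seed (Fin N) => P.isLocal_coloring.{u} ω)
  refine ⟨D, fun V _ G _ port e hG hfree => ?_⟩
  have hne : Nonempty V := by
    by_contra hV
    rw [not_nonempty_iff] at hV
    rw [SimpleGraph.maxDegree_of_subsingleton] at hG
    have := P.three_le
    omega
  simp only [← hD V G port e]
  refine IsFractionalColoring.of_map (X := fun i => encodeColors
    fun x : P.Seed (Fin N) × Fin P.Δ => P.coloring x.1 (G.map e) i = some x.2) ?_
  exact P.isFractionalColoring_coloring hε <| hP _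
    (fun x => hG ▸ degIn_map_le_maxDegree e x) (SimpleGraph.cliqueFree_map_iff.2 hfree)

/-- For identifiers below `N`, views after `rounds ε Δ` rounds determine a fractional colouring. -/
theorem exists_view_coloring {ε : ℝ} (hε : 0 < ε) (N : ℕ) [NeZero N] {Δ : ℕ} (hΔ : 3 ≤ Δ) :
    ∃ D : View → Finset ℕ, ∀ (V : Type u) [Fintype V] (G : SimpleGraph V) [DecidableRel G.Adj]
      (port : PortNumbering G) (e : V ↪ Fin N), G.maxDegree = Δ → (ε < 1 → G.CliqueFree (Δ + 1)) →
      IsFractionalColoring G (Δ + ε)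
        fun v => D (View.after G port (fun w => (e w : ℕ)) (rounds ε Δ) v) := by
  rcases lt_or_ge ε 1 with hε1 | hε1
  · obtain ⟨D, hD⟩ := (Params.ofExponent hΔ (exponent ε Δ)).exists_view_coloring.{u} hε N
      fun H hdeg hfree x => (Params.prob_ofExponent_le hΔ hdeg hfree x).trans
        (three_div_pow_exponent_le hε hε1 hΔ)
    refine ⟨D, fun V _ G _ port e hG hfree => ?_⟩
    rw [rounds_of_lt hε1 hΔ]
    exact hD V G port e hG (hfree hε1)
  · obtain ⟨D, hD⟩ := isLocal_isFirst.{u} (N := N)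
    refine ⟨D, fun V _ G _ port e hG _ => ?_⟩
    rw [rounds_of_le hε1]
    simp only [← hD V G port e]
    exact IsFractionalColoring.of_map (X := fun i => encodeColors (IsFirst (G.map e) i))
      (isFractionalColoring_perm (fun x => hG ▸ degIn_map_le_maxDegree e x) hε1)

theorem exists_algorithm {ε : ℝ} (hε : 0 < ε) (c : ℕ) : ∃ A : LocalAlgorithm (Finset ℕ),
    ∀ (V : Type u) [Fintype V] (G : SimpleGraph V) [DecidableRel G.Adj]
      (port : PortNumbering G) (ident : V → ℕ),
      IsIdAssignment c ident → 3 ≤ G.maxDegree →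
      (ε < 1 → G.CliqueFree (G.maxDegree + 1)) →
      IsFractionalColoring G (G.maxDegree + ε)
        (A.outputAfter G port ident (rounds ε G.maxDegree)) := by
  -- Identifiers are at most `n ^ c`, so they embed into `Fin (n ^ c + 1)`. Each node reads `n` and
  -- `Δ` off its view and picks the matching decoder; the number of rounds involves neither `n` nor
  -- `c`.
  choose D hD using fun (n Δ : ℕ) (hΔ : 3 ≤ Δ) =>
    exists_view_coloring.{u} hε (n ^ c + 1) hΔ
  classical
  refine ⟨gatherAlgorithm fun w => if h : 3 ≤ w.maxDeg then D w.size w.maxDeg h w else ∅, ?_⟩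
  intro V _ G _ port ident hid hΔ hfree
  let e : V ↪ Fin (Fintype.card V ^ c + 1) :=
    ⟨fun v => ⟨ident v, Nat.lt_succ_of_le (hid.2 v).2⟩, fun v w h => hid.1 (Fin.mk.inj h)⟩
  refine Eq.mp (congrArg _ ?_) (hD (Fintype.card V) G.maxDegree hΔ V G port e rfl hfree)
  funext v
  rw [gatherAlgorithm_outputAfter]
  simp only [View.size_after, View.maxDeg_after, dif_pos hΔ]
  rfl

end Algorithm

theorem mainTheorem1 :
    ∃ T : ℝ → ℕ → ℕ,
      -- the number of rounds `T ε Δ` satisfies both time bounds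
      (∃ C : ℝ, 0 < C ∧ ∀ ε : ℝ, 0 < ε → ∀ Δ : ℕ, 3 ≤ Δ →
        (T ε Δ : ℝ) ≤ C * max 1
          ((Real.log Δ + Real.log (1 / ε) ^ 2 / Real.log Δ) * Real.log (Δ / ε)) ∧
        (T ε Δ : ℝ) ≤ C * max 1
          (Real.log Δ ^ 2 + Real.log (1 / ε) ^ 2 + Real.log (1 / ε) ^ 3 / Real.log Δ)) ∧
      -- the two time bounds are of the same order
      (∃ C : ℝ, 0 < C ∧ ∀ ε : ℝ, 0 < ε → ε ≤ 1 → ∀ Δ : ℕ, 3 ≤ Δ →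
        (Real.log Δ + Real.log (1 / ε) ^ 2 / Real.log Δ) * Real.log (Δ / ε) ≤
          C * (Real.log Δ ^ 2 + Real.log (1 / ε) ^ 2 + Real.log (1 / ε) ^ 3 / Real.log Δ) ∧
        Real.log Δ ^ 2 + Real.log (1 / ε) ^ 2 + Real.log (1 / ε) ^ 3 / Real.log Δ ≤
          C * ((Real.log Δ + Real.log (1 / ε) ^ 2 / Real.log Δ) * Real.log (Δ / ε))) ∧
      -- for `ε > 1 / Δ ^ a` the bound is `O(log² Δ)`
      (∀ a : ℝ, 0 < a → ∃ C : ℝ, 0 < C ∧ ∀ Δ : ℕ, 3 ≤ Δ → ∀ ε : ℝ, 1 / (Δ : ℝ) ^ a < ε →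
        (T ε Δ : ℝ) ≤ C * Real.log Δ ^ 2) ∧
      -- a deterministic algorithm computes the coloring within `T ε Δ` rounds
      (∀ ε : ℝ, 0 < ε → ∀ c : ℕ, 1 ≤ c → ∃ A : LocalAlgorithm (Finset ℕ),
        ∀ (V : Type u) [Fintype V] (G : SimpleGraph V) [DecidableRel G.Adj]
          (port : PortNumbering G) (ident : V → ℕ),
          IsIdAssignment c ident → 3 ≤ G.maxDegree →
          (ε < 1 → G.CliqueFree (G.maxDegree + 1)) →
          IsFractionalColoring G (G.maxDegree + ε)
            (A.outputAfter G port ident (T ε G.maxDegree))) := by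
  -- The constant of `rounds_le`, doubled for the passage to the second bound by
  -- `bounds_comparable`.
  refine ⟨rounds, ⟨24000000, by norm_num, fun ε hε Δ hΔ => ?_⟩,
    ⟨2, by norm_num, fun ε hε hε1 Δ hΔ => ?_⟩,
    fun a ha => ⟨12000000 * ((1 + a ^ 2) * (1 + a)), by positivity,
      fun Δ hΔ ε hε => rounds_le_of_lt ha hΔ hε⟩,
    fun ε hε c _ => exists_algorithm hε c⟩
  · have hx := one_le_log_natCast hΔ
    rcases lt_or_ge ε 1 with hε1 | hε1
    · have hy : 0 ≤ Real.log (1 / ε) := Real.log_nonneg (one_le_one_div hε hε1.le)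
      have h := rounds_le hε hε1 hΔ
      obtain ⟨h1, h2⟩ := bounds_comparable (x := Real.log Δ) (by linarith) hy
      rw [log_natCast_div hε hΔ] at h ⊢
      have h3 := le_max_right 1 ((Real.log Δ + Real.log (1 / ε) ^ 2 / Real.log Δ) *
        (Real.log Δ + Real.log (1 / ε)))
      have h4 := le_max_right 1
        (Real.log Δ ^ 2 + Real.log (1 / ε) ^ 2 + Real.log (1 / ε) ^ 3 / Real.log Δ)
      have h5 : 0 ≤ (Real.log Δ + Real.log (1 / ε) ^ 2 / Real.log Δ) *
        (Real.log Δ + Real.log (1 / ε)) := by positivity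
      exact ⟨by linarith, by linarith⟩
    · rw [rounds_of_le hε1, Nat.cast_one]
      have h : ∀ z : ℝ, 1 ≤ 24000000 * max 1 z := fun z => by linarith [le_max_left 1 z]
      exact ⟨h _, h _⟩
  · have hx := one_le_log_natCast hΔ
    have hy : 0 ≤ Real.log (1 / ε) := Real.log_nonneg (one_le_one_div hε hε1)
    obtain ⟨h1, h2⟩ := bounds_comparable (x := Real.log Δ) (by linarith) hy
    rw [log_natCast_div hε hΔ]
    have h5 : 0 ≤ (Real.log Δ + Real.log (1 / ε) ^ 2 / Real.log Δ) *
      (Real.log Δ + Real.log (1 / ε)) := by positivity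
    exact ⟨h1, by linarith⟩
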